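/- Let $G$ be a countable directed graph (loops and multiple edges allowed) with vertex set $V$, edge set $E$, source and range maps $s,r:E\to V$. Let $F:E\to\mathbb R$ be a function and $\beta\in\mathbb R$. Let $V_\infty\subseteq V$ be the set of sinks (vertices emitting no edge) and infinite emitters. A finite path is a vertex or a composable string $\mu=e_1\cdots e_n$ of edges ($r(e_i)=s(e_{i+1})$); put $F(\mu)=\sum_i F(e_i)$ and $F(v)=0$ for $v\in V$. Let $\Omega_G$ be the set of all infinite paths and all finite paths ending in $V_\infty$, let $Z(\mu)\subseteq\Omega_G$ be the set of elements that begin with the finite path $\mu$ (so $Z(v)=\{x: s(x)=v\}$), and give $\Omega_G$ the topology with basis the sets $Z(\mu)\setminus\bigcup_{\nu\in A}Z(\nu)$, $A$ a finite set of finite paths. Let $\mathcal G$ be the étale groupoid of all triples $\gamma=(\mu x,|\mu|-|\mu'|,\mu'x)$, with range $r(\gamma)=\mu x$, source $s(\gamma)=\mu'x$, product $(x,k,y)(y,l,z)=(x,k+l,z)$ and inverse $(x,k,y)^{-1}=(y,-k,x)$, and with topology generated by the sets $\{(\mu x,|\mu|-|\mu'|,\mu'x): \mu x\in Z(\mu)\setminus\bigcup_{\nu\in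 A}Z(\nu),\ \mu'x\in Z(\mu')\setminus\bigcup_{\nu\in B}Z(\nu)\}$, where $r(\mu)=r(\mu')$ and $A,B$ are finite. Let $c_F(\mu x,|\mu|-|\mu'|,\mu'x)=F(\mu)-F(\mu')$. Identify $C^*(G)$ with the reduced groupoid $C^*$-algebra $C^*_r(\mathcal G)$, let $P_v\in C^*(G)$ be the projection given by the characteristic function of $\{(x,0,x):x\in Z(v)\}$, and let $\alpha^F$ be the one-parameter group of automorphisms of $C^*(G)$ with $\alpha^F_t(f)=e^{itc_F}f$ for $f\in C_c(\mathcal G)$; the gauge action is $\alpha^1$. A *$\beta$-KMS measure* is a regular Borel measure $m$ on $\Omega_G$ which is $(\mathcal G,c_F)$-conformal with exponent $\beta$, that is, $$m(s(W))=\int_{r(W)}e^{\beta c_F(r_W^{-1}(x))}\,dm(x)$$ for every open bisection $W\subseteq\mathcal G$ (an open set on which $r$ and $s$ are injective), where $r_W^{-1}$ is the inverse of $r:W\to r(W)$. Put $A(\beta)_{vw}=\sum_{s(e)=v,\,r(e)=w}e^{-\beta F(e)}\in[0,\infty]$. A vector $\psi\in[0,\infty[^V$ is *almost $A(\beta)$-harmonic*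 when $\sum_w A(\beta)_{vw}\psi_w\le\psi_v$ for all $v\in V$, with equality for all $v\in V\setminus V_\infty$. A weight is *proper* when it is non-zero, densely defined and lower semi-continuous. A *$\beta$-KMS weight* for $\alpha^F$ is a proper weight $\varphi$ on $C^*(G)$ such that $\varphi\circ\alpha^F_t=\varphi$ for all $t\in\mathbb R$ and such that for all $a,b\in\mathcal N_\varphi\cap\mathcal N_\varphi^*$, where $\mathcal N_\varphi=\{a:\varphi(a^*a)<\infty\}$, there is a continuous bounded function $f$ on the closed strip of complex numbers with imaginary part between $0$ and $\beta$, holomorphic in its interior, with $f(t)=\varphi(a\alpha^F_t(b))$ and $f(t+i\beta)=\varphi(\alpha^F_t(b)a)$ for all $t\in\mathbb R$. It is *gauge invariant* when $\varphi\circ\alpha^1_t=\varphi$ for all $t\in\mathbb R$. Then the following hold. 1. The map $m\mapsto (m(Z(v)))_{v\in V}$ is a bijection from the $\beta$-KMS measures on $\Omega_G$ onto the almost $A(\beta)$-harmonic vectors on $V$. 2. There is a map $m\mapsto\varphi_m$ which is an affine bijection from the non-zero $\beta$-KMS measures onto the gauge invariant $\beta$-KMS weights for $\alpha^F$, such that $\varphi_m(f)=\int_{\Omega_G}f(x,0,x)\,dm(x)$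 for all $f\in C_c(\mathcal G)$. The map $m\mapsto(m(Z(v)))_{v\in V}$ is an affine bijection from the non-zero $\beta$-KMS measures onto the non-zero almost $A(\beta)$-harmonic vectors. The map $\varphi\mapsto(\varphi(P_v))_{v\in V}$ is an affine bijection from the gauge invariant $\beta$-KMS weights for $\alpha^F$ onto the non-zero almost $A(\beta)$-harmonic vectors. (Each of the three sets is closed under linear combinations with positive coefficients, and affine means that these are preserved.) -/

import Mathlib

open scoped ENNReal NNReal Topology

namespace GraphKMS

/-! ### Directed graphs and their path spaces -/

/-- A directed graph with vertex set `V`, edge set `E`, source map `s` and range map `r`.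
Loops and multiple edges are allowed. -/
structure EGraph (V E : Type*) where
  s : E → V
  r : E → V

section Graph

variable {V E : Type*} (G : EGraph V E)

/-- `V_∞`: the vertices that are sinks or infinite emitters. -/
def EGraph.singular : Set V := {v | {e | G.s e = v} = ∅ ∨ {e | G.s e = v}.Infinite}

/-- The list of edges `l` can be walked through, one after the other, starting at `v`. -/
def EGraph.IsWalk : V → List E → Prop
  | _, [] => True
  | v, e :: l => G.s e = v ∧ EGraph.IsWalk (G.r e) l

/-- The last vertex of the walk `l` from `v`. -/
def EGraph.walkEnd : V → List E → V
  | v, [] => v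
  | _, e :: l => EGraph.walkEnd (G.r e) l

/-- Finite paths; those without edges are the vertices. -/
structure FinPath where
  src : V
  edges : List E
  isWalk : G.IsWalk src edges

/-- Infinite paths. -/
structure InfPath where
  edge : ℕ → E
  isWalk : ∀ i, G.r (edge i) = G.s (edge (i + 1))

variable {G}

/-- The length `|μ|`. -/
abbrev FinPath.length (μ : FinPath G) : ℕ := μ.edges.length

/-- The range `r(μ)`. -/
def FinPath.range (μ : FinPath G) : V := G.walkEnd μ.src μ.edges

/-- A vertex as a path of length `0`. -/
def FinPath.ofVertex (G : EGraph V E) (v : V) : FinPath G := ⟨v, [], trivial⟩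

/-- The extension of `F : E → ℝ` to finite paths. -/
def FinPath.weight (F : E → ℝ) (μ : FinPath G) : ℝ := (μ.edges.map F).sum

variable (G) in
/-- The path space `Ω_G`: infinite paths, and finite paths ending in `V_∞`. -/
inductive PathSpace where
  | infinite (p : InfPath G) : PathSpace
  | finite (p : FinPath G) (h : p.range ∈ G.singular) : PathSpace

/-- The source of an element of `Ω_G`. -/
def PathSpace.src : PathSpace G → V
  | .infinite p => G.s (p.edge 0)
  | .finite p _ => p.src

/-- The `i`-th edge (counted from `0`) of an element of `Ω_G`, if there is one. -/
def PathSpace.edge : PathSpace G → ℕ → Option E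
  | .infinite p, i => some (p.edge i)
  | .finite p _, i => p.edges[i]?

/-- The cylinder set `Z(μ)`: the elements of `Ω_G` which begin with `μ`. -/
def cylinder (μ : FinPath G) : Set (PathSpace G) :=
  {x | x.src = μ.src ∧ ∀ i < μ.length, x.edge i = μ.edges[i]?}

/-- `Z_F(μ) = Z(μ) \ ⋃_{ν ∈ F} Z(ν)`. -/
def cylinderDiff (μ : FinPath G) (F : Finset (FinPath G)) : Set (PathSpace G) :=
  cylinder μ \ ⋃ ν ∈ F, cylinder ν

/-- The topology of `Ω_G`, generated by the sets `Z_F(μ)`. -/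
instance : TopologicalSpace (PathSpace G) :=
  TopologicalSpace.generateFrom {U | ∃ μ F, U = cylinderDiff μ F}

instance : MeasurableSpace (PathSpace G) := borel _

instance : BorelSpace (PathSpace G) := ⟨rfl⟩

/-! ### Concatenation -/

lemma isWalk_append {v : V} {l k : List E} :
    G.IsWalk v (l ++ k) ↔ G.IsWalk v l ∧ G.IsWalk (G.walkEnd v l) k := by
  induction l generalizing v with
  | nil => simp [EGraph.IsWalk, EGraph.walkEnd]
  | cons e l ih => simp [EGraph.IsWalk, EGraph.walkEnd, ih, and_assoc]

lemma walkEnd_append {v : V} {l k : List E} :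
    G.walkEnd v (l ++ k) = G.walkEnd (G.walkEnd v l) k := by
  induction l generalizing v with
  | nil => simp [EGraph.walkEnd]
  | cons e l ih => simp [EGraph.walkEnd, ih]

/-- The concatenation `μν` of finite paths. -/
def FinPath.append (μ ν : FinPath G) (h : ν.src = μ.range) : FinPath G :=
  ⟨μ.src, μ.edges ++ ν.edges, isWalk_append.2 ⟨μ.isWalk, by
    have hν := ν.isWalk
    rw [h] at hν
    exact hν⟩⟩

lemma FinPath.range_append (μ ν : FinPath G) (h : ν.src = μ.range) :
    (μ.append ν h).range = ν.range := by
  simp only [FinPath.range, FinPath.append, walkEnd_append]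
  rw [← FinPath.range, ← h]

/-- The sequence `l` followed by the sequence `p`. -/
def seqAppend (l : List E) (p : ℕ → E) (i : ℕ) : E := (l[i]?).getD (p (i - l.length))

lemma seqAppend_isWalk {v : V} {l : List E} {p : ℕ → E} (hl : G.IsWalk v l)
    (h : G.s (p 0) = G.walkEnd v l) (hp : ∀ i, G.r (p i) = G.s (p (i + 1))) (i : ℕ) :
    G.r (seqAppend l p i) = G.s (seqAppend l p (i + 1)) := by
  induction l generalizing v i with
  | nil => simpa [seqAppend] using hp i
  | cons e l ih =>
    cases i with
    | zero =>
      cases l with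
      | nil => simpa [seqAppend, EGraph.walkEnd] using h.symm
      | cons e' l => simpa [seqAppend] using hl.2.1.symm
    | succ i => simpa [seqAppend] using ih hl.2 h i

/-- The concatenation `μx`. -/
def concat (μ : FinPath G) : (x : PathSpace G) → x.src = μ.range → PathSpace G
  | .infinite p, h => .infinite ⟨seqAppend μ.edges p.edge, seqAppend_isWalk μ.isWalk h p.isWalk⟩
  | .finite p hp, h => .finite (μ.append p h) ((μ.range_append p h).symm ▸ hp)

lemma concat_src (μ : FinPath G) (x : PathSpace G) (h : x.src = μ.range) :
    (concat μ x h).src = μ.src := by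
  cases x with
  | finite p hp => rfl
  | infinite p =>
    obtain ⟨v, l, hl⟩ := μ
    cases l with
    | nil => simpa [concat, PathSpace.src, seqAppend, FinPath.range, EGraph.walkEnd] using h
    | cons e l => simpa [concat, PathSpace.src, seqAppend] using hl.1

lemma concat_edge (μ : FinPath G) (x : PathSpace G) (h : x.src = μ.range) (i : ℕ) :
    (concat μ x h).edge i = if i < μ.length then μ.edges[i]? else x.edge (i - μ.length) := by
  cases x with
  | finite p hp =>
    simp only [concat, PathSpace.edge, FinPath.append, FinPath.length]
    exact List.getElem?_append
  | infinite p =>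
    simp only [concat, PathSpace.edge, seqAppend, FinPath.length]
    split_ifs with hi
    · simp [hi]
    · rw [List.getElem?_eq_none (not_lt.1 hi), Option.getD_none]

lemma PathSpace.ext' {x y : PathSpace G} (h : x.src = y.src) (he : ∀ i, x.edge i = y.edge i) :
    x = y := by
  cases x with
  | infinite p =>
    cases y with
    | infinite q =>
      obtain ⟨p, hp⟩ := p
      obtain ⟨q, hq⟩ := q
      have : p = q := funext fun i => by simpa [PathSpace.edge] using he i
      subst this
      rfl
    | finite q hq => simpa [PathSpace.edge] using he q.edges.length
  | finite p hp =>
    cases y with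
    | infinite q => simpa [PathSpace.edge] using he p.edges.length
    | finite q hq =>
      obtain ⟨v, l, hl⟩ := p
      obtain ⟨w, k, hk⟩ := q
      have h1 : v = w := h
      have h2 : l = k := List.ext_getElem? he
      subst h1 h2
      rfl

lemma concat_append (μ ν : FinPath G) (x : PathSpace G) (h : ν.src = μ.range)
    (hx : x.src = ν.range) :
    concat (μ.append ν h) x (hx.trans (μ.range_append ν h).symm) =
      concat μ (concat ν x hx) ((concat_src ν x hx).trans h) := by
  refine PathSpace.ext' ?_ fun i => ?_
  · rw [concat_src, concat_src]; rfl
  · simp only [concat_edge, FinPath.append, FinPath.length, List.length_append,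
      List.getElem?_append]
    by_cases h1 : i < μ.edges.length
    · rw [if_pos h1, if_pos (by omega), if_pos h1]
    · by_cases h2 : i - μ.edges.length < ν.edges.length
      · rw [if_neg h1, if_pos (by omega), if_neg h1, if_pos h2]
      · rw [if_neg (by omega), if_neg h1, if_neg h2, Nat.sub_sub]

lemma concat_injective (μ : FinPath G) {x y : PathSpace G} (hx : x.src = μ.range)
    (hy : y.src = μ.range) (h : concat μ x hx = concat μ y hy) : x = y := by
  refine PathSpace.ext' (hx.trans hy.symm) fun i => ?_
  have := congrArg (fun z => z.edge (i + μ.length)) h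
  simpa [concat_edge] using this

lemma concat_edges_take {μ ν : FinPath G} {x y : PathSpace G} {hx : x.src = μ.range}
    {hy : y.src = ν.range} (h : concat μ x hx = concat ν y hy) (hl : μ.length ≤ ν.length) :
    μ.edges = ν.edges.take μ.length := by
  refine List.ext_getElem? fun i => ?_
  by_cases hi : i < μ.length
  · have := congrArg (fun z => z.edge i) h
    simp only [concat_edge, if_pos hi, if_pos (hi.trans_le hl)] at this
    rw [List.getElem?_take, if_pos hi, this]
  · rw [List.getElem?_eq_none (not_lt.1 hi), List.getElem?_take, if_neg hi]

/-- If `μx = νy` and `|μ| ≤ |ν|` then `ν = μκ` and `x = κy` for some `κ`. -/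
lemma concat_eq_concat {μ ν : FinPath G} {x y : PathSpace G} {hx : x.src = μ.range}
    {hy : y.src = ν.range} (h : concat μ x hx = concat ν y hy) (hl : μ.length ≤ ν.length) :
    ∃ (κ : FinPath G) (hκ : κ.src = μ.range) (hy' : y.src = κ.range),
      ν = μ.append κ hκ ∧ x = concat κ y hy' := by
  have hsrc : μ.src = ν.src := by
    rw [← concat_src μ x hx, h, concat_src]
  obtain ⟨v, l, hwl⟩ := μ
  obtain ⟨w, k, hwk⟩ := ν
  have hsrc' : v = w := hsrc
  subst hsrc'
  have ht : k = l ++ k.drop l.length := by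
    have h1 : l = k.take l.length := concat_edges_take h hl
    calc k = k.take l.length ++ k.drop l.length := (List.take_append_drop _ _).symm
      _ = l ++ k.drop l.length := by rw [← h1]
  generalize k.drop l.length = k' at ht
  subst ht
  let κ : FinPath G := ⟨G.walkEnd v l, k', (isWalk_append.1 hwk).2⟩
  have hyκ : y.src = κ.range := hy.trans walkEnd_append
  refine ⟨κ, rfl, hyκ, rfl, concat_injective _ hx (concat_src κ y hyκ) ?_⟩
  rw [h, ← concat_append ⟨v, l, hwl⟩ κ y rfl hyκ]
  rfl

lemma weight_append (F : E → ℝ) (μ ν : FinPath G) (h : ν.src = μ.range) :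
    (μ.append ν h).weight F = μ.weight F + ν.weight F := by
  simp [FinPath.weight, FinPath.append]

lemma length_append (μ ν : FinPath G) (h : ν.src = μ.range) :
    (μ.append ν h).length = μ.length + ν.length := by
  simp [FinPath.length, FinPath.append]

lemma append_right_eq {μ ν : FinPath G} {x y : PathSpace G} {hx : x.src = μ.range}
    {hy : y.src = ν.range} (h : concat μ x hx = concat ν y hy) (hl : μ.length = ν.length) :
    μ = ν := by
  obtain ⟨κ, hκ, hy', rfl, -⟩ := concat_eq_concat h hl.le
  rw [length_append] at hl
  have : κ.edges = [] := List.eq_nil_of_length_eq_zero (by unfold FinPath.length at hl; omega)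
  obtain ⟨v, l, hwl⟩ := μ
  simp [FinPath.append, this]

/-! ### The groupoid of the graph -/

variable (G) in
/-- The groupoid `𝒢` of `G`: the triples `(μx, |μ| - |μ'|, μ'x)`. -/
@[ext] structure Gpd where
  rng : PathSpace G
  lag : ℤ
  src : PathSpace G
  exists_rep : ∃ (μ μ' : FinPath G) (x : PathSpace G) (h : x.src = μ.range)
    (h' : x.src = μ'.range), rng = concat μ x h ∧ lag = (μ.length : ℤ) - μ'.length ∧
      src = concat μ' x h'

/-- The element `(μx, |μ| - |μ'|, μ'x)` of `𝒢`. -/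
def Gpd.mk' (μ μ' : FinPath G) (x : PathSpace G) (h : x.src = μ.range)
    (h' : x.src = μ'.range) : Gpd G :=
  ⟨concat μ x h, (μ.length : ℤ) - μ'.length, concat μ' x h', μ, μ', x, h, h', rfl, rfl, rfl⟩

lemma Gpd.exists_eq_mk' (g : Gpd G) : ∃ μ μ' x h h', g = Gpd.mk' μ μ' x h h' := by
  obtain ⟨a, k, b, μ, μ', x, h, h', rfl, rfl, rfl⟩ := g
  exact ⟨μ, μ', x, h, h', rfl⟩

/-- The cocycle `c_F`. The choice of the representation does not matter: see `cocycle_mk'`. -/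
noncomputable def cocycle (F : E → ℝ) (g : Gpd G) : ℝ :=
  g.exists_rep.choose.weight F - g.exists_rep.choose_spec.choose.weight F

lemma weight_sub_eq (F : E → ℝ) {μ μ' ν ν' : FinPath G} {x y : PathSpace G}
    {h : x.src = μ.range} {h' : x.src = μ'.range} {k : y.src = ν.range} {k' : y.src = ν'.range}
    (e : concat μ x h = concat ν y k) (e' : concat μ' x h' = concat ν' y k')
    (hlag : (μ.length : ℤ) - μ'.length = (ν.length : ℤ) - ν'.length) :
    μ.weight F - μ'.weight F = ν.weight F - ν'.weight F := by
  wlog hl : μ.length ≤ ν.length generalizing μ μ' ν ν' x y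
  · exact (this e.symm e'.symm hlag.symm (by omega)).symm
  obtain ⟨κ, hκ, hy, rfl, rfl⟩ := concat_eq_concat e hl
  have hκ' : κ.src = μ'.range := (concat_src κ y hy).symm.trans h'
  rw [← concat_append μ' κ y hκ' hy] at e'
  have := append_right_eq e' (by rw [length_append] at *; omega)
  subst this
  rw [weight_append, weight_append]
  ring

/-- `c_F(μx, |μ| - |μ'|, μ'x) = F(μ) - F(μ')`. -/
lemma cocycle_mk' (F : E → ℝ) (μ μ' : FinPath G) (x : PathSpace G) (h : x.src = μ.range)
    (h' : x.src = μ'.range) : cocycle F (Gpd.mk' μ μ' x h h') = μ.weight F - μ'.weight F := by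
  obtain ⟨y, k, k', e, hlag, e'⟩ := (Gpd.mk' μ μ' x h h').exists_rep.choose_spec.choose_spec
  exact (weight_sub_eq F e e' hlag).symm

/-- Inversion in `𝒢`. -/
def Gpd.inv (g : Gpd G) : Gpd G :=
  ⟨g.src, -g.lag, g.rng, by
    obtain ⟨a, k, b, μ, μ', x, h, h', rfl, rfl, rfl⟩ := g
    exact ⟨μ', μ, x, h', h, rfl, by ring, rfl⟩⟩

/-- Composable elements of `𝒢` have representations `(αz, ·, βz)` and `(βz, ·, γz)`. -/
lemma Gpd.exists_common (g h : Gpd G) (hgh : g.src = h.rng) :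
    ∃ α β γ z hα hβ hγ, g = Gpd.mk' α β z hα hβ ∧ h = Gpd.mk' β γ z hβ hγ := by
  obtain ⟨μ, μ', x, hx, hx', rfl⟩ := g.exists_eq_mk'
  obtain ⟨ν, ν', y, hy, hy', rfl⟩ := h.exists_eq_mk'
  have e : concat μ' x hx' = concat ν y hy := hgh
  rcases le_total μ'.length ν.length with hl | hl
  · obtain ⟨κ, hκ, hyκ, rfl, rfl⟩ := concat_eq_concat e hl
    have hμ : κ.src = μ.range := (concat_src κ y hyκ).symm.trans hx
    refine ⟨μ.append κ hμ, μ'.append κ hκ, ν', y, hyκ.trans (μ.range_append κ hμ).symm, hy, hy',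
      ?_, rfl⟩
    ext1
    · exact (concat_append μ κ y hμ hyκ).symm
    · simp only [Gpd.mk', length_append]; push_cast; ring
    · exact (concat_append μ' κ y hκ hyκ).symm
  · obtain ⟨κ, hκ, hxκ, rfl, rfl⟩ := concat_eq_concat e.symm hl
    have hν : κ.src = ν'.range := (concat_src κ x hxκ).symm.trans hy'
    refine ⟨μ, ν.append κ hκ, ν'.append κ hν, x, hx, hx', hxκ.trans (ν'.range_append κ hν).symm,
      rfl, ?_⟩
    ext1
    · exact (concat_append ν κ x hκ hxκ).symm
    · simp only [Gpd.mk', length_append]; push_cast; ring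
    · exact (concat_append ν' κ x hν hxκ).symm

/-- The product in `𝒢`. -/
def Gpd.comp (g h : Gpd G) (hgh : g.src = h.rng) : Gpd G :=
  ⟨g.rng, g.lag + h.lag, h.src, by
    obtain ⟨α, β, γ, z, hα, hβ, hγ, rfl, rfl⟩ := g.exists_common h hgh
    exact ⟨α, γ, z, hα, hγ, rfl, by simp only [Gpd.mk']; ring, rfl⟩⟩

/-- The unit `(x, 0, x)`. -/
def Gpd.unit (x : PathSpace G) : Gpd G :=
  ⟨x, 0, x, by
    have h : x = concat (FinPath.ofVertex G x.src) x rfl := by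
      refine PathSpace.ext' (concat_src (FinPath.ofVertex G x.src) x rfl).symm fun i => ?_
      simp [concat_edge, FinPath.ofVertex, FinPath.length]
    exact ⟨FinPath.ofVertex G x.src, FinPath.ofVertex G x.src, x, rfl, rfl, h, by simp, h⟩⟩

lemma cocycle_comp (F : E → ℝ) (g h : Gpd G) (hgh : g.src = h.rng) :
    cocycle F (g.comp h hgh) = cocycle F g + cocycle F h := by
  obtain ⟨α, β, γ, z, hα, hβ, hγ, rfl, rfl⟩ := g.exists_common h hgh
  have : (Gpd.mk' α β z hα hβ).comp (Gpd.mk' β γ z hβ hγ) hgh = Gpd.mk' α γ z hα hγ := by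
    ext1
    · rfl
    · simp only [Gpd.mk', Gpd.comp]; ring
    · rfl
  rw [this, cocycle_mk', cocycle_mk', cocycle_mk']
  ring

lemma cocycle_inv (F : E → ℝ) (g : Gpd G) : cocycle F g.inv = - cocycle F g := by
  obtain ⟨μ, μ', x, hx, hx', rfl⟩ := g.exists_eq_mk'
  have : (Gpd.mk' μ μ' x hx hx').inv = Gpd.mk' μ' μ x hx' hx := by
    ext1
    · rfl
    · simp only [Gpd.mk', Gpd.inv]; ring
    · rfl
  rw [this, cocycle_mk', cocycle_mk']
  ring

/-- `γη⁻¹`, for `γ, η` with the same source. -/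
def Gpd.mulInv (γ η : Gpd G) (h : η.src = γ.src) : Gpd G :=
  γ.comp η.inv (show γ.src = η.src from h.symm)

lemma cocycle_mulInv (F : E → ℝ) (γ η : Gpd G) (h : η.src = γ.src) :
    cocycle F (γ.mulInv η h) = cocycle F γ - cocycle F η := by
  unfold Gpd.mulInv
  exact (cocycle_comp F _ _ _).trans (by rw [cocycle_inv, sub_eq_add_neg])

/-- The basic open sets `{(μx, |μ| - |μ'|, μ'x) : μx ∈ Z_A(μ), μ'x ∈ Z_B(μ')}` of `𝒢`. -/
def basicSet (μ μ' : FinPath G) (A B : Finset (FinPath G)) : Set (Gpd G) :=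
  {g | ∃ x h h', g = Gpd.mk' μ μ' x h h' ∧ concat μ x h ∈ cylinderDiff μ A ∧
    concat μ' x h' ∈ cylinderDiff μ' B}

/-- The topology of `𝒢`. -/
instance : TopologicalSpace (Gpd G) :=
  TopologicalSpace.generateFrom {U | ∃ μ μ' A B, μ.range = μ'.range ∧ U = basicSet μ μ' A B}

lemma concat_mem_cylinder (μ : FinPath G) (x : PathSpace G) (h : x.src = μ.range) :
    concat μ x h ∈ cylinder μ :=
  ⟨concat_src μ x h, fun i hi => by rw [concat_edge, if_pos hi]⟩

lemma continuous_cocycle (F : E → ℝ) : Continuous (cocycle F : Gpd G → ℝ) := by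
  refine continuous_iff_continuousAt.2 fun g => ?_
  obtain ⟨μ, μ', x, hx, hx', rfl⟩ := g.exists_eq_mk'
  have ho : IsOpen (basicSet μ μ' ∅ ∅) :=
    TopologicalSpace.isOpen_generateFrom_of_mem ⟨μ, μ', ∅, ∅, hx.symm.trans hx', rfl⟩
  have hm : Gpd.mk' μ μ' x hx hx' ∈ basicSet μ μ' ∅ ∅ :=
    ⟨x, hx, hx', rfl, by simpa [cylinderDiff] using concat_mem_cylinder μ x hx,
      by simpa [cylinderDiff] using concat_mem_cylinder μ' x hx'⟩
  refine (continuousAt_const (y := μ.weight F - μ'.weight F)).congr ?_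
  filter_upwards [ho.mem_nhds hm] with g hg
  obtain ⟨y, hy, hy', rfl, -⟩ := hg
  rw [cocycle_mk']

/-! ### Conformal measures and almost harmonic vectors -/

/-- Open bisections: open sets on which the range and the source map are injective. -/
def IsOpenBisection (W : Set (Gpd G)) : Prop :=
  IsOpen W ∧ Set.InjOn Gpd.rng W ∧ Set.InjOn Gpd.src W

/-- `γ ↦ e^{β c_F(γ)}` on the bisection `W`, as a function of the range of `γ`, that is,
the function `x ↦ e^{β c_F(r_W⁻¹(x))}` on `r(W)` (extended by zero). -/
noncomputable def bisectionDensity (F : E → ℝ) (β : ℝ) (W : Set (Gpd G)) :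
    PathSpace G → ℝ≥0∞ :=
  Function.extend (fun g : W => g.1.rng)
    (fun g : W => ENNReal.ofReal (Real.exp (β * cocycle F g.1))) 0

/-- `β`-KMS measures: regular Borel measures on `Ω_G` which are `(𝒢, c_F)`-conformal with
exponent `β`. -/
def IsKMSMeasure (F : E → ℝ) (β : ℝ) (m : MeasureTheory.Measure (PathSpace G)) : Prop :=
  m.Regular ∧ ∀ W : Set (Gpd G), IsOpenBisection W →
    m (Gpd.src '' W) = ∫⁻ x in Gpd.rng '' W, bisectionDensity F β W x ∂m

/-- The vector `(m(Z(v)))_v`. -/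
noncomputable def vertexVector (m : MeasureTheory.Measure (PathSpace G)) (v : V) : ℝ≥0∞ :=
  m (cylinder (FinPath.ofVertex G v))

variable (G) in
/-- The matrix `A(β)`. -/
noncomputable def weightMatrix (F : E → ℝ) (β : ℝ) (v w : V) : ℝ≥0∞ :=
  ∑' e : {e : E // G.s e = v ∧ G.r e = w}, ENNReal.ofReal (Real.exp (-β * F e))

variable (G) in
/-- Almost `A(β)`-harmonic vectors in `[0,∞[^V`. -/
def IsAlmostHarmonic (F : E → ℝ) (β : ℝ) (ψ : V → ℝ≥0∞) : Prop :=
  (∀ v, ψ v ≠ ∞) ∧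
  (∀ v, ∑' w, weightMatrix G F β v w * ψ w ≤ ψ v) ∧
  (∀ v, v ∉ G.singular → ∑' w, weightMatrix G F β v w * ψ w = ψ v)

end Graph

/-! ### Weights on `C*`-algebras -/

section Weights

/-- The positive elements `b*b` of a `C*`-algebra. -/
def PosCone (A : Type*) [NonUnitalCStarAlgebra A] : Type _ := {a : A // ∃ b : A, a = star b * b}

variable {A : Type*} [NonUnitalCStarAlgebra A]

instance : CoeOut (PosCone A) A := ⟨Subtype.val⟩

instance : TopologicalSpace (PosCone A) :=
  inferInstanceAs (TopologicalSpace {a : A // ∃ b : A, a = star b * b})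

/-- The positive element `a*a`. -/
def starMulSelf (a : A) : PosCone A := ⟨star a * a, a, rfl⟩

/-- Weights: additive and positively homogeneous maps from the positive elements to `[0,∞]`. -/
@[ext] structure Weight (A : Type*) [NonUnitalCStarAlgebra A] where
  toFun : PosCone A → ℝ≥0∞
  map_add' : ∀ a b c : PosCone A, (c : A) = (a : A) + (b : A) → toFun c = toFun a + toFun b
  map_smul' : ∀ (t : ℝ≥0) (a b : PosCone A), (b : A) = ((t : ℝ) : ℂ) • (a : A) →
    toFun b = t * toFun a

instance : CoeFun (Weight A) (fun _ => PosCone A → ℝ≥0∞) := ⟨Weight.toFun⟩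

noncomputable instance : Add (Weight A) where
  add φ ψ :=
    { toFun := fun a => φ a + ψ a
      map_add' := fun a b c h => by rw [φ.map_add' a b c h, ψ.map_add' a b c h]; ring
      map_smul' := fun t a b h => by rw [φ.map_smul' t a b h, ψ.map_smul' t a b h]; ring }

noncomputable instance : SMul ℝ≥0 (Weight A) where
  smul k φ :=
    { toFun := fun a => k * φ a
      map_add' := fun a b c h => by rw [φ.map_add' a b c h]; ring
      map_smul' := fun t a b h => by rw [φ.map_smul' t a b h]; ring }

/-- Proper weights: non-zero, densely defined and lower semi-continuous. -/
def Weight.IsProper (φ : Weight A) : Prop :=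
  (∃ a, φ a ≠ 0) ∧ Dense {a | φ a < ∞} ∧ LowerSemicontinuous φ.toFun

/-- `a` lies in the linear span of the positive elements of finite weight, and the linear
extension of `φ` to this span takes the value `z` at `a`. -/
def Weight.HasValue (φ : Weight A) (a : A) (z : ℂ) : Prop :=
  ∃ p q u w : PosCone A, φ p < ∞ ∧ φ q < ∞ ∧ φ u < ∞ ∧ φ w < ∞ ∧
    a = ((p : A) - (q : A)) + Complex.I • ((u : A) - (w : A)) ∧
    z = ((φ p).toReal - (φ q).toReal : ℝ) + Complex.I * ((φ u).toReal - (φ w).toReal : ℝ)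

/-- `𝒩_φ ∩ 𝒩_φ*`. -/
def Weight.biDomain (φ : Weight A) : Set A :=
  {a | φ (starMulSelf a) < ∞ ∧ φ (starMulSelf (star a)) < ∞}

/-- `φ ∘ α_t = φ` for all `t`. -/
def Weight.IsInvariant (φ : Weight A) (α : ℝ → A ≃⋆ₐ[ℂ] A) : Prop :=
  ∀ (t : ℝ) (a b : PosCone A), (b : A) = α t a → φ b = φ a

/-- The closed strip of the complex numbers with imaginary part between `0` and `β`. -/
def strip (β : ℝ) : Set ℂ := {z | z.im ∈ Set.uIcc 0 β}

/-- `β`-KMS weights for `α`. -/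
def Weight.IsKMS (φ : Weight A) (α : ℝ → A ≃⋆ₐ[ℂ] A) (β : ℝ) : Prop :=
  φ.IsProper ∧ φ.IsInvariant α ∧
  ∀ a ∈ φ.biDomain, ∀ b ∈ φ.biDomain, ∃ f : ℂ → ℂ,
    ContinuousOn f (strip β) ∧ (∃ C, ∀ z ∈ strip β, ‖f z‖ ≤ C) ∧
    DifferentiableOn ℂ f (interior (strip β)) ∧
    ∀ t : ℝ, φ.HasValue (a * α t b) (f t) ∧ φ.HasValue (α t b * a) (f (t + β * Complex.I))

end Weights

/-! ### The reduced groupoid `C*`-algebra -/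

section CStar

variable {V E : Type*} (G : EGraph V E)

/-- The Hilbert space `ℓ²(𝒢)`, the direct sum of the spaces `ℓ²(s⁻¹(x))`, `x ∈ Ω_G`. -/
abbrev HilbertG : Type _ := lp (fun _ : Gpd G => ℂ) 2

variable {G}

/-- `T` is the operator of left convolution by `f` on `ℓ²(𝒢)`, that is, the direct sum of the
regular representations `π_x(f)` on `ℓ²(s⁻¹(x))`:
`(Tξ)(γ) = ∑ f(γη⁻¹) ξ(η)` with the sum over all `η` with `s(η) = s(γ)`. -/
def IsConvOp (f : Gpd G → ℂ) (T : HilbertG G →L[ℂ] HilbertG G) : Prop :=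
  ∀ (ξ : HilbertG G) (γ : Gpd G),
    HasSum (fun η : {η : Gpd G // η.src = γ.src} => f (γ.mulInv η.1 η.2) * ξ η.1) (T ξ γ)

variable (G) in
/-- The functions in `C_c(𝒢)`. -/
def IsCc (f : Gpd G → ℂ) : Prop := Continuous f ∧ HasCompactSupport f

variable (G) in
/-- The operators of convolution by functions in `C_c(𝒢)`. -/
def convOps : Set (HilbertG G →L[ℂ] HilbertG G) := {T | ∃ f, IsCc G f ∧ IsConvOp f T}

variable (G) in
/-- `C*(G) = C*_r(𝒢)`, as a norm closed algebra of operators on `ℓ²(𝒢)`: the completion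
of `C_c(𝒢)` in the norm `sup_x ‖π_x(f)‖`. -/
noncomputable def cstarSub : NonUnitalStarSubalgebra ℂ (HilbertG G →L[ℂ] HilbertG G) :=
  (NonUnitalStarAlgebra.adjoin ℂ (convOps G)).topologicalClosure

variable (G) in
/-- `C*(G) = C*_r(𝒢)` as a type. -/
abbrev CStarG : Type _ := cstarSub G

instance : IsClosed (cstarSub G : Set (HilbertG G →L[ℂ] HilbertG G)) :=
  NonUnitalStarSubalgebra.isClosed_topologicalClosure _

noncomputable instance : NonUnitalCStarAlgebra (CStarG G) :=
  NonUnitalStarSubalgebra.nonUnitalCStarAlgebra (cstarSub G)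

/-! ### The generalized gauge actions -/

lemma phase_mem (F : E → ℝ) (t : ℝ) (ξ : HilbertG G) :
    Memℓp (fun g => Complex.exp ((t * cocycle F g : ℝ) * Complex.I) * ξ g) 2 := by
  refine memℓp_gen ?_
  simpa only [norm_mul, Complex.norm_exp_ofReal_mul_I, one_mul] using
    (lp.memℓp ξ).summable (by norm_num)

/-- Multiplication by the function `e^{itc_F}`, a unitary operator on `ℓ²(𝒢)`. -/
noncomputable def phase (F : E → ℝ) (t : ℝ) : HilbertG G ≃ₗᵢ[ℂ] HilbertG G where
  toFun ξ := ⟨fun g => Complex.exp ((t * cocycle F g : ℝ) * Complex.I) * ξ g, phase_mem F t ξ⟩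
  invFun ξ := ⟨fun g => Complex.exp ((-t * cocycle F g : ℝ) * Complex.I) * ξ g,
    phase_mem F (-t) ξ⟩
  map_add' ξ η := by ext g; exact mul_add _ _ _
  map_smul' k ξ := by ext g; exact mul_left_comm _ _ _
  left_inv ξ := by ext g; simp [← mul_assoc, ← Complex.exp_add]
  right_inv ξ := by ext g; simp [← mul_assoc, ← Complex.exp_add]
  norm_map' ξ := by
    rw [lp.norm_eq_tsum_rpow (by norm_num), lp.norm_eq_tsum_rpow (by norm_num)]
    change (∑' g, ‖Complex.exp ((t * cocycle F g : ℝ) * Complex.I) * ξ g‖ ^ _) ^ _ = _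
    simp only [norm_mul, Complex.norm_exp_ofReal_mul_I, one_mul]

lemma phase_apply (F : E → ℝ) (t : ℝ) (ξ : HilbertG G) (g : Gpd G) :
    phase F t ξ g = Complex.exp ((t * cocycle F g : ℝ) * Complex.I) * ξ g := rfl

lemma phase_symm (F : E → ℝ) (t : ℝ) : (phase F t : HilbertG G ≃ₗᵢ[ℂ] HilbertG G).symm =
    phase F (-t) := by
  ext ξ g
  rfl

/-- Conjugation by the unitary `e^{itc_F}`; on convolution operators it multiplies the function
by `e^{itc_F}`. -/
noncomputable def conjPhase (F : E → ℝ) (t : ℝ) :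
    (HilbertG G →L[ℂ] HilbertG G) ≃⋆ₐ[ℂ] (HilbertG G →L[ℂ] HilbertG G) :=
  (phase F t).conjStarAlgEquiv

lemma conjPhase_apply (F : E → ℝ) (t : ℝ) (T : HilbertG G →L[ℂ] HilbertG G) (ξ : HilbertG G) :
    conjPhase F t T ξ = phase F t (T (phase F (-t) ξ)) := by
  rw [← phase_symm]
  rfl

lemma conjPhase_neg (F : E → ℝ) (t : ℝ) (T : HilbertG G →L[ℂ] HilbertG G) :
    conjPhase F (-t) T = (conjPhase F t).symm T := by
  rw [conjPhase, ← phase_symm]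
  rfl

lemma isConvOp_conjPhase (F : E → ℝ) (t : ℝ) {f : Gpd G → ℂ}
    {T : HilbertG G →L[ℂ] HilbertG G} (h : IsConvOp f T) :
    IsConvOp (fun g => Complex.exp ((t * cocycle F g : ℝ) * Complex.I) * f g)
      (conjPhase F t T) := by
  intro ξ γ
  rw [conjPhase_apply, phase_apply]
  refine (congrArg (fun k => HasSum k _) (funext fun η => ?_)).mpr
    ((h (phase F (-t) ξ) γ).mul_left (Complex.exp ((t * cocycle F γ : ℝ) * Complex.I)))
  have he : Complex.exp ((t * cocycle F (γ.mulInv η.1 η.2) : ℝ) * Complex.I) =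
      Complex.exp ((t * cocycle F γ : ℝ) * Complex.I) *
        Complex.exp ((-t * cocycle F η.1 : ℝ) * Complex.I) := by
    rw [← Complex.exp_add, cocycle_mulInv]
    congr 1
    push_cast
    ring
  simp only [phase_apply, he]
  ring

lemma conjPhase_mem (F : E → ℝ) (t : ℝ) {T : HilbertG G →L[ℂ] HilbertG G}
    (hT : T ∈ cstarSub G) : conjPhase F t T ∈ cstarSub G := by
  have hc : Continuous (conjPhase (G := G) F t) :=
    (phase F t).toContinuousLinearEquiv.conjContinuousAlgEquiv.continuous
  have h1 : NonUnitalStarAlgebra.adjoin ℂ (convOps G) ≤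
      (NonUnitalStarAlgebra.adjoin ℂ (convOps G)).comap (conjPhase F t) := by
    refine NonUnitalStarAlgebra.adjoin_le ?_
    rintro T ⟨f, ⟨hf, hs⟩, hT⟩
    refine NonUnitalStarAlgebra.subset_adjoin ℂ _ ⟨_, ⟨?_, hs.mul_left⟩, isConvOp_conjPhase F t hT⟩
    have := continuous_cocycle (G := G) F
    fun_prop
  exact map_mem_closure hc hT fun T hT => h1 hT

/-- The automorphism `α^F_t` of `C*(G)`, determined by `α^F_t(f) = e^{itc_F} f` for
`f ∈ C_c(𝒢)`. -/
noncomputable def gaugeAction (F : E → ℝ) (t : ℝ) : CStarG G ≃⋆ₐ[ℂ] CStarG G where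
  toFun T := ⟨conjPhase F t T, conjPhase_mem F t T.2⟩
  invFun T := ⟨conjPhase F (-t) T, conjPhase_mem F (-t) T.2⟩
  left_inv T := Subtype.ext (by simp only [conjPhase_neg, StarAlgEquiv.symm_apply_apply])
  right_inv T := Subtype.ext (by simp only [conjPhase_neg, StarAlgEquiv.apply_symm_apply])
  map_mul' S T := Subtype.ext (map_mul (conjPhase F t) (S : HilbertG G →L[ℂ] HilbertG G) T)
  map_add' S T := Subtype.ext (map_add (conjPhase F t) (S : HilbertG G →L[ℂ] HilbertG G) T)
  map_star' T := Subtype.ext (map_star (conjPhase F t) (T : HilbertG G →L[ℂ] HilbertG G))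
  map_smul' k T := Subtype.ext (map_smul (conjPhase F t) k (T : HilbertG G →L[ℂ] HilbertG G))

/-- Gauge invariant `β`-KMS weights for `α^F`. The gauge action is `α^F` for `F = 1`. -/
def IsGaugeKMSWeight (F : E → ℝ) (β : ℝ) (φ : Weight (CStarG G)) : Prop :=
  φ.IsKMS (gaugeAction F) β ∧ φ.IsInvariant (gaugeAction (fun _ => 1))

end CStar

/-- `f` is an affine bijection from `S` onto `T`. The sets in question are closed under linear
combinations with positive coefficients, not only under convex combinations. -/
def IsAffineBij {X Y : Type*} [Add X] [SMul ℝ≥0 X] [Add Y] [SMul ℝ≥0 Y] (f : X → Y)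
    (S : Set X) (T : Set Y) : Prop :=
  Set.BijOn f S T ∧ ∀ x ∈ S, ∀ y ∈ S, ∀ a b : ℝ≥0, 0 < a → 0 < b →
    a • x + b • y ∈ S ∧ f (a • x + b • y) = a • f x + b • f y

end GraphKMS

namespace GraphKMS

section PathSpaceTopology

variable {V E : Type*} {G : EGraph V E}

/-! ### Finite paths and cylinder sets -/

/-! Measures. Two cylinder sets are nested or disjoint, so a Borel measure that is finite on the
sets Z(v) is determined by its values on cylinders. Conformality on the bisection {(μx, |μ|, x)}
says that m(Z(μ)) = e^{-βF(μ)} m(Z(r(μ))), which is the content of `IsCylinderConformal`.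
Conversely, this identity gives conformality on every open bisection, because 𝒢 is a countable
disjoint union of bisections {(μx, |μ|-|ν|, νx)}, one for each pair (μ, ν) without common tail, and
c_F is constant on each of them (`isKMSMeasure_iff`). Hence m is determined by ψ_v = m(Z(v)), and
cutting Z(v) along the first edge shows that ψ is almost harmonic; the defect at v ∈ V_∞ is the mass
of the one-point set consisting of the path v. Given ψ, iterating the map `transfer` yields measures
with the right values on cylinders of length at most n, and a limit along an ultrafilter together
with the Riesz theorem gives the conformal measure (`exists_isCylinderConformal`).

From measures to weights. Every element of C*(G) is convolution by a continuous function `coeff` on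
𝒢, and the operators S_μS_ν* span a dense *-algebra (`mem_cstarSub_iff`). The weight φ_m integrates
the diagonal x ↦ a(x,0,x). In terms of the measure `gpdMeasure` on 𝒢 induced by m, φ_m(y*c) is the
L²-inner product of y and c, and inversion changes that measure by the density e^{-βc_F}. The KMS
function of a and b is therefore z ↦ ∫ e^{izc_F(γ)} a(γ⁻¹) b(γ) (`GraphRep.isKMS_kmsWeight`).

From weights to vectors. A KMS weight is finite on each P_v: averaging over the action produces
fixed elements of finite weight near P_v, and the KMS condition is a trace property on fixed
elements (`Weight.IsKMS.lt_top_of_average`). The KMS condition gives φ(S_μS_μ*) = e^{-βF(μ)}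
φ(P_{r(μ)}), so that (φ(P_v)) is almost harmonic by the relations between the S_eS_e* and P_v;
together with gauge invariance it gives φ(S_μS_ν*) = 0 for μ ≠ ν (`GraphRep.hasValue_elt_of_ne`).
Hence φ is determined by the numbers φ(P_v) on the corners P_X C*(G) P_X with X finite, and then
everywhere by lower semicontinuity and the inequality φ(P_X a P_X) ≤ φ(a)
(`GraphRep.eq_of_vertex_eq`). Since φ_m(P_v) = m(Z(v)), the three maps are compatible and all
bijective. -/

lemma FinPath.ext' {μ ν : FinPath G} (h : μ.src = ν.src) (he : μ.edges = ν.edges) : μ = ν := by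
  cases μ; cases ν; cases h; cases he; rfl

instance [Countable V] [Countable E] : Countable (FinPath G) :=
  Function.Injective.countable (f := fun μ : FinPath G => (μ.src, μ.edges)) fun _ _ h =>
    FinPath.ext' (congrArg Prod.fst h) (congrArg Prod.snd h)

/-- An edge as a path of length `1`. -/
def FinPath.ofEdge (G : EGraph V E) (e : E) : FinPath G := ⟨G.s e, [e], rfl, trivial⟩

@[simp] lemma FinPath.range_ofEdge (e : E) : (FinPath.ofEdge G e).range = G.r e := rfl

@[simp] lemma FinPath.src_ofEdge (e : E) : (FinPath.ofEdge G e).src = G.s e := rfl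

@[simp] lemma FinPath.range_ofVertex (v : V) : (FinPath.ofVertex G v).range = v := rfl

@[simp] lemma FinPath.src_ofVertex (v : V) : (FinPath.ofVertex G v).src = v := rfl

@[simp] lemma FinPath.weight_ofVertex (F : E → ℝ) (v : V) :
    (FinPath.ofVertex G v).weight F = 0 := by simp [FinPath.weight, FinPath.ofVertex]

@[simp] lemma FinPath.weight_ofEdge (F : E → ℝ) (e : E) :
    (FinPath.ofEdge G e).weight F = F e := by simp [FinPath.weight, FinPath.ofEdge]

lemma FinPath.append_ofVertex (μ : FinPath G) {v : V} (h : v = μ.range) :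
    μ.append (FinPath.ofVertex G v) h = μ :=
  FinPath.ext' rfl (List.append_nil _)

lemma FinPath.append_assoc (μ ν κ : FinPath G) (h : ν.src = μ.range) (h' : κ.src = ν.range) :
    (μ.append ν h).append κ (h'.trans (μ.range_append ν h).symm) =
      μ.append (ν.append κ h') h :=
  FinPath.ext' rfl (List.append_assoc _ _ _)

lemma FinPath.eq_ofVertex {μ : FinPath G} (h : μ.length = 0) : μ = FinPath.ofVertex G μ.src :=
  FinPath.ext' rfl (List.eq_nil_of_length_eq_zero h)

/-- The path `μe`. -/
def FinPath.snoc (μ : FinPath G) (e : E) (h : G.s e = μ.range) : FinPath G :=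
  μ.append (FinPath.ofEdge G e) h

/-- The path `eμ`. -/
def FinPath.cons (e : E) (μ : FinPath G) (h : μ.src = G.r e) : FinPath G :=
  (FinPath.ofEdge G e).append μ h

@[simp] lemma FinPath.src_snoc (μ : FinPath G) (e : E) (h : G.s e = μ.range) :
    (μ.snoc e h).src = μ.src := rfl

@[simp] lemma FinPath.range_snoc (μ : FinPath G) (e : E) (h : G.s e = μ.range) :
    (μ.snoc e h).range = G.r e := FinPath.range_append _ _ h

@[simp] lemma FinPath.length_snoc (μ : FinPath G) (e : E) (h : G.s e = μ.range) :
    (μ.snoc e h).length = μ.length + 1 := length_append _ _ h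

lemma FinPath.weight_snoc (F : E → ℝ) (μ : FinPath G) (e : E) (h : G.s e = μ.range) :
    (μ.snoc e h).weight F = μ.weight F + F e :=
  (weight_append F _ _ h).trans (by rw [weight_ofEdge])

@[simp] lemma FinPath.edges_snoc (μ : FinPath G) (e : E) (h : G.s e = μ.range) :
    (μ.snoc e h).edges = μ.edges ++ [e] := rfl

@[simp] lemma FinPath.src_cons (e : E) (μ : FinPath G) (h : μ.src = G.r e) :
    (FinPath.cons e μ h).src = G.s e := rfl

@[simp] lemma FinPath.range_cons (e : E) (μ : FinPath G) (h : μ.src = G.r e) :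
    (FinPath.cons e μ h).range = μ.range := FinPath.range_append _ _ h

@[simp] lemma FinPath.length_cons (e : E) (μ : FinPath G) (h : μ.src = G.r e) :
    (FinPath.cons e μ h).length = μ.length + 1 := (length_append _ _ h).trans (add_comm _ _)

lemma FinPath.weight_cons (F : E → ℝ) (e : E) (μ : FinPath G) (h : μ.src = G.r e) :
    (FinPath.cons e μ h).weight F = F e + μ.weight F :=
  (weight_append F _ _ h).trans (by rw [weight_ofEdge])

lemma FinPath.exists_cons {μ : FinPath G} (h : μ.length ≠ 0) :
    ∃ (e : E) (κ : FinPath G) (h : κ.src = G.r e), μ = FinPath.cons e κ h := by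
  obtain ⟨v, l, hl⟩ := μ
  cases l with
  | nil => exact absurd rfl h
  | cons e l => exact ⟨e, ⟨G.r e, l, hl.2⟩, rfl, FinPath.ext' hl.1.symm rfl⟩

lemma FinPath.append_cons (μ κ : FinPath G) (e : E) (h : κ.src = G.r e)
    (h' : (FinPath.cons e κ h).src = μ.range) : μ.append (FinPath.cons e κ h) h' =
      (μ.snoc e h').append κ (h.trans (FinPath.range_snoc _ _ _).symm) :=
  (FinPath.append_assoc μ (FinPath.ofEdge G e) κ h' h).symm

lemma concat_ofVertex {v : V} (x : PathSpace G) (h : x.src = v) :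
    concat (FinPath.ofVertex G v) x h = x :=
  PathSpace.ext' ((concat_src _ _ _).trans h.symm) fun i => by
    simp [concat_edge, FinPath.ofVertex, FinPath.length]

lemma PathSpace.exists_tail {x : PathSpace G} {e : E} (h : x.edge 0 = some e) :
    x.src = G.s e ∧ ∃ y : PathSpace G, y.src = G.r e ∧ ∀ i, y.edge i = x.edge (i + 1) := by
  cases x with
  | infinite p =>
    have h' : p.edge 0 = e := by simpa [PathSpace.edge] using h
    subst h'
    exact ⟨rfl, .infinite ⟨fun i => p.edge (i + 1), fun i => p.isWalk _⟩, (p.isWalk 0).symm,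
      fun i => rfl⟩
  | finite p hp =>
    obtain ⟨v, l, hl⟩ := p
    cases l with
    | nil => simp [PathSpace.edge] at h
    | cons e' l =>
      have h' : e' = e := by simpa [PathSpace.edge] using h
      subst h'
      exact ⟨hl.1.symm, .finite ⟨G.r e', l, hl.2⟩ hp, rfl, fun i => by simp [PathSpace.edge]⟩

lemma exists_concat_of_mem_cylinder {μ : FinPath G} {x : PathSpace G} (hx : x ∈ cylinder μ) :
    ∃ (y : PathSpace G) (h : y.src = μ.range), x = concat μ y h := by
  obtain ⟨v, l, hl⟩ := μ
  obtain ⟨y, hy, hye⟩ : ∃ y : PathSpace G, y.src = G.walkEnd v l ∧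
      ∀ i, y.edge i = x.edge (i + l.length) := by
    obtain ⟨h1, h2⟩ := hx
    simp only [FinPath.length] at h1 h2
    induction l generalizing x v with
    | nil => exact ⟨x, h1, fun i => rfl⟩
    | cons e l ih =>
      obtain ⟨-, z, hz, hze⟩ := PathSpace.exists_tail (x := x) (e := e) (by simpa using h2 0)
      obtain ⟨y, hy, hye⟩ := ih (G.r e) hl.2 (x := z) hz fun i hi => by
        rw [hze, h2 (i + 1) (by simpa using hi)]
        simp
      exact ⟨y, hy, fun i => by rw [hye, hze, List.length_cons, add_assoc]⟩
  have hy' : y.src = (⟨v, l, hl⟩ : FinPath G).range := hy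
  refine ⟨y, hy', PathSpace.ext' (hx.1.trans (concat_src _ _ _).symm) fun i => ?_⟩
  rw [concat_edge]
  split_ifs with hi
  · exact hx.2 i hi
  · rw [hye]
    congr 1
    simp only [FinPath.length] at hi ⊢
    omega

lemma mem_cylinder_iff {μ : FinPath G} {x : PathSpace G} :
    x ∈ cylinder μ ↔ ∃ (y : PathSpace G) (h : y.src = μ.range), x = concat μ y h :=
  ⟨exists_concat_of_mem_cylinder, by rintro ⟨y, h, rfl⟩; exact concat_mem_cylinder μ y h⟩

@[simp] lemma mem_cylinder_ofVertex {v : V} {x : PathSpace G} :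
    x ∈ cylinder (FinPath.ofVertex G v) ↔ x.src = v := by
  simp [cylinder, FinPath.ofVertex, FinPath.length]

lemma cylinder_append_subset (μ κ : FinPath G) (h : κ.src = μ.range) :
    cylinder (μ.append κ h) ⊆ cylinder μ := by
  intro x hx
  obtain ⟨y, hy, rfl⟩ := mem_cylinder_iff.1 hx
  rw [concat_append μ κ y h (hy.trans (μ.range_append κ h))]
  exact concat_mem_cylinder _ _ _

lemma concat_mem_cylinder_append {μ κ : FinPath G} {h : κ.src = μ.range} {x : PathSpace G}
    {hx : x.src = μ.range} : concat μ x hx ∈ cylinder (μ.append κ h) ↔ x ∈ cylinder κ := by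
  constructor
  · intro hm
    obtain ⟨y, hy, e⟩ := mem_cylinder_iff.1 hm
    rw [concat_append μ κ y h (hy.trans (μ.range_append κ h))] at e
    rw [concat_injective μ _ _ e]
    exact concat_mem_cylinder _ _ _
  · intro hm
    obtain ⟨y, hy, rfl⟩ := mem_cylinder_iff.1 hm
    rw [← concat_append μ κ y h hy]
    exact concat_mem_cylinder _ _ _

lemma exists_append_of_mem_cylinder {μ ν : FinPath G} {x : PathSpace G} (hμ : x ∈ cylinder μ)
    (hν : x ∈ cylinder ν) (hl : μ.length ≤ ν.length) :
    ∃ (κ : FinPath G) (h : κ.src = μ.range), ν = μ.append κ h := by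
  obtain ⟨y, hy, rfl⟩ := mem_cylinder_iff.1 hμ
  obtain ⟨z, hz, e⟩ := mem_cylinder_iff.1 hν
  obtain ⟨κ, hκ, -, rfl, -⟩ := concat_eq_concat e hl
  exact ⟨κ, hκ, rfl⟩

lemma eq_of_mem_cylinder {μ ν : FinPath G} {x : PathSpace G} (hμ : x ∈ cylinder μ)
    (hν : x ∈ cylinder ν) (hl : μ.length = ν.length) : μ = ν := by
  obtain ⟨y, hy, rfl⟩ := mem_cylinder_iff.1 hμ
  obtain ⟨z, hz, e⟩ := mem_cylinder_iff.1 hν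
  exact append_right_eq e hl

lemma cylinder_subset_src (μ : FinPath G) : cylinder μ ⊆ cylinder (FinPath.ofVertex G μ.src) :=
  fun _ hx => mem_cylinder_ofVertex.2 hx.1

/-- A finite path ending in `V_∞`, as an element of `Ω_G`, lies in `Z(ν)` exactly when `ν` is one
of its initial segments. -/
lemma finite_mem_cylinder_iff {μ ν : FinPath G} {h : μ.range ∈ G.singular} :
    PathSpace.finite μ h ∈ cylinder ν ↔ ∃ (κ : FinPath G) (hκ : κ.src = ν.range),
      μ = ν.append κ hκ := by
  constructor
  · intro hx
    obtain ⟨y, hy, e⟩ := mem_cylinder_iff.1 hx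
    cases y with
    | infinite p => simp [concat] at e
    | finite p hp =>
      simp only [concat, PathSpace.finite.injEq] at e
      exact ⟨p, hy, e⟩
  · rintro ⟨κ, hκ, rfl⟩
    exact mem_cylinder_iff.2 ⟨.finite κ ((ν.range_append κ hκ) ▸ h), hκ, rfl⟩

lemma finite_mem_cylinder_self {μ : FinPath G} {h : μ.range ∈ G.singular} :
    PathSpace.finite μ h ∈ cylinder μ :=
  finite_mem_cylinder_iff.2 ⟨FinPath.ofVertex G μ.range, rfl, (μ.append_ofVertex rfl).symm⟩

/-- Repeated extension of a vertex by edges: either one can go on forever, or one ends in `V_∞`. -/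
lemma exists_path_of_extension (P : FinPath G → Prop) (v : V) (hv : P (FinPath.ofVertex G v))
    (H : ∀ μ, P μ → μ.range ∉ G.singular → ∃ (e : E) (h : G.s e = μ.range),
      P (μ.snoc e h)) :
    (∃ x : PathSpace G, x.src = v ∧ ∀ n, ∃ μ : FinPath G, μ.length = n ∧ P μ ∧ x ∈ cylinder μ) ∨
    (∃ μ : FinPath G, P μ ∧ μ.src = v ∧ μ.range ∈ G.singular ∧ ¬ ∃ (e : E) (h : G.s e = μ.range),
      P (μ.snoc e h)) := by
  classical
  -- Either some path in P starting at v has no extension in P, and then `H` forces its range into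
  -- V_∞, or all such paths extend and a choice of next edges builds an infinite path.
  by_cases hc : ∃ μ : FinPath G, P μ ∧ μ.src = v ∧ ¬ ∃ (e : E) (h : G.s e = μ.range),
      P (μ.snoc e h)
  · obtain ⟨μ, h1, h2, h3⟩ := hc
    exact Or.inr ⟨μ, h1, h2, by_contra fun h => h3 (H μ h1 h), h3⟩
  · push Not at hc
    left
    have : Nonempty E := ⟨(hc _ hv rfl).choose⟩
    choose! nxt hs hP using hc
    let Q : Type _ := {μ : FinPath G // P μ ∧ μ.src = v}
    let step : Q → Q := fun μ =>
      ⟨μ.1.snoc (nxt μ.1) (hs μ.1 μ.2.1 μ.2.2), hP μ.1 μ.2.1 μ.2.2, μ.2.2⟩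
    let q : ℕ → Q := fun n => Nat.rec ⟨FinPath.ofVertex G v, hv, rfl⟩ (fun _ μ => step μ) n
    let p : ℕ → E := fun n => nxt (q n).1
    have hq : ∀ n, (q (n + 1)).1 =
      (q n).1.snoc (p n) (hs (q n).1 (q n).2.1 (q n).2.2) := fun n => rfl
    have hlen : ∀ n, (q n).1.length = n := by
      intro n
      induction n with
      | zero => rfl
      | succ n ih => rw [hq, FinPath.length_snoc, ih]
    have hrange : ∀ n, (q (n + 1)).1.range = G.r (p n) := fun n => by
      rw [hq, FinPath.range_snoc]
    have hedge : ∀ n, ∀ i < n, (q n).1.edges[i]? = some (p i) := by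
      intro n
      induction n with
      | zero => intro i hi; omega
      | succ n ih =>
        intro i hi
        rw [hq]
        simp only [FinPath.edges_snoc]
        rcases Nat.lt_succ_iff_lt_or_eq.1 hi with h | rfl
        · rw [List.getElem?_append_left (by have := hlen n; simp only [FinPath.length] at this; omega)]
          exact ih i h
        · rw [List.getElem?_append_right (by have := hlen i; simp only [FinPath.length] at this; omega)]
          have := hlen i
          simp only [FinPath.length] at this
          simp [this]
    refine ⟨.infinite ⟨p, fun i => ?_⟩, ?_, fun n => ⟨(q n).1, hlen n, (q n).2.1, ?_⟩⟩
    · rw [← hrange i]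
      exact (hs (q (i + 1)).1 (q (i + 1)).2.1 (q (i + 1)).2.2).symm
    · exact hs (q 0).1 (q 0).2.1 (q 0).2.2
    · refine ⟨(hs (q 0).1 (q 0).2.1 (q 0).2.2).trans (q n).2.2.symm, fun i hi => ?_⟩
      rw [hedge n i (by rwa [hlen n] at hi)]
      rfl

lemma exists_path (G : EGraph V E) (v : V) : ∃ x : PathSpace G, x.src = v := by
  rcases exists_path_of_extension (G := G) (fun _ => True) v trivial (fun μ _ h => by
    simp only [EGraph.singular, Set.mem_ofPred_eq, not_or] at h
    obtain ⟨e, he⟩ := Set.nonempty_iff_ne_empty.2 h.1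
    exact ⟨e, he, trivial⟩) with ⟨x, hx, -⟩ | ⟨μ, -, h, h', -⟩
  · exact ⟨x, hx⟩
  · exact ⟨.finite μ h', h⟩

lemma iUnion_cylinder_ofVertex : ⋃ v, cylinder (FinPath.ofVertex G v) = Set.univ :=
  Set.eq_univ_of_forall fun x => Set.mem_iUnion.2 ⟨x.src, mem_cylinder_ofVertex.2 rfl⟩

lemma concat_mem_cylinder_snoc {μ : FinPath G} {e : E} {h : G.s e = μ.range} {x : PathSpace G}
    {hx : x.src = μ.range} : concat μ x hx ∈ cylinder (μ.snoc e h) ↔ x.edge 0 = some e := by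
  refine (concat_mem_cylinder_append (h := h)).trans ⟨fun hm => ?_, fun he => ?_⟩
  · simpa [FinPath.ofEdge] using hm.2 0 (by simp [FinPath.ofEdge, FinPath.length])
  · refine ⟨(PathSpace.exists_tail he).1, fun i hi => ?_⟩
    have : i = 0 := by simpa [FinPath.ofEdge, FinPath.length] using hi
    subst this
    simpa [FinPath.ofEdge] using he

lemma cylinder_snoc_subset (μ : FinPath G) (e : E) (h : G.s e = μ.range) :
    cylinder (μ.snoc e h) ⊆ cylinder μ := cylinder_append_subset _ _ _

/-- The part of `Z(μ)` beyond `μ` is cut up by the next edge. -/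
lemma cylinder_eq_iUnion_of_notMem {μ : FinPath G} (h : μ.range ∉ G.singular) :
    cylinder μ = ⋃ e : {e : E // G.s e = μ.range}, cylinder (μ.snoc e.1 e.2) := by
  refine Set.Subset.antisymm (fun x hx => ?_)
    (Set.iUnion_subset fun e => cylinder_snoc_subset _ _ _)
  obtain ⟨y, hy, rfl⟩ := mem_cylinder_iff.1 hx
  obtain ⟨e, he⟩ : ∃ e, y.edge 0 = some e := by
    cases y with
    | infinite p => exact ⟨_, rfl⟩
    | finite p hp =>
      obtain ⟨v, l, hl⟩ := p
      cases l with
      | nil => exact absurd ((show v = μ.range from hy) ▸ hp) h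
      | cons e l => exact ⟨e, rfl⟩
  exact Set.mem_iUnion.2 ⟨⟨e, (PathSpace.exists_tail he).1.symm.trans hy⟩,
    concat_mem_cylinder_snoc.2 he⟩

lemma PathSpace.exists_mem_cylinder_of_edge {x : PathSpace G} {i : ℕ} {e : E}
    (h : x.edge i = some e) : ∃ μ : FinPath G, μ.length = i + 1 ∧ x ∈ cylinder μ := by
  induction i generalizing x with
  | zero =>
    have := concat_mem_cylinder_snoc (μ := FinPath.ofVertex G x.src) (e := e)
      (h := (PathSpace.exists_tail h).1.symm) (hx := rfl) |>.2 h
    rw [concat_ofVertex] at this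
    exact ⟨_, FinPath.length_snoc _ _ _, this⟩
  | succ i ih =>
    obtain ⟨e', he'⟩ : ∃ e', x.edge 0 = some e' := by
      cases x with
      | infinite p => exact ⟨_, rfl⟩
      | finite p hp =>
        obtain ⟨v, l, hl⟩ := p
        cases l with
        | nil => simp [PathSpace.edge] at h
        | cons e l => exact ⟨e, rfl⟩
    obtain ⟨hs, y, hy, hye⟩ := PathSpace.exists_tail he'
    obtain ⟨μ, hμ, hyμ⟩ := ih (x := y) (by rw [hye, h])
    refine ⟨FinPath.cons e' μ (hyμ.1.symm.trans hy), by rw [FinPath.length_cons, hμ], ?_⟩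
    have hy' : y.src = (FinPath.ofEdge G e').range := hy
    have hx : x = concat (FinPath.ofEdge G e') y hy' := by
      refine PathSpace.ext' (hs.trans (concat_src (FinPath.ofEdge G e') y hy').symm) fun i => ?_
      rw [concat_edge]
      cases i with
      | zero => simpa [FinPath.ofEdge, FinPath.length] using he'
      | succ i => simp [FinPath.ofEdge, FinPath.length, hye]
    rw [hx]
    exact concat_mem_cylinder_append.2 hyμ

lemma PathSpace.eq_of_cylinder {x y : PathSpace G} (h : ∀ μ, x ∈ cylinder μ ↔ y ∈ cylinder μ) :
    x = y := by
  have key : ∀ {x y : PathSpace G}, (∀ μ, x ∈ cylinder μ → y ∈ cylinder μ) →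
      ∀ i e, x.edge i = some e → y.edge i = some e := by
    intro x y h i e he
    obtain ⟨μ, hμ, hx⟩ := PathSpace.exists_mem_cylinder_of_edge he
    rw [(h μ hx).2 i (by omega), ← hx.2 i (by omega), he]
  refine PathSpace.ext' (mem_cylinder_ofVertex.1 ((h _).2 (mem_cylinder_ofVertex.2 rfl)))
    fun i => Option.ext fun e => ?_
  exact ⟨key (fun μ => (h μ).1) i e, key (fun μ => (h μ).2) i e⟩

/-! ### The topology of the path space -/

lemma isOpen_cylinderDiff (μ : FinPath G) (A : Finset (FinPath G)) : IsOpen (cylinderDiff μ A) :=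
  TopologicalSpace.isOpen_generateFrom_of_mem ⟨μ, A, rfl⟩

lemma isOpen_cylinder (μ : FinPath G) : IsOpen (cylinder μ) := by
  simpa [cylinderDiff] using isOpen_cylinderDiff μ ∅

lemma isClosed_cylinder (μ : FinPath G) : IsClosed (cylinder μ) := by
  -- The sets Z(v) cover Ω_G, and Z(v) \ Z(μ) is open by the definition of the topology.
  have : (cylinder μ)ᶜ = ⋃ v, cylinderDiff (FinPath.ofVertex G v) {μ} := by
    simp only [cylinderDiff, Finset.mem_singleton, Set.iUnion_iUnion_eq_left,
      ← Set.iUnion_sdiff, iUnion_cylinder_ofVertex]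
    rw [Set.compl_eq_univ_sdiff]
  rw [← isOpen_compl_iff, this]
  exact isOpen_iUnion fun v => isOpen_cylinderDiff _ _

lemma isClopen_cylinder (μ : FinPath G) : IsClopen (cylinder μ) :=
  ⟨isClosed_cylinder μ, isOpen_cylinder μ⟩

/-- Basic open sets are built from cylinders by finitely many unions and one difference, and
cylinders are clopen. -/
lemma continuous_pathSpace_iff {X : Type*} [TopologicalSpace X] {f : X → PathSpace G} :
    Continuous f ↔ ∀ μ, IsClopen (f ⁻¹' cylinder μ) := by
  refine ⟨fun h μ => (isClopen_cylinder μ).preimage h, fun h => ?_⟩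
  refine continuous_generateFrom_iff.2 ?_
  rintro _ ⟨μ, A, rfl⟩
  simp only [cylinderDiff, Set.preimage_sdiff, Set.preimage_iUnion]
  exact (h μ).isOpen.sdiff (A.finite_toSet.isClosed_biUnion fun ν _ => (h ν).isClosed)

instance : T2Space (PathSpace G) := by
  refine ⟨fun x y hxy => ?_⟩
  have : ∃ μ, ¬ (x ∈ cylinder μ ↔ y ∈ cylinder μ) := by
    by_contra! h
    exact hxy (PathSpace.eq_of_cylinder h)
  obtain ⟨μ, hμ⟩ := this
  by_cases hx : x ∈ cylinder μ
  · exact ⟨cylinder μ, (cylinder μ)ᶜ, isOpen_cylinder μ, (isClosed_cylinder μ).isOpen_compl, hx,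
      fun hy => hμ ⟨fun _ => hy, fun _ => hx⟩, disjoint_compl_right⟩
  · exact ⟨(cylinder μ)ᶜ, cylinder μ, (isClosed_cylinder μ).isOpen_compl, isOpen_cylinder μ, hx,
      by_contra fun hy => hμ ⟨fun h => absurd h hx, fun h => absurd h hy⟩, disjoint_compl_left⟩

instance [Countable V] [Countable E] : SecondCountableTopology (PathSpace G) := by
  refine ⟨{U | ∃ (μ : FinPath G) (A : Finset (FinPath G)), U = cylinderDiff μ A}, ?_, rfl⟩
  refine (Set.countable_range fun p : FinPath G × Finset (FinPath G) =>
    cylinderDiff p.1 p.2).mono ?_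
  rintro _ ⟨μ, A, rfl⟩
  exact ⟨(μ, A), rfl⟩

/-- An ultrafilter containing a finite union contains one of its members, so convergence to x in
this topology can be tested on single cylinders. -/
lemma ultrafilter_le_nhds {U : Ultrafilter (PathSpace G)} {x : PathSpace G}
    (h : ∀ μ, x ∈ cylinder μ ↔ cylinder μ ∈ U) : (U : Filter (PathSpace G)) ≤ 𝓝 x := by
  rw [TopologicalSpace.nhds_generateFrom]
  refine le_iInf₂ fun s hs => ?_
  obtain ⟨hx, μ, A, rfl⟩ := hs
  rw [Filter.le_principal_iff]
  refine Filter.inter_mem ((h μ).1 hx.1) (Ultrafilter.compl_mem_iff_notMem.2 fun hA => ?_)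
  obtain ⟨ν, hν, hU⟩ := (Ultrafilter.finite_biUnion_mem_iff A.finite_toSet).1 hA
  exact hx.2 (Set.mem_biUnion hν ((h ν).2 hU))

/-- Follow an ultrafilter on Z(v) edge by edge. At a vertex outside V_∞ finitely many edges leave,
and one of the corresponding cylinders belongs to the ultrafilter. The walk either goes on forever
and the infinite path is the limit, or it gets stuck at a path ending in V_∞, which then is itself
the limit. -/
lemma isCompact_cylinder_ofVertex (v : V) : IsCompact (cylinder (FinPath.ofVertex G v)) := by
  refine isCompact_iff_ultrafilter_le_nhds.2 fun U hU => ?_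
  rw [Filter.le_principal_iff] at hU
  have hmeet : ∀ {μ ν : FinPath G}, cylinder μ ∈ U → cylinder ν ∈ U →
      (cylinder μ ∩ cylinder ν).Nonempty := fun h h' => U.nonempty_of_mem (Filter.inter_mem h h')
  rcases exists_path_of_extension (fun μ => cylinder μ ∈ U) v hU (fun μ hμ h => by
    rw [cylinder_eq_iUnion_of_notMem h] at hμ
    simp only [EGraph.singular, Set.mem_ofPred_eq, not_or, Set.not_infinite] at h
    have : Finite {e : E // G.s e = μ.range} := h.2
    have := (Ultrafilter.finite_biUnion_mem_iff (Set.finite_univ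
      (α := {e : E // G.s e = μ.range}))).1 (by simpa using hμ)
    obtain ⟨e, -, he⟩ := this
    exact ⟨e.1, e.2, he⟩) with ⟨x, hx, h⟩ | ⟨μ, hμ, hs, hr, hno⟩
  · refine ⟨x, mem_cylinder_ofVertex.2 hx, ultrafilter_le_nhds fun ν => ?_⟩
    obtain ⟨μ, hl, hμ, hxμ⟩ := h ν.length
    refine ⟨fun hν => ?_, fun hν => ?_⟩
    · rwa [eq_of_mem_cylinder hν hxμ hl.symm]
    · obtain ⟨y, hy1, hy2⟩ := hmeet hμ hν
      rwa [← eq_of_mem_cylinder hy1 hy2 hl]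
  · refine ⟨.finite μ hr, mem_cylinder_ofVertex.2 hs, ultrafilter_le_nhds fun ν => ?_⟩
    refine ⟨fun hν => ?_, fun hν => ?_⟩
    · obtain ⟨κ, hκ, rfl⟩ := finite_mem_cylinder_iff.1 hν
      exact Filter.mem_of_superset hμ (cylinder_append_subset _ _ _)
    · obtain ⟨y, hy1, hy2⟩ := hmeet hμ hν
      rcases le_total ν.length μ.length with hl | hl
      · obtain ⟨κ, hκ, rfl⟩ := exists_append_of_mem_cylinder hy2 hy1 hl
        exact finite_mem_cylinder_iff.2 ⟨κ, hκ, rfl⟩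
      · obtain ⟨κ, hκ, rfl⟩ := exists_append_of_mem_cylinder hy1 hy2 hl
        by_cases h0 : κ.length = 0
        · have hκ0 : μ.append κ hκ = μ :=
            FinPath.ext' rfl (by simp [FinPath.append, List.eq_nil_of_length_eq_zero h0])
          rw [hκ0]
          exact finite_mem_cylinder_self
        -- If Z(μeκ) belonged to the ultrafilter then so would Z(μe), although the walk is stuck at
        -- μ.
        · obtain ⟨e, κ, h, rfl⟩ := FinPath.exists_cons h0
          rw [FinPath.append_cons] at hν
          exact absurd ⟨e, hκ, Filter.mem_of_superset hν (cylinder_append_subset _ _ _)⟩ hno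

lemma isCompact_cylinder (μ : FinPath G) : IsCompact (cylinder μ) :=
  (isCompact_cylinder_ofVertex μ.src).of_isClosed_subset (isClosed_cylinder μ)
    (cylinder_subset_src μ)

instance : WeaklyLocallyCompactSpace (PathSpace G) :=
  ⟨fun x => ⟨cylinder (FinPath.ofVertex G x.src), isCompact_cylinder _,
    (isOpen_cylinder _).mem_nhds (mem_cylinder_ofVertex.2 rfl)⟩⟩

lemma measurableSet_cylinder (μ : FinPath G) : MeasurableSet (cylinder μ) :=
  (isOpen_cylinder μ).measurableSet

/-- A compact set meets only finitely many of the sets `Z(v)`. -/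
lemma IsCompact.exists_finset_vertex {K : Set (PathSpace G)} (hK : IsCompact K) :
    ∃ X : Finset V, K ⊆ ⋃ v ∈ X, cylinder (FinPath.ofVertex G v) :=
  hK.elim_finite_subcover _ (fun v => isOpen_cylinder _)
    (by rw [iUnion_cylinder_ofVertex]; exact Set.subset_univ _)

/-! ### Concatenation is a homeomorphism -/

/-- The preimage of a cylinder Z(ν) is empty if Z(ν) misses Z(μ), is Z(κ) if ν = μκ, and is
everything if ν is an initial segment of μ. All of these are clopen. -/
lemma continuous_concat (μ : FinPath G) :
    Continuous fun x : cylinder (FinPath.ofVertex G μ.range) =>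
      concat μ x.1 (mem_cylinder_ofVertex.1 x.2) := by
  refine continuous_pathSpace_iff.2 fun ν => ?_
  by_cases hmeet : ∃ x : cylinder (FinPath.ofVertex G μ.range),
      concat μ x.1 (mem_cylinder_ofVertex.1 x.2) ∈ cylinder ν
  · obtain ⟨⟨x, hx⟩, hxν⟩ := hmeet
    have hxμ := concat_mem_cylinder μ x (mem_cylinder_ofVertex.1 hx)
    rcases le_total μ.length ν.length with hl | hl
    · obtain ⟨κ, hκ, rfl⟩ := exists_append_of_mem_cylinder hxμ hxν hl
      have : (fun x : cylinder (FinPath.ofVertex G μ.range) =>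
          concat μ x.1 (mem_cylinder_ofVertex.1 x.2)) ⁻¹' cylinder (μ.append κ hκ) =
          Subtype.val ⁻¹' cylinder κ := by
        ext y
        exact concat_mem_cylinder_append
      rw [this]
      exact (isClopen_cylinder κ).preimage continuous_subtype_val
    · obtain ⟨κ, hκ, rfl⟩ := exists_append_of_mem_cylinder hxν hxμ hl
      convert isClopen_univ
      refine Set.eq_univ_of_forall fun y => ?_
      exact cylinder_append_subset _ _ _ (concat_mem_cylinder _ _ _)
  · convert isClopen_empty
    exact Set.eq_empty_of_forall_notMem fun x hx => hmeet ⟨x, hx⟩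

end PathSpaceTopology

end GraphKMS

namespace GraphKMS

section GroupoidTopology

variable {V E : Type*} {G : EGraph V E}

/-! ### The topology of the groupoid -/

@[simp] lemma Gpd.rng_mk' (μ ν : FinPath G) (x : PathSpace G) (h : x.src = μ.range)
    (h' : x.src = ν.range) : (Gpd.mk' μ ν x h h').rng = concat μ x h := rfl

@[simp] lemma Gpd.src_mk' (μ ν : FinPath G) (x : PathSpace G) (h : x.src = μ.range)
    (h' : x.src = ν.range) : (Gpd.mk' μ ν x h h').src = concat ν x h' := rfl

@[simp] lemma Gpd.lag_mk' (μ ν : FinPath G) (x : PathSpace G) (h : x.src = μ.range)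
    (h' : x.src = ν.range) : (Gpd.mk' μ ν x h h').lag = (μ.length : ℤ) - ν.length := rfl

@[simp] lemma Gpd.rng_inv (g : Gpd G) : g.inv.rng = g.src := rfl
@[simp] lemma Gpd.src_inv (g : Gpd G) : g.inv.src = g.rng := rfl
@[simp] lemma Gpd.lag_inv (g : Gpd G) : g.inv.lag = -g.lag := rfl
@[simp] lemma Gpd.inv_inv (g : Gpd G) : g.inv.inv = g := Gpd.ext rfl (neg_neg _) rfl
@[simp] lemma Gpd.rng_unit (x : PathSpace G) : (Gpd.unit x).rng = x := rfl
@[simp] lemma Gpd.src_unit (x : PathSpace G) : (Gpd.unit x).src = x := rfl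
@[simp] lemma Gpd.lag_unit (x : PathSpace G) : (Gpd.unit x).lag = 0 := rfl
@[simp] lemma Gpd.rng_comp (g h : Gpd G) (e : g.src = h.rng) : (g.comp h e).rng = g.rng := rfl
@[simp] lemma Gpd.src_comp (g h : Gpd G) (e : g.src = h.rng) : (g.comp h e).src = h.src := rfl
@[simp] lemma Gpd.lag_comp (g h : Gpd G) (e : g.src = h.rng) :
    (g.comp h e).lag = g.lag + h.lag := rfl
@[simp] lemma Gpd.rng_mulInv (g h : Gpd G) (e : h.src = g.src) :
    (g.mulInv h e).rng = g.rng := rfl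
@[simp] lemma Gpd.src_mulInv (g h : Gpd G) (e : h.src = g.src) :
    (g.mulInv h e).src = h.rng := rfl
@[simp] lemma Gpd.lag_mulInv (g h : Gpd G) (e : h.src = g.src) :
    (g.mulInv h e).lag = g.lag - h.lag := (sub_eq_add_neg _ _).symm

@[simp] lemma Gpd.inv_mk' (μ ν : FinPath G) (x : PathSpace G) (h : x.src = μ.range)
    (h' : x.src = ν.range) : (Gpd.mk' μ ν x h h').inv = Gpd.mk' ν μ x h' h :=
  Gpd.ext rfl (neg_sub _ _) rfl

/-- The bisection `{(μx, |μ| - |ν|, νx)}`. -/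
abbrev basicBisection (μ ν : FinPath G) : Set (Gpd G) := basicSet μ ν ∅ ∅

lemma mem_basicBisection {μ ν : FinPath G} {g : Gpd G} :
    g ∈ basicBisection μ ν ↔ ∃ x h h', g = Gpd.mk' μ ν x h h' := by
  constructor
  · rintro ⟨x, h, h', e, -⟩
    exact ⟨x, h, h', e⟩
  · rintro ⟨x, h, h', e⟩
    exact ⟨x, h, h', e, by simpa [cylinderDiff] using concat_mem_cylinder μ x h,
      by simpa [cylinderDiff] using concat_mem_cylinder ν x h'⟩

lemma mk'_mem_basicBisection (μ ν : FinPath G) (x : PathSpace G) (h : x.src = μ.range)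
    (h' : x.src = ν.range) : Gpd.mk' μ ν x h h' ∈ basicBisection μ ν :=
  mem_basicBisection.2 ⟨x, h, h', rfl⟩

lemma basicSet_eq (μ ν : FinPath G) (A B : Finset (FinPath G)) :
    basicSet μ ν A B = {g ∈ basicBisection μ ν | g.rng ∈ cylinderDiff μ A ∧
      g.src ∈ cylinderDiff ν B} := by
  ext g
  constructor
  · rintro ⟨x, h, h', rfl, h1, h2⟩
    exact ⟨mk'_mem_basicBisection μ ν x h h', h1, h2⟩
  · rintro ⟨hg, h1, h2⟩
    obtain ⟨x, h, h', rfl⟩ := mem_basicBisection.1 hg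
    exact ⟨x, h, h', rfl, h1, h2⟩

lemma basicBisection_eq_empty {μ ν : FinPath G} (h : μ.range ≠ ν.range) :
    basicBisection μ ν = ∅ := by
  refine Set.eq_empty_of_forall_notMem fun g hg => ?_
  obtain ⟨x, h1, h2, -⟩ := mem_basicBisection.1 hg
  exact h (h1.symm.trans h2)

lemma isOpen_basicBisection (μ ν : FinPath G) : IsOpen (basicBisection μ ν) := by
  by_cases h : μ.range = ν.range
  · exact TopologicalSpace.isOpen_generateFrom_of_mem ⟨μ, ν, ∅, ∅, h, rfl⟩
  · rw [basicBisection_eq_empty h]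
    exact isOpen_empty

lemma isOpen_basicSet (μ ν : FinPath G) (A B : Finset (FinPath G)) : IsOpen (basicSet μ ν A B) := by
  by_cases h : μ.range = ν.range
  · exact TopologicalSpace.isOpen_generateFrom_of_mem ⟨μ, ν, A, B, h, rfl⟩
  · have : basicSet μ ν A B = ∅ := by rw [basicSet_eq, basicBisection_eq_empty h]; simp
    rw [this]
    exact isOpen_empty

lemma iUnion_basicBisection :
    ⋃ p : FinPath G × FinPath G, basicBisection p.1 p.2 = Set.univ := by
  refine Set.eq_univ_of_forall fun g => ?_
  obtain ⟨μ, ν, x, h, h', rfl⟩ := g.exists_eq_mk'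
  exact Set.mem_iUnion.2 ⟨(μ, ν), mk'_mem_basicBisection μ ν x h h'⟩

/-- The bisection of (μκ, νκ) is the part of the bisection of (μ, ν) whose tails begin with κ. All
comparisons of basic bisections go through this. -/
lemma Gpd.mk'_append (μ ν κ : FinPath G) (x : PathSpace G) (h : κ.src = μ.range)
    (h' : κ.src = ν.range) (hx : x.src = κ.range) :
    Gpd.mk' (μ.append κ h) (ν.append κ h') x (hx.trans (μ.range_append κ h).symm)
      (hx.trans (ν.range_append κ h').symm) =
    Gpd.mk' μ ν (concat κ x hx) ((concat_src κ x hx).trans h) ((concat_src κ x hx).trans h') := by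
  ext1
  · exact concat_append μ κ x h hx
  · simp only [Gpd.lag_mk', length_append]; push_cast; ring
  · exact concat_append ν κ x h' hx

/-- Two representations of an element of `𝒢` differ by a common final segment. -/
lemma Gpd.rep_compare {μ ν μ' ν' : FinPath G} {x y : PathSpace G} {h : x.src = μ.range}
    {h' : x.src = ν.range} {k : y.src = μ'.range} {k' : y.src = ν'.range}
    (e : Gpd.mk' μ ν x h h' = Gpd.mk' μ' ν' y k k') (hl : μ.length ≤ μ'.length) :
    ∃ (κ : FinPath G) (hκ : κ.src = μ.range) (hκ' : κ.src = ν.range) (hy : y.src = κ.range),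
      μ' = μ.append κ hκ ∧ ν' = ν.append κ hκ' ∧ x = concat κ y hy := by
  have e1 : concat μ x h = concat μ' y k := congrArg Gpd.rng e
  have e2 : concat ν x h' = concat ν' y k' := congrArg Gpd.src e
  have e3 : (μ.length : ℤ) - ν.length = (μ'.length : ℤ) - ν'.length := congrArg Gpd.lag e
  obtain ⟨κ, hκ, hy, rfl, rfl⟩ := concat_eq_concat e1 hl
  have hκ' : κ.src = ν.range := (concat_src κ y hy).symm.trans h'
  rw [← concat_append ν κ y hκ' hy] at e2
  exact ⟨κ, hκ, hκ', hy, rfl, (append_right_eq e2 (by rw [length_append] at *; omega)).symm, rfl⟩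

/-- The preimage of Z(κ) is closed because the basic sets that remove κ on the range side cover its
complement. It is open because an element with range in Z(κ) has a representation (μ, ν) in which μ
begins with κ, and then the whole bisection has its range in Z(κ). -/
lemma continuous_rng : Continuous (Gpd.rng : Gpd G → PathSpace G) := by
  refine continuous_pathSpace_iff.2 fun κ => ⟨?_, ?_⟩
  · have : (Gpd.rng ⁻¹' cylinder κ)ᶜ =
        ⋃ p : FinPath G × FinPath G, basicSet p.1 p.2 {κ} ∅ := by
      ext g
      simp only [Set.mem_compl_iff, Set.mem_preimage, Set.mem_iUnion]
      constructor
      · intro hg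
        obtain ⟨μ, ν, x, h, h', rfl⟩ := g.exists_eq_mk'
        refine ⟨(μ, ν), x, h, h', rfl, ⟨concat_mem_cylinder _ _ _, by simpa using hg⟩, ?_⟩
        simpa [cylinderDiff] using concat_mem_cylinder ν x h'
      · rintro ⟨p, x, h, h', rfl, h1, -⟩
        simpa using h1.2
    rw [← isOpen_compl_iff, this]
    exact isOpen_iUnion fun p => isOpen_basicSet _ _ _ _
  · rw [isOpen_iff_forall_mem_open]
    intro g hg
    obtain ⟨μ, ν, x, h, h', rfl⟩ := g.exists_eq_mk'
    have hx : concat μ x h ∈ cylinder κ := hg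
    rcases le_total κ.length μ.length with hl | hl
    · obtain ⟨ρ, hρ, rfl⟩ := exists_append_of_mem_cylinder hx (concat_mem_cylinder μ x h) hl
      refine ⟨_, fun g hg => ?_, isOpen_basicBisection _ _, mk'_mem_basicBisection _ _ x h h'⟩
      obtain ⟨y, k, k', rfl⟩ := mem_basicBisection.1 hg
      exact cylinder_append_subset _ _ _ (concat_mem_cylinder _ _ _)
    · obtain ⟨ρ, hρ, rfl⟩ := exists_append_of_mem_cylinder (concat_mem_cylinder μ x h) hx hl
      obtain ⟨y, hy, rfl⟩ := mem_cylinder_iff.1 (concat_mem_cylinder_append.1 hx)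
      have hρ' : ρ.src = ν.range := (concat_src ρ y hy).symm.trans h'
      refine ⟨_, fun g hg => ?_, isOpen_basicBisection (μ.append ρ hρ) (ν.append ρ hρ'), ?_⟩
      · obtain ⟨z, k, k', rfl⟩ := mem_basicBisection.1 hg
        exact concat_mem_cylinder _ _ _
      · rw [← Gpd.mk'_append μ ν ρ y hρ hρ' hy]
        exact mk'_mem_basicBisection _ _ _ _ _

lemma continuous_inv : Continuous (Gpd.inv : Gpd G → Gpd G) := by
  refine continuous_generateFrom_iff.2 ?_
  rintro _ ⟨μ, ν, A, B, -, rfl⟩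
  convert isOpen_basicSet ν μ B A
  ext g
  constructor
  · rintro ⟨x, h, h', e, h1, h2⟩
    exact ⟨x, h', h, by rw [← g.inv_inv, e, Gpd.inv_mk'], h2, h1⟩
  · rintro ⟨x, h, h', rfl, h1, h2⟩
    exact ⟨x, h', h, Gpd.inv_mk' _ _ _ _ _, h2, h1⟩

lemma continuous_src : Continuous (Gpd.src : Gpd G → PathSpace G) :=
  continuous_rng.comp continuous_inv

lemma cocycle_one (g : Gpd G) : cocycle (fun _ => 1) g = g.lag := by
  obtain ⟨μ, ν, x, h, h', rfl⟩ := g.exists_eq_mk'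
  rw [cocycle_mk']
  simp [FinPath.weight, FinPath.length]

lemma Gpd.ext_of_cocycle {g h : Gpd G} (h1 : g.rng = h.rng)
    (h2 : cocycle (fun _ => 1) g = cocycle (fun _ => 1) h) (h3 : g.src = h.src) : g = h :=
  Gpd.ext h1 (by simpa [cocycle_one] using h2) h3

/-- The lag is the cocycle of the constant function 1, hence continuous, and range, lag and source
together separate the elements of 𝒢. -/
instance : T2Space (Gpd G) := by
  refine T2Space.of_injective_continuous
    (f := fun g : Gpd G => (g.rng, cocycle (fun _ => (1 : ℝ)) g, g.src)) (fun g h e => ?_)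
    (continuous_rng.prodMk ((continuous_cocycle _).prodMk continuous_src))
  simp only [Prod.mk.injEq] at e
  exact Gpd.ext_of_cocycle e.1 e.2.1 e.2.2

/-- The parametrization of the bisection `basicBisection μ ν`. -/
def Gpd.mkOn (μ ν : FinPath G) (h : μ.range = ν.range)
    (x : cylinder (FinPath.ofVertex G μ.range)) : Gpd G :=
  Gpd.mk' μ ν x.1 (mem_cylinder_ofVertex.1 x.2) ((mem_cylinder_ofVertex.1 x.2).trans h)

/-- If the bisections of (μ, ν) and (μ', ν') share a point, one pair extends the other by a common
tail κ. The preimage is then everything or contains the neighbourhood Z(κ) of the point. Continuity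
makes the basic bisections compact, and therefore clopen. -/
lemma continuous_mkOn (μ ν : FinPath G) (h : μ.range = ν.range) :
    Continuous (Gpd.mkOn μ ν h) := by
  have hr : Continuous fun x => (Gpd.mkOn μ ν h x).rng := continuous_concat μ
  have hs : Continuous fun x => (Gpd.mkOn μ ν h x).src := by
    have h1 := continuous_concat ν
    have h2 : Continuous fun x : cylinder (FinPath.ofVertex G μ.range) =>
        (⟨x.1, mem_cylinder_ofVertex.2 ((mem_cylinder_ofVertex.1 x.2).trans h)⟩ :
          cylinder (FinPath.ofVertex G ν.range)) := by fun_prop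
    exact h1.comp h2
  refine continuous_generateFrom_iff.2 ?_
  rintro _ ⟨μ', ν', A, B, -, rfl⟩
  have hW : IsOpen (Gpd.mkOn μ ν h ⁻¹' basicBisection μ' ν') := by
    rw [isOpen_iff_forall_mem_open]
    rintro ⟨x, hx⟩ hxW
    obtain ⟨y, k, k', e⟩ := mem_basicBisection.1 hxW
    rcases le_total μ'.length μ.length with hl | hl
    · obtain ⟨κ, hκ, hκ', -, rfl, rfl, -⟩ := Gpd.rep_compare e.symm hl
      refine ⟨Set.univ, fun z _ => ?_, isOpen_univ, trivial⟩
      have hz := (mem_cylinder_ofVertex.1 z.2).trans (μ'.range_append κ hκ)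
      refine mem_basicBisection.2 ⟨concat κ z.1 hz, _, _, Gpd.mk'_append μ' ν' κ z.1 hκ hκ' hz⟩
    · obtain ⟨κ, hκ, hκ', hy, rfl, rfl, hxy⟩ := Gpd.rep_compare e hl
      refine ⟨Subtype.val ⁻¹' cylinder κ, fun z hz => ?_,
        (isOpen_cylinder κ).preimage continuous_subtype_val, ?_⟩
      · obtain ⟨z, hz'⟩ := z
        obtain ⟨w, hw, rfl⟩ := mem_cylinder_iff.1 (show z ∈ cylinder κ from hz)
        exact mem_basicBisection.2 ⟨w, _, _, (Gpd.mk'_append μ ν κ w hκ hκ' hw).symm⟩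
      · rw [Set.mem_preimage, hxy]
        exact concat_mem_cylinder _ _ _
  rw [basicSet_eq]
  exact hW.inter (((isOpen_cylinderDiff μ' A).preimage hr).inter
    ((isOpen_cylinderDiff ν' B).preimage hs))

lemma range_mkOn (μ ν : FinPath G) (h : μ.range = ν.range) :
    Set.range (Gpd.mkOn μ ν h) = basicBisection μ ν := by
  ext g
  rw [mem_basicBisection]
  constructor
  · rintro ⟨x, rfl⟩
    exact ⟨x.1, _, _, rfl⟩
  · rintro ⟨x, k, k', rfl⟩
    exact ⟨⟨x, mem_cylinder_ofVertex.2 k⟩, rfl⟩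

instance (μ : FinPath G) : CompactSpace (cylinder μ) :=
  isCompact_iff_compactSpace.1 (isCompact_cylinder μ)

lemma isCompact_basicBisection (μ ν : FinPath G) : IsCompact (basicBisection μ ν) := by
  by_cases h : μ.range = ν.range
  · rw [← range_mkOn μ ν h]
    exact isCompact_range (continuous_mkOn μ ν h)
  · rw [basicBisection_eq_empty h]
    exact isCompact_empty

lemma isClopen_basicBisection (μ ν : FinPath G) : IsClopen (basicBisection μ ν) :=
  ⟨(isCompact_basicBisection μ ν).isClosed, isOpen_basicBisection μ ν⟩

lemma continuous_unit : Continuous (Gpd.unit : PathSpace G → Gpd G) := by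
  refine continuous_iff_continuousAt.2 fun x => ?_
  have ho : IsOpen (cylinder (FinPath.ofVertex G x.src)) := isOpen_cylinder _
  have hc : ContinuousOn (Gpd.unit : PathSpace G → Gpd G) (cylinder (FinPath.ofVertex G x.src)) := by
    rw [continuousOn_iff_continuous_domRestrict]
    refine (continuous_mkOn (FinPath.ofVertex G x.src) (FinPath.ofVertex G x.src) rfl).congr
      fun y => ?_
    ext1
    · exact concat_ofVertex y.1 (mem_cylinder_ofVertex.1 y.2)
    · exact sub_self _
    · exact concat_ofVertex y.1 (mem_cylinder_ofVertex.1 y.2)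
  exact hc.continuousAt (ho.mem_nhds (mem_cylinder_ofVertex.2 rfl))

lemma injOn_rng_basicBisection (μ ν : FinPath G) : Set.InjOn Gpd.rng (basicBisection μ ν) := by
  intro g hg g' hg' e
  obtain ⟨x, h, h', rfl⟩ := mem_basicBisection.1 hg
  obtain ⟨y, k, k', rfl⟩ := mem_basicBisection.1 hg'
  obtain rfl := concat_injective μ h k e
  rfl

lemma injOn_src_basicBisection (μ ν : FinPath G) : Set.InjOn Gpd.src (basicBisection μ ν) := by
  intro g hg g' hg' e
  obtain ⟨x, h, h', rfl⟩ := mem_basicBisection.1 hg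
  obtain ⟨y, k, k', rfl⟩ := mem_basicBisection.1 hg'
  obtain rfl := concat_injective ν h' k' e
  rfl

lemma isOpenBisection_basicBisection (μ ν : FinPath G) : IsOpenBisection (basicBisection μ ν) :=
  ⟨isOpen_basicBisection μ ν, injOn_rng_basicBisection μ ν, injOn_src_basicBisection μ ν⟩

lemma unit_mem_basicBisection_self {μ : FinPath G} {x : PathSpace G} (h : x ∈ cylinder μ) :
    Gpd.unit x ∈ basicBisection μ μ := by
  obtain ⟨y, hy, rfl⟩ := mem_cylinder_iff.1 h
  exact mem_basicBisection.2 ⟨y, hy, hy, Gpd.ext rfl (sub_self _).symm rfl⟩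

lemma basicBisection_self (μ : FinPath G) : basicBisection μ μ = Gpd.unit '' cylinder μ := by
  ext g
  constructor
  · intro hg
    obtain ⟨x, h, -, rfl⟩ := mem_basicBisection.1 hg
    exact ⟨concat μ x h, concat_mem_cylinder _ _ _, Gpd.ext rfl (sub_self _).symm rfl⟩
  · rintro ⟨x, hx, rfl⟩
    exact unit_mem_basicBisection_self hx

/-! ### Reduced representations -/

/-- The pair `(μ, ν)` has common range and no common final segment. -/
def IsReducedPair (μ ν : FinPath G) : Prop :=
  μ.range = ν.range ∧ ∀ (μ' ν' κ : FinPath G) (h : κ.src = μ'.range) (h' : κ.src = ν'.range),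
    μ = μ'.append κ h → ν = ν'.append κ h' → κ.length = 0

lemma IsReducedPair.symm {μ ν : FinPath G} (h : IsReducedPair μ ν) : IsReducedPair ν μ :=
  ⟨h.1.symm, fun μ' ν' κ k k' e e' => h.2 ν' μ' κ k' k e' e⟩

/-- A common final segment is moved into the tail x; the length of μ decreases, so this stops. -/
lemma Gpd.exists_reduced (g : Gpd G) :
    ∃ μ ν x h h', IsReducedPair μ ν ∧ g = Gpd.mk' μ ν x h h' := by
  obtain ⟨μ, ν, x, h, h', rfl⟩ := g.exists_eq_mk'
  induction hn : μ.length using Nat.strong_induction_on generalizing μ ν x with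
  | _ n ih =>
    by_cases hr : IsReducedPair μ ν
    · exact ⟨μ, ν, x, h, h', hr, rfl⟩
    · simp only [IsReducedPair, h.symm.trans h', true_and, not_forall] at hr
      obtain ⟨μ', ν', κ, k, k', rfl, rfl, hκ⟩ := hr
      have hx := h.trans (μ'.range_append κ k)
      rw [Gpd.mk'_append μ' ν' κ x k k' hx]
      refine ih μ'.length ?_ _ _ _ _ _ rfl
      rw [length_append] at hn
      omega

lemma IsReducedPair.unique {μ ν μ' ν' : FinPath G} {x y : PathSpace G} {h : x.src = μ.range}
    {h' : x.src = ν.range} {k : y.src = μ'.range} {k' : y.src = ν'.range}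
    (hr : IsReducedPair μ ν) (hr' : IsReducedPair μ' ν')
    (e : Gpd.mk' μ ν x h h' = Gpd.mk' μ' ν' y k k') : μ = μ' ∧ ν = ν' ∧ x = y := by
  wlog hl : μ.length ≤ μ'.length generalizing μ ν μ' ν' x y
  · obtain ⟨h1, h2, h3⟩ := this hr' hr e.symm (by omega)
    exact ⟨h1.symm, h2.symm, h3.symm⟩
  obtain ⟨κ, hκ, hκ', hy, rfl, rfl, rfl⟩ := Gpd.rep_compare e hl
  -- The longer reduced pair is the shorter one with κ appended on both sides, so reducedness leaves
  -- only the empty κ.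
  have h0 := hr'.2 μ ν κ hκ hκ' rfl rfl
  have e1 : μ.append κ hκ = μ :=
    FinPath.ext' rfl (by simp [FinPath.append, List.eq_nil_of_length_eq_zero h0])
  have e2 : ν.append κ hκ' = ν :=
    FinPath.ext' rfl (by simp [FinPath.append, List.eq_nil_of_length_eq_zero h0])
  have hsrc : y.src = μ.range := k.trans (congrArg FinPath.range e1)
  refine ⟨e1.symm, e2.symm, PathSpace.ext' (h.trans hsrc.symm) fun i => ?_⟩
  rw [concat_edge, if_neg (by omega), h0, Nat.sub_zero]

end GroupoidTopology

end GraphKMS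

namespace GraphKMS

section Measures

open MeasureTheory

variable {V E : Type*} {G : EGraph V E}

/-! ### Measures on the path space -/

lemma isPiSystem_cylinder : IsPiSystem (Set.range (cylinder : FinPath G → Set (PathSpace G))) := by
  rintro _ ⟨μ, rfl⟩ _ ⟨ν, rfl⟩ ⟨x, hμ, hν⟩
  rcases le_total μ.length ν.length with hl | hl
  · obtain ⟨κ, hκ, rfl⟩ := exists_append_of_mem_cylinder hμ hν hl
    exact ⟨_, (Set.inter_eq_right.2 (cylinder_append_subset _ _ _)).symm⟩
  · obtain ⟨κ, hκ, rfl⟩ := exists_append_of_mem_cylinder hν hμ hl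
    exact ⟨_, (Set.inter_eq_left.2 (cylinder_append_subset _ _ _)).symm⟩

lemma borel_eq_generateFrom_cylinder [Countable V] [Countable E] :
    (inferInstance : MeasurableSpace (PathSpace G)) =
      MeasurableSpace.generateFrom (Set.range (cylinder : FinPath G → Set (PathSpace G))) := by
  refine le_antisymm ?_ (MeasurableSpace.generateFrom_le ?_)
  · change borel _ ≤ _
    rw [borel_eq_generateFrom_of_subbasis (α := PathSpace G) rfl]
    refine MeasurableSpace.generateFrom_le ?_
    rintro _ ⟨μ, A, rfl⟩
    refine MeasurableSet.diff (MeasurableSpace.measurableSet_generateFrom ⟨μ, rfl⟩) ?_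
    exact A.measurableSet_biUnion fun ν _ => MeasurableSpace.measurableSet_generateFrom ⟨ν, rfl⟩
  · rintro _ ⟨μ, rfl⟩
    exact measurableSet_cylinder μ

/-- Cylinders are a π-system generating the Borel sets, and countably many sets Z(v) of finite
measure cover Ω_G. -/
lemma measure_ext_of_cylinder [Countable V] [Countable E] {m m' : Measure (PathSpace G)}
    (h : ∀ μ, m (cylinder μ) = m' (cylinder μ))
    (hfin : ∀ v, m (cylinder (FinPath.ofVertex G v)) ≠ ∞) : m = m' := by
  cases isEmpty_or_nonempty V with
  | inl hV =>
    have : IsEmpty (PathSpace G) := ⟨fun x => hV.elim x.src⟩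
    exact Measure.ext fun s _ => by simp [Set.eq_empty_of_isEmpty s]
  | inr hV =>
    obtain ⟨f, hf⟩ := exists_surjective_nat V
    refine Measure.ext_of_generateFrom_of_iUnion _ (fun n => cylinder (FinPath.ofVertex G (f n)))
      borel_eq_generateFrom_cylinder isPiSystem_cylinder ?_ (fun n => ⟨_, rfl⟩)
      (fun n => hfin _) ?_
    · rw [← iUnion_cylinder_ofVertex]
      exact hf.iUnion_comp fun v => cylinder (FinPath.ofVertex G v)
    · rintro _ ⟨μ, rfl⟩
      exact h μ

lemma continuous_of_isClopen {X Y : Type*} [TopologicalSpace X] [TopologicalSpace Y] {f : X → Y}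
    {U : Set X} (hU : IsClopen U) (h1 : ContinuousOn f U) (h2 : ContinuousOn f Uᶜ) :
    Continuous f :=
  continuous_iff_continuousAt.2 fun x => (em (x ∈ U)).elim
    (fun hx => h1.continuousAt (hU.isOpen.mem_nhds hx))
    fun hx => h2.continuousAt (hU.compl.isOpen.mem_nhds hx)

open Classical in
/-- Concatenation with `μ`, extended to all of `Ω_G` by the identity. -/
noncomputable def concatD (μ : FinPath G) (x : PathSpace G) : PathSpace G :=
  if h : x.src = μ.range then concat μ x h else x

lemma concatD_of_eq {μ : FinPath G} {x : PathSpace G} (h : x.src = μ.range) :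
    concatD μ x = concat μ x h := dif_pos h

lemma continuous_concatD (μ : FinPath G) : Continuous (concatD μ) := by
  refine continuous_of_isClopen (isClopen_cylinder (FinPath.ofVertex G μ.range)) ?_ ?_
  · rw [continuousOn_iff_continuous_domRestrict]
    refine (continuous_concat μ).congr fun x => ?_
    exact (concatD_of_eq (mem_cylinder_ofVertex.1 x.2)).symm
  · refine continuousOn_id.congr fun x hx => ?_
    exact dif_neg fun h => hx (mem_cylinder_ofVertex.2 h)

open Classical in
/-- The element `(μx, |μ| - |ν|, νx)` of `𝒢`, and `(x, 0, x)` where the former is undefined. -/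
noncomputable def mkD (μ ν : FinPath G) (x : PathSpace G) : Gpd G :=
  if h : x.src = μ.range ∧ x.src = ν.range then Gpd.mk' μ ν x h.1 h.2 else Gpd.unit x

lemma mkD_of_eq {μ ν : FinPath G} {x : PathSpace G} (h : x.src = μ.range) (h' : x.src = ν.range) :
    mkD μ ν x = Gpd.mk' μ ν x h h' := dif_pos ⟨h, h'⟩

lemma continuous_mkD (μ ν : FinPath G) : Continuous (mkD μ ν) := by
  by_cases hr : μ.range = ν.range
  · refine continuous_of_isClopen (isClopen_cylinder (FinPath.ofVertex G μ.range)) ?_ ?_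
    · rw [continuousOn_iff_continuous_domRestrict]
      refine (continuous_mkOn μ ν hr).congr fun x => ?_
      exact (mkD_of_eq (mem_cylinder_ofVertex.1 x.2)
        ((mem_cylinder_ofVertex.1 x.2).trans hr)).symm
    · refine continuous_unit.continuousOn.congr fun x hx => ?_
      exact dif_neg fun h => hx (mem_cylinder_ofVertex.2 h.1)
  · refine continuous_unit.congr fun x => ?_
    rw [mkD, dif_neg fun h => hr (h.1.symm.trans h.2)]

/-- The factor `e^{-βF(μ)}`. -/
noncomputable def pathFactor (F : E → ℝ) (β : ℝ) (μ : FinPath G) : ℝ≥0∞ :=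
  ENNReal.ofReal (Real.exp (-β * μ.weight F))

lemma pathFactor_append (F : E → ℝ) (β : ℝ) (μ ν : FinPath G) (h : ν.src = μ.range) :
    pathFactor F β (μ.append ν h) = pathFactor F β μ * pathFactor F β ν := by
  rw [pathFactor, weight_append, mul_add, Real.exp_add, ENNReal.ofReal_mul (Real.exp_pos _).le]
  rfl

lemma pathFactor_cons (F : E → ℝ) (β : ℝ) (e : E) (κ : FinPath G) (h : κ.src = G.r e) :
    pathFactor F β (FinPath.cons e κ h) = ENNReal.ofReal (Real.exp (-β * F e)) *
      pathFactor F β κ := by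
  rw [pathFactor, FinPath.weight_cons, mul_add, Real.exp_add,
    ENNReal.ofReal_mul (Real.exp_pos _).le]
  rfl

lemma pathFactor_ne_top (F : E → ℝ) (β : ℝ) (μ : FinPath G) : pathFactor F β μ ≠ ∞ :=
  ENNReal.ofReal_ne_top

@[simp] lemma pathFactor_ofVertex (F : E → ℝ) (β : ℝ) (v : V) :
    pathFactor F β (FinPath.ofVertex G v) = 1 := by
  simp [pathFactor]

/-- The measure of `Z(μ)` is `e^{-βF(μ)}` times the measure of `Z(r(μ))`, and the latter is
finite. -/
structure IsCylinderConformal (F : E → ℝ) (β : ℝ) (m : Measure (PathSpace G)) : Prop where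
  apply_cylinder : ∀ μ : FinPath G,
    m (cylinder μ) = pathFactor F β μ * m (cylinder (FinPath.ofVertex G μ.range))
  ne_top : ∀ v, m (cylinder (FinPath.ofVertex G v)) ≠ ∞

lemma concatD_mem_cylinder_append {μ κ : FinPath G} {h : κ.src = μ.range} {x : PathSpace G}
    (hx : x.src = μ.range) : concatD μ x ∈ cylinder (μ.append κ h) ↔ x ∈ cylinder κ := by
  rw [concatD_of_eq hx, concat_mem_cylinder_append]

lemma concatD_mem_cylinder {μ : FinPath G} {x : PathSpace G} (hx : x.src = μ.range) :
    concatD μ x ∈ cylinder μ := by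
  rw [concatD_of_eq hx]; exact concat_mem_cylinder _ _ _

/-! ### Conformality on bisections and conformality on cylinder sets. -/

section Conformal

variable [Countable V] [Countable E] {F : E → ℝ} {β : ℝ} {m : Measure (PathSpace G)}

/-- On `Z(μ)` the measure is the image of that on `Z(r(μ))`, scaled by `e^{-βF(μ)}`. -/
lemma IsCylinderConformal.restrict_cylinder (hm : IsCylinderConformal F β m) (μ : FinPath G) :
    m.restrict (cylinder μ) = pathFactor F β μ •
      (m.restrict (cylinder (FinPath.ofVertex G μ.range))).map (concatD μ) := by
  have hmeas := (continuous_concatD μ).measurable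
  refine measure_ext_of_cylinder (fun ν => ?_) fun v => ?_
  · rw [Measure.restrict_apply (measurableSet_cylinder ν), Measure.smul_apply,
      Measure.map_apply hmeas (measurableSet_cylinder ν),
      Measure.restrict_apply (hmeas (measurableSet_cylinder ν)), smul_eq_mul]
    -- Both measures are compared on cylinders Z(ν); one that meets Z(μ) is contained in Z(μ) or
    -- contains it.
    by_cases hmeet : (cylinder ν ∩ cylinder μ).Nonempty
    · obtain ⟨x, hν, hμ⟩ := hmeet
      rcases le_total μ.length ν.length with hl | hl
      · obtain ⟨κ, hκ, rfl⟩ := exists_append_of_mem_cylinder hμ hν hl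
        have : concatD μ ⁻¹' cylinder (μ.append κ hκ) ∩ cylinder (FinPath.ofVertex G μ.range) =
            cylinder κ := by
          ext y
          constructor
          · rintro ⟨h1, h2⟩
            exact (concatD_mem_cylinder_append (mem_cylinder_ofVertex.1 h2)).1 h1
          · intro hy
            have hy' : y.src = μ.range := hy.1.trans hκ
            exact ⟨(concatD_mem_cylinder_append hy').2 hy, mem_cylinder_ofVertex.2 hy'⟩
        rw [this, Set.inter_eq_left.2 (cylinder_append_subset _ _ _), hm.apply_cylinder,
          pathFactor_append, hm.apply_cylinder κ, FinPath.range_append, mul_assoc]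
      · obtain ⟨κ, hκ, rfl⟩ := exists_append_of_mem_cylinder hν hμ hl
        rw [Set.inter_eq_right.2 (cylinder_append_subset _ _ _), hm.apply_cylinder,
          Set.inter_eq_right.2]
        intro y hy
        exact cylinder_append_subset _ _ _ (concatD_mem_cylinder (mem_cylinder_ofVertex.1 hy))
    · rw [Set.not_nonempty_iff_eq_empty] at hmeet
      have : concatD μ ⁻¹' cylinder ν ∩ cylinder (FinPath.ofVertex G μ.range) = ∅ := by
        refine Set.eq_empty_of_forall_notMem fun y hy => ?_
        exact (hmeet.le ⟨hy.1, concatD_mem_cylinder (mem_cylinder_ofVertex.1 hy.2)⟩).elim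
      rw [hmeet, this]
      simp
  · exact ((Measure.restrict_apply_le _ _).trans_lt (hm.ne_top v).lt_top).ne

lemma IsCylinderConformal.lintegral_cylinder (hm : IsCylinderConformal F β m) (μ : FinPath G)
    {f : PathSpace G → ℝ≥0∞} (hf : Measurable f) :
    ∫⁻ x in cylinder μ, f x ∂m = pathFactor F β μ *
      ∫⁻ x in cylinder (FinPath.ofVertex G μ.range), f (concatD μ x) ∂m := by
  rw [hm.restrict_cylinder μ, lintegral_smul_measure,
    lintegral_map hf (continuous_concatD μ).measurable, smul_eq_mul]

/-- The preimage of `W` in the parametrization of the bisection `basicBisection μ ν`. -/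
def paramSet (μ ν : FinPath G) (W : Set (Gpd G)) : Set (PathSpace G) :=
  {x | x.src = μ.range ∧ x.src = ν.range ∧ mkD μ ν x ∈ W}

omit [Countable V] [Countable E] in
lemma concatD_injOn (μ : FinPath G) : Set.InjOn (concatD μ) {x | x.src = μ.range} := by
  intro x hx y hy e
  rw [concatD_of_eq hx, concatD_of_eq hy] at e
  exact concat_injective μ _ _ e

omit [Countable V] [Countable E] in
lemma measurableSet_paramSet (μ ν : FinPath G) {W : Set (Gpd G)} (hW : IsOpen W) :
    MeasurableSet (paramSet μ ν W) := by
  have h1 := measurableSet_cylinder (FinPath.ofVertex G μ.range)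
  have h2 := measurableSet_cylinder (FinPath.ofVertex G ν.range)
  convert h1.inter (h2.inter (hW.preimage (continuous_mkD μ ν)).measurableSet) using 1
  ext x
  simp [paramSet]

omit [Countable V] [Countable E] in
-- A continuous injection of the compact set Z(r(μ)) into a Hausdorff space is a closed embedding,
-- so it preserves Borel sets.
lemma measurableSet_concatD_image (μ : FinPath G) {B : Set (PathSpace G)} (hB : MeasurableSet B)
    (hB' : B ⊆ cylinder (FinPath.ofVertex G μ.range)) : MeasurableSet (concatD μ '' B) := by
  have hemb : MeasurableEmbedding fun x : cylinder (FinPath.ofVertex G μ.range) =>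
      concatD μ x.1 := by
    refine (Continuous.isClosedEmbedding ((continuous_concatD μ).comp continuous_subtype_val)
      ?_).measurableEmbedding
    intro x y e
    exact Subtype.ext (concatD_injOn μ (mem_cylinder_ofVertex.1 x.2)
      (mem_cylinder_ofVertex.1 y.2) e)
  convert hemb.measurableSet_image.2 (hB.preimage measurable_subtype_coe) using 1
  ext y
  constructor
  · rintro ⟨x, hx, rfl⟩
    exact ⟨⟨x, hB' hx⟩, hx, rfl⟩
  · rintro ⟨x, hx, rfl⟩
    exact ⟨x, hx, rfl⟩

lemma IsCylinderConformal.apply_image (hm : IsCylinderConformal F β m) (μ : FinPath G)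
    {B : Set (PathSpace G)} (hB : MeasurableSet B)
    (hB' : B ⊆ cylinder (FinPath.ofVertex G μ.range)) :
    m (concatD μ '' B) = pathFactor F β μ * m B := by
  have hsub : concatD μ '' B ⊆ cylinder μ := by
    rintro _ ⟨x, hx, rfl⟩
    exact concatD_mem_cylinder (mem_cylinder_ofVertex.1 (hB' hx))
  have hms := measurableSet_concatD_image μ hB hB'
  have hmeas := (continuous_concatD μ).measurable
  rw [← Set.inter_eq_left.2 hsub, ← Measure.restrict_apply hms, hm.restrict_cylinder μ,
    Measure.smul_apply, Measure.map_apply hmeas hms, Measure.restrict_apply (hmeas hms),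
    smul_eq_mul]
  congr 2
  ext x
  constructor
  · rintro ⟨⟨y, hy, e⟩, hx⟩
    rwa [← concatD_injOn μ (mem_cylinder_ofVertex.1 (hB' hy)) (mem_cylinder_ofVertex.1 hx) e]
  · intro hx
    exact ⟨⟨x, hx, rfl⟩, hB' hx⟩

variable (G) in
/-- The index set of the partition of `𝒢` into basic bisections of reduced pairs. -/
abbrev ReducedPair : Type _ := {p : FinPath G × FinPath G // IsReducedPair p.1 p.2}

omit [Countable V] [Countable E] in
lemma rng_image_eq (p : ReducedPair G) (W : Set (Gpd G)) :
    Gpd.rng '' (W ∩ basicBisection p.1.1 p.1.2) =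
      concatD p.1.1 '' paramSet p.1.1 p.1.2 W := by
  ext y
  constructor
  · rintro ⟨g, ⟨hg, hg'⟩, rfl⟩
    obtain ⟨x, h, h', rfl⟩ := mem_basicBisection.1 hg'
    exact ⟨x, ⟨h, h', by rwa [mkD_of_eq h h']⟩, by rw [concatD_of_eq h]; rfl⟩
  · rintro ⟨x, ⟨h, h', hx⟩, rfl⟩
    rw [mkD_of_eq h h'] at hx
    exact ⟨_, ⟨hx, mk'_mem_basicBisection _ _ _ _ _⟩, by rw [concatD_of_eq h]; rfl⟩

omit [Countable V] [Countable E] in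
lemma src_image_eq (p : ReducedPair G) (W : Set (Gpd G)) :
    Gpd.src '' (W ∩ basicBisection p.1.1 p.1.2) =
      concatD p.1.2 '' paramSet p.1.1 p.1.2 W := by
  ext y
  constructor
  · rintro ⟨g, ⟨hg, hg'⟩, rfl⟩
    obtain ⟨x, h, h', rfl⟩ := mem_basicBisection.1 hg'
    exact ⟨x, ⟨h, h', by rwa [mkD_of_eq h h']⟩, by rw [concatD_of_eq h']; rfl⟩
  · rintro ⟨x, ⟨h, h', hx⟩, rfl⟩
    rw [mkD_of_eq h h'] at hx
    exact ⟨_, ⟨hx, mk'_mem_basicBisection _ _ _ _ _⟩, by rw [concatD_of_eq h']; rfl⟩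

omit [Countable V] [Countable E] in
lemma iUnion_reducedPair (W : Set (Gpd G)) :
    ⋃ p : ReducedPair G, (W ∩ basicBisection p.1.1 p.1.2) = W := by
  refine Set.Subset.antisymm (Set.iUnion_subset fun p => Set.inter_subset_left) fun g hg => ?_
  obtain ⟨μ, ν, x, h, h', hr, rfl⟩ := g.exists_reduced
  exact Set.mem_iUnion.2 ⟨⟨(μ, ν), hr⟩, hg, mk'_mem_basicBisection _ _ _ _ _⟩

omit [Countable V] [Countable E] in
lemma ReducedPair.eq_of_mem {p q : ReducedPair G} {g : Gpd G}
    (hp : g ∈ basicBisection p.1.1 p.1.2) (hq : g ∈ basicBisection q.1.1 q.1.2) : p = q := by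
  obtain ⟨x, h, h', rfl⟩ := mem_basicBisection.1 hp
  obtain ⟨y, k, k', e⟩ := mem_basicBisection.1 hq
  obtain ⟨h1, h2, -⟩ := p.2.unique q.2 e
  exact Subtype.ext (Prod.ext h1 h2)

omit [Countable V] [Countable E] in
lemma disjoint_image_reducedPair {W : Set (Gpd G)} {f : Gpd G → PathSpace G} (hf : Set.InjOn f W) :
    Pairwise (Function.onFun Disjoint fun p : ReducedPair G =>
      f '' (W ∩ basicBisection p.1.1 p.1.2)) := by
  intro p q hpq
  refine Set.disjoint_left.2 ?_
  rintro _ ⟨g, hg, rfl⟩ ⟨g', hg', e⟩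
  obtain rfl := hf hg'.1 hg.1 e
  exact hpq (ReducedPair.eq_of_mem hg.2 hg'.2)

omit [Countable V] [Countable E] in
lemma bisectionDensity_apply {W : Set (Gpd G)} (hW : Set.InjOn Gpd.rng W) {g : Gpd G}
    (hg : g ∈ W) : bisectionDensity F β W g.rng =
      ENNReal.ofReal (Real.exp (β * cocycle F g)) := by
  have hinj : Function.Injective fun g : W => g.1.rng :=
    fun g h e => Subtype.ext (hW g.2 h.2 e)
  exact hinj.extend_apply _ _ (⟨g, hg⟩ : W)

/-- The bisection is cut into countably many pieces along the reduced pairs (μ, ν). On each piece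
c_F = F(μ) - F(ν) is constant, and range and source are the images of the same set of tails under
concatenation with μ and with ν, which scale m by e^{-βF(μ)} and e^{-βF(ν)}. -/
lemma IsCylinderConformal.apply_bisection (hm : IsCylinderConformal F β m) {W : Set (Gpd G)}
    (hW : IsOpenBisection W) :
    m (Gpd.src '' W) = ∫⁻ x in Gpd.rng '' W, bisectionDensity F β W x ∂m := by
  obtain ⟨ho, hr, hs⟩ := hW
  have hB (p : ReducedPair G) := measurableSet_paramSet p.1.1 p.1.2 ho
  have hBr (p : ReducedPair G) : paramSet p.1.1 p.1.2 W ⊆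
    cylinder (FinPath.ofVertex G p.1.1.range) := fun x hx => mem_cylinder_ofVertex.2 hx.1
  have hBs (p : ReducedPair G) : paramSet p.1.1 p.1.2 W ⊆
    cylinder (FinPath.ofVertex G p.1.2.range) := fun x hx => mem_cylinder_ofVertex.2 hx.2.1
  have hsW : Gpd.src '' W = ⋃ p : ReducedPair G, Gpd.src '' (W ∩ basicBisection p.1.1 p.1.2) := by
    rw [← Set.image_iUnion, iUnion_reducedPair]
  have hrW : Gpd.rng '' W = ⋃ p : ReducedPair G, Gpd.rng '' (W ∩ basicBisection p.1.1 p.1.2) := by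
    rw [← Set.image_iUnion, iUnion_reducedPair]
  have hms (p : ReducedPair G) : MeasurableSet (Gpd.src '' (W ∩ basicBisection p.1.1 p.1.2)) := by
    rw [src_image_eq]; exact measurableSet_concatD_image _ (hB p) (hBs p)
  have hmr (p : ReducedPair G) : MeasurableSet (Gpd.rng '' (W ∩ basicBisection p.1.1 p.1.2)) := by
    rw [rng_image_eq]; exact measurableSet_concatD_image _ (hB p) (hBr p)
  rw [hsW, hrW, measure_iUnion (disjoint_image_reducedPair hs) hms,
    lintegral_iUnion hmr (disjoint_image_reducedPair hr)]
  refine tsum_congr fun p => ?_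
  have hconst : ∀ x ∈ Gpd.rng '' (W ∩ basicBisection p.1.1 p.1.2), bisectionDensity F β W x =
      ENNReal.ofReal (Real.exp (β * (p.1.1.weight F - p.1.2.weight F))) := by
    rintro _ ⟨g, ⟨hg, hg'⟩, rfl⟩
    rw [bisectionDensity_apply hr hg]
    obtain ⟨x, h, h', rfl⟩ := mem_basicBisection.1 hg'
    rw [cocycle_mk']
  rw [setLIntegral_congr_fun (hmr p) hconst, setLIntegral_const, rng_image_eq, src_image_eq,
    hm.apply_image _ (hB p) (hBs p), hm.apply_image _ (hB p) (hBr p), ← mul_assoc, pathFactor,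
    pathFactor, ← ENNReal.ofReal_mul (Real.exp_pos _).le, ← Real.exp_add]
  congr 4
  ring

omit [Countable V] [Countable E] in
-- The bisection {(μx, |μ|, x)} has range Z(μ), source Z(r(μ)) and constant cocycle F(μ). Finiteness
-- on Z(v) is regularity together with compactness.
lemma IsKMSMeasure.isCylinderConformal (hm : IsKMSMeasure F β m) : IsCylinderConformal F β m := by
  obtain ⟨hreg, h⟩ := hm
  refine ⟨fun μ => ?_, fun v => (isCompact_cylinder _).measure_lt_top.ne⟩
  let W := basicBisection μ (FinPath.ofVertex G μ.range)
  have hW := isOpenBisection_basicBisection μ (FinPath.ofVertex G μ.range)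
  have hs : Gpd.src '' W = cylinder (FinPath.ofVertex G μ.range) := by
    ext x
    constructor
    · rintro ⟨g, hg, rfl⟩
      obtain ⟨x, h, h', rfl⟩ := mem_basicBisection.1 hg
      exact concat_mem_cylinder _ _ _
    · intro hx
      have hx' := mem_cylinder_ofVertex.1 hx
      exact ⟨_, mk'_mem_basicBisection μ (FinPath.ofVertex G μ.range) x hx' hx',
        concat_ofVertex x hx'⟩
  have hr : Gpd.rng '' W = cylinder μ := by
    ext x
    constructor
    · rintro ⟨g, hg, rfl⟩
      obtain ⟨x, h, h', rfl⟩ := mem_basicBisection.1 hg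
      exact concat_mem_cylinder _ _ _
    · intro hx
      obtain ⟨y, hy, rfl⟩ := mem_cylinder_iff.1 hx
      exact ⟨_, mk'_mem_basicBisection μ (FinPath.ofVertex G μ.range) y hy hy, rfl⟩
  have hconst : ∀ x ∈ cylinder μ, bisectionDensity F β W x =
      ENNReal.ofReal (Real.exp (β * μ.weight F)) := by
    rw [← hr]
    rintro _ ⟨g, hg, rfl⟩
    rw [bisectionDensity_apply hW.2.1 hg]
    obtain ⟨x, h, h', rfl⟩ := mem_basicBisection.1 hg
    rw [cocycle_mk', FinPath.weight_ofVertex, sub_zero]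
  have := h W hW
  rw [hs, hr, setLIntegral_congr_fun (measurableSet_cylinder μ) hconst, setLIntegral_const] at this
  rw [this, ← mul_assoc, pathFactor, ← ENNReal.ofReal_mul (Real.exp_pos _).le, ← Real.exp_add]
  simp

lemma isKMSMeasure_iff : IsKMSMeasure F β m ↔ m.Regular ∧ IsCylinderConformal F β m :=
  ⟨fun h => ⟨h.1, h.isCylinderConformal⟩, fun h => ⟨h.1, fun _ hW => h.2.apply_bisection hW⟩⟩

/-! ### Almost harmonic vectors -/

omit [Countable V] [Countable E] in
-- Summation over edges instead of end vertices matches the decomposition of Z(v) by the first edge.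
lemma tsum_weightMatrix (F : E → ℝ) (β : ℝ) (ψ : V → ℝ≥0∞) (v : V) :
    ∑' w, weightMatrix G F β v w * ψ w =
      ∑' e : {e : E // G.s e = v}, ENNReal.ofReal (Real.exp (-β * F e.1)) * ψ (G.r e.1) := by
  have : ∀ w, weightMatrix G F β v w * ψ w = ∑' e : {e : {e : E // G.s e = v} // G.r e.1 = w},
      ENNReal.ofReal (Real.exp (-β * F e.1.1)) * ψ (G.r e.1.1) := by
    intro w
    rw [weightMatrix, ← ENNReal.tsum_mul_right]
    rw [← (Equiv.subtypeSubtypeEquivSubtypeInter (fun e => G.s e = v)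
      (fun e => G.r e = w)).tsum_eq]
    refine tsum_congr fun e => ?_
    rw [e.2]
    rfl
  simp_rw [this]
  rw [← ENNReal.tsum_sigma (f := fun w (e : {e : {e : E // G.s e = v} // G.r e.1 = w}) =>
    ENNReal.ofReal (Real.exp (-β * F e.1.1)) * ψ (G.r e.1.1))]
  exact (Equiv.sigmaFiberEquiv fun e : {e : E // G.s e = v} => G.r e.1).tsum_eq
    fun e => ENNReal.ofReal (Real.exp (-β * F e.1)) * ψ (G.r e.1)

omit [Countable V] [Countable E] in
lemma disjoint_cylinder_snoc (μ : FinPath G) : Pairwise (Function.onFun Disjoint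
    fun e : {e : E // G.s e = μ.range} => cylinder (μ.snoc e.1 e.2)) := by
  intro e e' hne
  refine Set.disjoint_left.2 fun x hx hx' => hne ?_
  have := eq_of_mem_cylinder hx hx' (by simp)
  have := congrArg FinPath.edges this
  exact Subtype.ext (by simpa using this)

omit [Countable V] in
-- The disjoint sets Z(e) with s(e) = v lie in Z(v), and they exhaust it when v ∉ V_∞.
lemma IsCylinderConformal.isAlmostHarmonic (hm : IsCylinderConformal F β m) :
    IsAlmostHarmonic G F β (vertexVector m) := by
  have key : ∀ v, ∑' w, weightMatrix G F β v w * vertexVector m w =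
      m (⋃ e : {e : E // G.s e = (FinPath.ofVertex G v).range},
        cylinder ((FinPath.ofVertex G v).snoc e.1 e.2)) := by
    intro v
    rw [tsum_weightMatrix, measure_iUnion (disjoint_cylinder_snoc _)
      fun e => measurableSet_cylinder _]
    refine tsum_congr fun e => ?_
    rw [hm.apply_cylinder, FinPath.range_snoc, pathFactor, FinPath.weight_snoc,
      FinPath.weight_ofVertex, zero_add]
    rfl
  refine ⟨hm.ne_top, fun v => ?_, fun v hv => ?_⟩
  · rw [key]
    exact measure_mono (Set.iUnion_subset fun e => cylinder_snoc_subset _ _ _)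
  · rw [key]
    exact congrArg m (cylinder_eq_iUnion_of_notMem (μ := FinPath.ofVertex G v) hv).symm

lemma IsCylinderConformal.ext {m' : Measure (PathSpace G)} (hm : IsCylinderConformal F β m)
    (hm' : IsCylinderConformal F β m') (h : vertexVector m = vertexVector m') : m = m' := by
  refine measure_ext_of_cylinder (fun μ => ?_) hm.ne_top
  rw [hm.apply_cylinder, hm'.apply_cylinder]
  exact congrArg _ (congrFun h μ.range)

end Conformal

end Measures

end GraphKMS

namespace GraphKMS

section Existence

open MeasureTheory Filter

variable {V E : Type*} {G : EGraph V E}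

/-! ### Existence of conformal measures -/

open Classical in
variable (G) in
/-- A point of `Z(v)`, which is the path `v` itself when `v ∈ V_∞`. -/
noncomputable def vertexPoint (v : V) : PathSpace G :=
  if h : v ∈ G.singular then .finite (FinPath.ofVertex G v) h else (exists_path G v).choose

lemma vertexPoint_mem_iff {v w : V} :
    vertexPoint G w ∈ cylinder (FinPath.ofVertex G v) ↔ w = v := by
  rw [mem_cylinder_ofVertex]
  have : (vertexPoint G w).src = w := by
    rw [vertexPoint]
    split_ifs with h
    · rfl
    · exact (exists_path G w).choose_spec
  rw [this]

lemma vertexPoint_notMem_cons {v : V} (hv : v ∈ G.singular) {e : E} {κ : FinPath G}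
    (h : κ.src = G.r e) : vertexPoint G v ∉ cylinder (FinPath.cons e κ h) := by
  intro hx
  rw [vertexPoint, dif_pos hv] at hx
  obtain ⟨ρ, hρ, e'⟩ := finite_mem_cylinder_iff.1 hx
  have := congrArg FinPath.length e'
  rw [length_append, FinPath.length_cons] at this
  simp only [FinPath.ofVertex, FinPath.length, List.length_nil] at this
  omega

/-- `e^{-βF(e)}`. -/
noncomputable def edgeFactor (F : E → ℝ) (β : ℝ) (e : E) : ℝ≥0∞ :=
  ENNReal.ofReal (Real.exp (-β * F e))

variable (G) in
/-- The part of the mass of `Z(v)` which must sit in the path `v`. -/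
noncomputable def defect (F : E → ℝ) (β : ℝ) (ψ : V → ℝ≥0∞) (v : V) : ℝ≥0∞ :=
  ψ v - ∑' e : {e : E // G.s e = v}, edgeFactor F β e.1 * ψ (G.r e.1)

variable (G) in
/-- The map on measures whose fixed points are the conformal measures with vertex vector `ψ`. -/
noncomputable def transfer (F : E → ℝ) (β : ℝ) (ψ : V → ℝ≥0∞) (m : Measure (PathSpace G)) :
    Measure (PathSpace G) :=
  Measure.sum (fun e : E => edgeFactor F β e •
      (m.restrict (cylinder (FinPath.ofVertex G (G.r e)))).map (concatD (FinPath.ofEdge G e))) +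
    Measure.sum (fun v : V => defect G F β ψ v • Measure.dirac (vertexPoint G v))

lemma transfer_apply_cylinder (F : E → ℝ) (β : ℝ) (ψ : V → ℝ≥0∞) (m : Measure (PathSpace G))
    (μ : FinPath G) : transfer G F β ψ m (cylinder μ) =
      ∑' e, edgeFactor F β e * m (concatD (FinPath.ofEdge G e) ⁻¹' cylinder μ ∩
        cylinder (FinPath.ofVertex G (G.r e))) +
      ∑' v, defect G F β ψ v * (cylinder μ).indicator 1 (vertexPoint G v) := by
  have hc := measurableSet_cylinder μ
  rw [transfer, Measure.add_apply, Measure.sum_apply _ hc, Measure.sum_apply _ hc]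
  congr 1
  · refine tsum_congr fun e => ?_
    have hm := (continuous_concatD (FinPath.ofEdge G e)).measurable
    rw [Measure.smul_apply, Measure.map_apply hm hc, Measure.restrict_apply (hm hc), smul_eq_mul]
  · refine tsum_congr fun v => ?_
    rw [Measure.smul_apply, Measure.dirac_apply' _ hc, smul_eq_mul]

variable {F : E → ℝ} {β : ℝ} {ψ : V → ℝ≥0∞}

/-- The edges leaving v carry the mass Σ e^{-βF(e)} ψ_{r(e)} into Z(v), and the point mass at v
supplies exactly what is missing to ψ_v. -/
lemma transfer_apply_vertex (hψ : IsAlmostHarmonic G F β ψ) {m : Measure (PathSpace G)}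
    (hm : ∀ v, m (cylinder (FinPath.ofVertex G v)) = ψ v) (v : V) :
    transfer G F β ψ m (cylinder (FinPath.ofVertex G v)) = ψ v := by
  rw [transfer_apply_cylinder]
  have h1 : ∑' w, defect G F β ψ w *
      (cylinder (FinPath.ofVertex G v)).indicator 1 (vertexPoint G w) = defect G F β ψ v := by
    rw [tsum_eq_single v]
    · rw [Set.indicator_of_mem (vertexPoint_mem_iff.2 rfl)]; simp
    · intro w hw
      rw [Set.indicator_of_notMem (fun h => hw (vertexPoint_mem_iff.1 h)), mul_zero]
  have h2 : ∑' e, edgeFactor F β e * m (concatD (FinPath.ofEdge G e) ⁻¹'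
        cylinder (FinPath.ofVertex G v) ∩ cylinder (FinPath.ofVertex G (G.r e))) =
      ∑' e : {e : E // G.s e = v}, edgeFactor F β e.1 * ψ (G.r e.1) := by
    rw [← tsum_subtype_eq_of_support_subset (s := {e | G.s e = v})]
    · refine tsum_congr fun e => ?_
      rw [← hm, Set.inter_eq_right.2]
      intro x hx
      refine mem_cylinder_ofVertex.2 ?_
      exact (concatD_mem_cylinder (μ := FinPath.ofEdge G e.1) (mem_cylinder_ofVertex.1 hx)).1.trans
        e.2
    · intro e he
      by_contra hne
      refine he ?_
      have : concatD (FinPath.ofEdge G e) ⁻¹' cylinder (FinPath.ofVertex G v) ∩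
          cylinder (FinPath.ofVertex G (G.r e)) = ∅ := by
        refine Set.eq_empty_of_forall_notMem fun x hx => hne ?_
        exact (concatD_mem_cylinder (μ := FinPath.ofEdge G e)
          (mem_cylinder_ofVertex.1 hx.2)).1.symm.trans (mem_cylinder_ofVertex.1 hx.1)
      simp only [this, measure_empty, mul_zero]
  rw [h1, h2, defect]
  refine add_tsub_cancel_of_le ?_
  have := hψ.2.1 v
  rwa [tsum_weightMatrix] at this

lemma defect_eq_zero (hψ : IsAlmostHarmonic G F β ψ) {v : V} (hv : v ∉ G.singular) :
    defect G F β ψ v = 0 := by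
  have := hψ.2.2 v hv
  rw [tsum_weightMatrix] at this
  exact tsub_eq_zero_of_le this.ge

/-- Only the summand of e reaches Z(eκ): a point mass with non-zero defect sits at a path v of
length zero with v ∈ V_∞. Each application of `transfer` thus corrects the cylinders that are one
edge longer. -/
lemma transfer_apply_cons (hψ : IsAlmostHarmonic G F β ψ) (m : Measure (PathSpace G))
    {e : E} {κ : FinPath G} (h : κ.src = G.r e) :
    transfer G F β ψ m (cylinder (FinPath.cons e κ h)) = edgeFactor F β e * m (cylinder κ) := by
  have hκ : κ.src = (FinPath.ofEdge G e).range := h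
  have hcons : FinPath.cons e κ h = (FinPath.ofEdge G e).append κ hκ := rfl
  rw [transfer_apply_cylinder]
  have h1 : ∀ w, defect G F β ψ w *
      (cylinder (FinPath.cons e κ h)).indicator 1 (vertexPoint G w) = 0 := by
    intro w
    by_cases hw : w ∈ G.singular
    · rw [Set.indicator_of_notMem (vertexPoint_notMem_cons hw h), mul_zero]
    · rw [defect_eq_zero hψ hw, zero_mul]
  simp only [h1, tsum_zero, add_zero]
  rw [tsum_eq_single e]
  · congr 2
    ext x
    constructor
    · rintro ⟨hx, hx'⟩
      exact (concatD_mem_cylinder_append (h := hκ) (mem_cylinder_ofVertex.1 hx')).1 hx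
    · intro hx
      have hxs : x.src = (FinPath.ofEdge G e).range := hx.1.trans hκ
      exact ⟨(concatD_mem_cylinder_append (h := hκ) hxs).2 hx, mem_cylinder_ofVertex.2 hxs⟩
  · intro e' he'
    have : concatD (FinPath.ofEdge G e') ⁻¹' cylinder (FinPath.cons e κ h) ∩
        cylinder (FinPath.ofVertex G (G.r e')) = ∅ := by
      refine Set.eq_empty_of_forall_notMem fun x hx => he' ?_
      have h1 := concatD_mem_cylinder (μ := FinPath.ofEdge G e') (mem_cylinder_ofVertex.1 hx.2)
      have h2 := cylinder_append_subset (FinPath.ofEdge G e) κ hκ hx.1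
      have := congrArg FinPath.edges (eq_of_mem_cylinder h1 h2 rfl)
      simpa [FinPath.ofEdge] using this
    rw [this, measure_empty, mul_zero]

variable (G F β ψ) in
/-- Measures whose values on the sets `Z(μ)` with `|μ| ≤ n` are those of a conformal measure. -/
noncomputable def approxMeasure : ℕ → Measure (PathSpace G)
  | 0 => Measure.sum fun v => ψ v • Measure.dirac (vertexPoint G v)
  | n + 1 => transfer G F β ψ (approxMeasure n)

lemma approxMeasure_vertex (hψ : IsAlmostHarmonic G F β ψ) (n : ℕ) (v : V) :
    approxMeasure G F β ψ n (cylinder (FinPath.ofVertex G v)) = ψ v := by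
  induction n generalizing v with
  | zero =>
    have hc := measurableSet_cylinder (FinPath.ofVertex G v)
    rw [approxMeasure, Measure.sum_apply _ hc, tsum_eq_single v]
    · rw [Measure.smul_apply, Measure.dirac_apply' _ hc,
        Set.indicator_of_mem (vertexPoint_mem_iff.2 rfl)]
      simp
    · intro w hw
      rw [Measure.smul_apply, Measure.dirac_apply' _ hc,
        Set.indicator_of_notMem (fun h => hw (vertexPoint_mem_iff.1 h)), smul_zero]
  | succ n ih => exact transfer_apply_vertex hψ ih v

lemma approxMeasure_cylinder (hψ : IsAlmostHarmonic G F β ψ) {n : ℕ} {μ : FinPath G}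
    (hn : μ.length ≤ n) :
    approxMeasure G F β ψ n (cylinder μ) = pathFactor F β μ * ψ μ.range := by
  induction n generalizing μ with
  | zero =>
    have := FinPath.eq_ofVertex (Nat.le_zero.1 hn)
    rw [this, approxMeasure_vertex hψ, pathFactor_ofVertex, one_mul, FinPath.range_ofVertex]
  | succ n ih =>
    by_cases h0 : μ.length = 0
    · rw [FinPath.eq_ofVertex h0, approxMeasure_vertex hψ, pathFactor_ofVertex, one_mul,
        FinPath.range_ofVertex]
    · obtain ⟨e, κ, h, rfl⟩ := FinPath.exists_cons h0
      rw [FinPath.length_cons] at hn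
      rw [approxMeasure, transfer_apply_cons hψ, ih (by omega), pathFactor_cons,
        FinPath.range_cons, edgeFactor, mul_assoc]

lemma isFiniteMeasureOnCompacts_of_vertex {m : Measure (PathSpace G)}
    (h : ∀ v, m (cylinder (FinPath.ofVertex G v)) ≠ ∞) : IsFiniteMeasureOnCompacts m := by
  refine ⟨fun K hK => ?_⟩
  obtain ⟨X, hX⟩ := IsCompact.exists_finset_vertex hK
  refine (measure_mono hX).trans_lt ((measure_biUnion_finset_le _ _).trans_lt ?_)
  exact ENNReal.sum_lt_top.2 fun v _ => (h v).lt_top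

open scoped CompactlySupported

/-- A sequence of measures with the same finite values on the sets `Z(v)` gives, along an
ultrafilter, a positive linear functional on `C_c(Ω_G)`. -/
lemma exists_limit_functional {m : ℕ → Measure (PathSpace G)}
    (hm : ∀ n v, m n (cylinder (FinPath.ofVertex G v)) = ψ v) (hψ : ∀ v, ψ v ≠ ∞) :
    ∃ Λ : C_c(PathSpace G, ℝ) →ₚ[ℝ] ℝ, ∀ f : C_c(PathSpace G, ℝ),
      Tendsto (fun n => ∫ x, f x ∂(m n)) (hyperfilter ℕ) (𝓝 (Λ f)) := by
  have hfin (n : ℕ) : IsFiniteMeasureOnCompacts (m n) :=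
    isFiniteMeasureOnCompacts_of_vertex fun v => by rw [hm]; exact hψ v
  have hint (n : ℕ) (f : C_c(PathSpace G, ℝ)) : Integrable f (m n) :=
    f.continuous.integrable_of_hasCompactSupport f.hasCompactSupport
  have hlim : ∀ f : C_c(PathSpace G, ℝ), ∃ L,
      Tendsto (fun n => ∫ x, f x ∂(m n)) (hyperfilter ℕ) (𝓝 L) := by
    intro f
    obtain ⟨X, hX⟩ := IsCompact.exists_finset_vertex f.hasCompactSupport
    obtain ⟨C, hC⟩ := f.hasCompactSupport.exists_bound_of_continuous f.continuous
    set S := ⋃ v ∈ X, cylinder (FinPath.ofVertex G v) with hS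
    set B : ℝ := C * (∑ v ∈ X, ψ v).toReal
    -- The bound dominates a norm, and so is nonnegative, only if there is a point at all.
    have hCnn : 0 ≤ C ∨ IsEmpty (PathSpace G) := by
      rcases isEmpty_or_nonempty (PathSpace G) with h | ⟨⟨x⟩⟩
      · exact Or.inr h
      · exact Or.inl ((norm_nonneg _).trans (hC x))
    have hb : ∀ n, ∫ x, f x ∂(m n) ∈ Set.Icc (-B) B := by
      intro n
      rcases hCnn with hCnn | hemp
      · have hSfin : m n S ≤ ∑ v ∈ X, ψ v :=
          (measure_biUnion_finset_le _ _).trans_eq (Finset.sum_congr rfl fun v _ => hm n v)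
        have hSum : ∑ v ∈ X, ψ v < ∞ := ENNReal.sum_lt_top.2 fun v _ => (hψ v).lt_top
        rw [Set.mem_Icc, ← abs_le, ← Real.norm_eq_abs]
        have h0 : ∫ x, f x ∂(m n) = ∫ x in S, f x ∂(m n) := by
          refine (setIntegral_eq_integral_of_forall_compl_eq_zero fun x hx => ?_).symm
          exact image_eq_zero_of_notMem_tsupport fun h => hx (hX h)
        rw [h0]
        refine (norm_setIntegral_le_of_norm_le_const (hSfin.trans_lt hSum)
          fun x _ => hC x).trans ?_
        exact mul_le_mul_of_nonneg_left (ENNReal.toReal_mono hSum.ne hSfin) hCnn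
      · have : m n = 0 := Measure.ext fun s _ => by simp [Set.eq_empty_of_isEmpty s]
        have hB : B = 0 := by
          have : (∑ v ∈ X, ψ v) = 0 := Finset.sum_eq_zero fun v _ => by
            rw [← hm n v, Set.eq_empty_of_isEmpty (cylinder _), measure_empty]
          simp [B, this]
        simp [hB, this]
    -- The integrals stay in a compact interval. A single ultrafilter serves all f at once, which is
    -- what makes the limit linear in f.
    obtain ⟨L, -, hL⟩ := isCompact_Icc.ultrafilter_le_nhds
      ((hyperfilter ℕ).map fun n => ∫ x, f x ∂(m n))
      (by
        rw [le_principal_iff]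
        exact Filter.mem_map.2 (Filter.Eventually.of_forall hb))
    exact ⟨L, hL⟩
  choose L hL using hlim
  refine ⟨PositiveLinearMap.mk₀ ⟨⟨L, fun f g => ?_⟩, fun c f => ?_⟩ fun f hf => ?_, hL⟩
  · refine tendsto_nhds_unique (hL (f + g)) ?_
    refine ((hL f).add (hL g)).congr fun n => ?_
    exact (integral_add (hint n f) (hint n g)).symm
  · refine tendsto_nhds_unique (hL (c • f)) ?_
    refine ((hL f).const_mul c).congr fun n => ?_
    exact (integral_const_mul c _).symm
  · exact ge_of_tendsto' (hL f) fun n => integral_nonneg fun x => hf x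

variable [Countable V] [Countable E]

omit [Countable V] [Countable E] in
-- Indicators of cylinders are continuous with compact support, and their integrals against the
-- approximating measures are eventually constant. The Riesz measure of the limit functional
-- therefore has exactly the prescribed values on cylinders.
lemma exists_isCylinderConformal (hψ : IsAlmostHarmonic G F β ψ) :
    ∃ m : Measure (PathSpace G), m.Regular ∧ IsCylinderConformal F β m ∧ vertexVector m = ψ := by
  obtain ⟨Λ, hΛ⟩ := exists_limit_functional (m := approxMeasure G F β ψ)
    (fun n v => approxMeasure_vertex hψ n v) hψ.1
  have hval : ∀ μ : FinPath G,
      RealRMK.rieszMeasure Λ (cylinder μ) = pathFactor F β μ * ψ μ.range := by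
    intro μ
    have hfin : pathFactor F β μ * ψ μ.range ≠ ∞ :=
      ENNReal.mul_ne_top (pathFactor_ne_top F β μ) (hψ.1 _)
    let f : C_c(PathSpace G, ℝ) :=
      ⟨⟨(cylinder μ).indicator fun _ => 1, (isClopen_cylinder μ).continuous_indicator
        continuous_const⟩, HasCompactSupport.intro (isCompact_cylinder μ)
          fun _ hx => Set.indicator_of_notMem (f := fun _ => (1 : ℝ)) hx⟩
    have hf : ∀ m : Measure (PathSpace G), ∫ x, f x ∂m = m.real (cylinder μ) := fun m => by
      change ∫ x, (cylinder μ).indicator (fun _ => (1 : ℝ)) x ∂m = _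
      rw [integral_indicator (measurableSet_cylinder μ)]
      simp
    have h1 : RealRMK.rieszMeasure Λ (cylinder μ) < ∞ :=
      (isCompact_cylinder μ).measure_lt_top
    have h2 : Λ f = (pathFactor F β μ * ψ μ.range).toReal := by
      refine tendsto_nhds_unique (hΛ f) (tendsto_const_nhds.congr' ?_)
      have : ∀ᶠ n in (hyperfilter ℕ : Filter ℕ), μ.length ≤ n :=
        Nat.hyperfilter_le_atTop (eventually_ge_atTop _)
      filter_upwards [this] with n hn
      rw [hf, Measure.real, approxMeasure_cylinder hψ hn]
    have h3 := RealRMK.integral_rieszMeasure Λ f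
    rw [hf, h2, Measure.real, ENNReal.toReal_eq_toReal_iff' h1.ne hfin] at h3
    exact h3
  have hvert : ∀ v, RealRMK.rieszMeasure Λ (cylinder (FinPath.ofVertex G v)) = ψ v := fun v => by
    rw [hval, pathFactor_ofVertex, one_mul, FinPath.range_ofVertex]
  refine ⟨RealRMK.rieszMeasure Λ, inferInstance, ⟨fun μ => ?_, fun v => ?_⟩, funext hvert⟩
  · rw [hvert, hval]
  · rw [hvert]
    exact hψ.1 v

theorem bijOn_vertexVector (F : E → ℝ) (β : ℝ) :
    Set.BijOn (fun m : Measure (PathSpace G) => vertexVector m)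
      {m | IsKMSMeasure F β m} {ψ | IsAlmostHarmonic G F β ψ} := by
  refine ⟨fun m hm => hm.isCylinderConformal.isAlmostHarmonic, fun m hm m' hm' h =>
    hm.isCylinderConformal.ext hm'.isCylinderConformal h, fun ψ hψ => ?_⟩
  obtain ⟨m, h1, h2, h3⟩ := exists_isCylinderConformal hψ
  exact ⟨m, isKMSMeasure_iff.2 ⟨h1, h2⟩, h3⟩

/-! ### Linear combinations of conformal measures -/

omit [Countable V] [Countable E] in
lemma vertexVector_add_smul (m m' : Measure (PathSpace G)) (a b : ℝ≥0) :
    vertexVector (a • m + b • m') = a • vertexVector m + b • vertexVector m' := rfl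

lemma IsKMSMeasure.add_smul {m m' : Measure (PathSpace G)} (hm : IsKMSMeasure F β m)
    (hm' : IsKMSMeasure F β m') (a b : ℝ≥0) : IsKMSMeasure F β (a • m + b • m') := by
  have h := hm.isCylinderConformal
  have h' := hm'.isCylinderConformal
  have hne : ∀ v, (a • m + b • m') (cylinder (FinPath.ofVertex G v)) ≠ ∞ := fun v =>
    ENNReal.add_ne_top.2 ⟨ENNReal.mul_ne_top ENNReal.coe_ne_top (h.ne_top v),
      ENNReal.mul_ne_top ENNReal.coe_ne_top (h'.ne_top v)⟩
  refine isKMSMeasure_iff.2 ⟨?_, fun μ => ?_, hne⟩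
  · have := isFiniteMeasureOnCompacts_of_vertex hne
    -- Ω_G is locally compact, Hausdorff and second countable, hence metrizable, and there
    -- finiteness on compact sets implies regularity.
    let _ := TopologicalSpace.metrizableSpaceMetric (PathSpace G)
    infer_instance
  · change (a : ℝ≥0∞) * m _ + (b : ℝ≥0∞) * m' _ = _ * ((a : ℝ≥0∞) * m _ + (b : ℝ≥0∞) * m' _)
    rw [h.apply_cylinder, h'.apply_cylinder]
    ring

lemma isAffineBij_vertexVector (F : E → ℝ) (β : ℝ) :
    IsAffineBij (fun m : Measure (PathSpace G) => vertexVector m)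
      {m | IsKMSMeasure F β m ∧ m ≠ 0} {ψ | IsAlmostHarmonic G F β ψ ∧ ψ ≠ 0} := by
  have hb := bijOn_vertexVector (G := G) F β
  -- Countably many sets Z(v) cover Ω_G, so a zero vertex vector forces m = 0.
  have h0 : ∀ m : Measure (PathSpace G), IsKMSMeasure F β m → (vertexVector m = 0 ↔ m = 0) := by
    refine fun m hm => ⟨fun h => ?_, fun h => by rw [h]; rfl⟩
    rw [← Measure.measure_univ_eq_zero, ← iUnion_cylinder_ofVertex, measure_iUnion_null_iff]
    exact fun v => congrFun h v
  refine ⟨⟨fun m hm => ⟨hb.1 hm.1, fun h => hm.2 ((h0 m hm.1).1 h)⟩,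
    fun m hm m' hm' h => hb.2.1 hm.1 hm'.1 h, ?_⟩, ?_⟩
  · rintro ψ ⟨hψ, hne⟩
    obtain ⟨m, hm, rfl⟩ := hb.2.2 hψ
    exact ⟨m, ⟨hm, fun h => hne ((h0 m hm).2 h)⟩, rfl⟩
  · intro m hm m' hm' a b ha hb
    refine ⟨⟨hm.1.add_smul hm'.1 a b, fun h => hm.2 ?_⟩, vertexVector_add_smul m m' a b⟩
    rw [← Measure.measure_univ_eq_zero] at h ⊢
    have h' : (a : ℝ≥0∞) * m Set.univ + (b : ℝ≥0∞) * m' Set.univ = 0 := h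
    simpa [ha.ne'] using (add_eq_zero.1 h').1

end Existence

end GraphKMS

namespace GraphKMS

section Operators

variable {V E : Type*} {G : EGraph V E}

/-! ### Convolution operators -/

variable (G) in
/-- The bounded operators on `ℓ²(𝒢)`. -/
abbrev Op : Type _ := HilbertG G →L[ℂ] HilbertG G

open Classical in
/-- The standard basis vectors of `ℓ²(𝒢)`. -/
noncomputable def bv (γ : Gpd G) : HilbertG G := lp.single 2 γ (1 : ℂ)

open Classical in
lemma bv_apply (γ η : Gpd G) : bv γ η = if η = γ then 1 else 0 := by
  rw [bv, lp.single_apply, Pi.single_apply]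

@[simp] lemma bv_apply_self (γ : Gpd G) : bv γ γ = 1 := by simp [bv_apply]

lemma bv_apply_ne {γ η : Gpd G} (h : η ≠ γ) : bv γ η = 0 := by simp [bv_apply, h]

lemma norm_bv (γ : Gpd G) : ‖bv γ‖ = 1 := by
  classical
  rw [bv, lp.norm_single (by norm_num), norm_one]

lemma inner_bv_left (γ : Gpd G) (ξ : HilbertG G) : inner ℂ (bv γ) ξ = ξ γ := by
  classical
  rw [bv, lp.inner_single_left]
  simp

lemma inner_bv_right (γ : Gpd G) (ξ : HilbertG G) : inner ℂ ξ (bv γ) = star (ξ γ) := by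
  rw [← inner_conj_symm, inner_bv_left]
  rfl

lemma hasSum_bv (ξ : HilbertG G) : HasSum (fun γ => ξ γ • bv γ) ξ := by
  classical
  convert lp.hasSum_single (by norm_num) ξ using 2 with γ
  rw [bv, ← lp.single_smul, smul_eq_mul, mul_one]

/-- The coordinate functionals of `ℓ²(𝒢)`. -/
noncomputable def coord (γ : Gpd G) : HilbertG G →L[ℂ] ℂ := innerSL ℂ (bv γ)

lemma coord_apply (γ : Gpd G) (ξ : HilbertG G) : coord γ ξ = ξ γ := inner_bv_left γ ξ

lemma op_hasSum (T : Op G) (ξ : HilbertG G) (γ : Gpd G) :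
    HasSum (fun η => ξ η * T (bv η) γ) (T ξ γ) := by
  have := ((hasSum_bv ξ).mapL T).mapL (coord γ)
  simpa [coord_apply] using this

lemma op_ext {S T : Op G} (h : ∀ η γ, S (bv η) γ = T (bv η) γ) : S = T := by
  ext ξ γ
  refine (op_hasSum S ξ γ).unique ?_
  simpa only [h] using op_hasSum T ξ γ

open Classical in
/-- The matrix `f(γη⁻¹)` of the operator of convolution by `f`. -/
noncomputable def convKernel (f : Gpd G → ℂ) (γ η : Gpd G) : ℂ :=
  if h : η.src = γ.src then f (γ.mulInv η h) else 0

/-- A bounded operator is determined by its matrix entries, so the convolution formula need only be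
tested on basis vectors. -/
lemma isConvOp_iff {f : Gpd G → ℂ} {T : Op G} :
    IsConvOp f T ↔ ∀ η γ, T (bv η) γ = convKernel f γ η := by
  constructor
  · intro hT η γ
    refine (hT (bv η) γ).unique ?_
    by_cases h : η.src = γ.src
    · rw [convKernel, dif_pos h]
      have := hasSum_single (f := fun η' : {η' : Gpd G // η'.src = γ.src} =>
        f (γ.mulInv η'.1 η'.2) * bv η η'.1) ⟨η, h⟩ fun η' hne => by
          rw [bv_apply_ne fun e => hne (Subtype.ext e), mul_zero]
      simpa using this
    · rw [convKernel, dif_neg h]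
      convert hasSum_zero with η'
      rw [bv_apply_ne fun e => h (by rw [← e]; exact η'.2), mul_zero]
  · intro hT ξ γ
    have h1 := op_hasSum T ξ γ
    rw [← hasSum_subtype_iff_of_support_subset (s := {η : Gpd G | η.src = γ.src})] at h1
    · refine (congrArg (fun k => HasSum k _) (funext fun η => ?_)).mp h1
      simp only [Function.comp, hT, convKernel]
      rw [dif_pos (show η.1.src = γ.src from η.2), mul_comm]
    · intro η hη
      by_contra h
      refine hη ?_
      have h' : ¬ η.src = γ.src := h
      simp only [hT, convKernel, dif_neg h', mul_zero]

lemma IsConvOp.unique {f : Gpd G → ℂ} {S T : Op G} (hS : IsConvOp f S) (hT : IsConvOp f T) :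
    S = T :=
  op_ext fun η γ => by rw [isConvOp_iff.1 hS, isConvOp_iff.1 hT]

lemma IsConvOp.add {f g : Gpd G → ℂ} {S T : Op G} (hS : IsConvOp f S) (hT : IsConvOp g T) :
    IsConvOp (fun γ => f γ + g γ) (S + T) := by
  rw [isConvOp_iff] at *
  intro η γ
  rw [add_apply, lp.coeFn_add, Pi.add_apply, hS, hT]
  simp only [convKernel]
  split_ifs <;> simp

lemma IsConvOp.smul {f : Gpd G → ℂ} {T : Op G} (hT : IsConvOp f T) (c : ℂ) :
    IsConvOp (fun γ => c * f γ) (c • T) := by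
  rw [isConvOp_iff] at *
  intro η γ
  rw [smul_apply, lp.coeFn_smul, Pi.smul_apply, hT]
  simp only [convKernel]
  split_ifs <;> simp

lemma isConvOp_zero : IsConvOp (fun _ : Gpd G => 0) 0 := by
  rw [isConvOp_iff]
  intro η γ
  simp [convKernel]

lemma op_star_apply (T : Op G) (η γ : Gpd G) : (star T) (bv η) γ = star (T (bv γ) η) := by
  rw [← inner_bv_left, ContinuousLinearMap.star_eq_adjoint,
    ContinuousLinearMap.adjoint_inner_right, inner_bv_right]

lemma IsConvOp.star {f : Gpd G → ℂ} {T : Op G} (hT : IsConvOp f T) :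
    IsConvOp (fun γ => star (f γ.inv)) (star T) := by
  rw [isConvOp_iff] at *
  intro η γ
  rw [op_star_apply, hT]
  simp only [convKernel]
  by_cases h : η.src = γ.src
  · rw [dif_pos h, dif_pos h.symm]
    congr 2
    exact Gpd.ext rfl (by simp) rfl
  · rw [dif_neg h, dif_neg fun h' => h h'.symm, star_zero]

/-- The function on `𝒢` given by an operator. -/
noncomputable def coeff (T : Op G) (γ : Gpd G) : ℂ := T (bv (Gpd.unit γ.src)) γ

/-- The column of the kernel f(γη⁻¹) at the unit η of s(γ) is f itself. -/
lemma IsConvOp.coeff_eq {f : Gpd G → ℂ} {T : Op G} (hT : IsConvOp f T) : coeff T = f := by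
  ext γ
  rw [coeff, isConvOp_iff.1 hT, convKernel, dif_pos (Gpd.src_unit _)]
  congr 1
  exact Gpd.ext rfl (by simp) rfl

lemma norm_coeff_le (T : Op G) (γ : Gpd G) : ‖coeff T γ‖ ≤ ‖T‖ := by
  refine (lp.norm_apply_le_norm (by norm_num) _ _).trans ((T.le_opNorm _).trans ?_)
  rw [norm_bv, mul_one]

lemma coeff_add (S T : Op G) (γ : Gpd G) : coeff (S + T) γ = coeff S γ + coeff T γ := rfl

lemma coeff_sub (S T : Op G) (γ : Gpd G) : coeff (S - T) γ = coeff S γ - coeff T γ := rfl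

lemma coeff_smul (c : ℂ) (T : Op G) (γ : Gpd G) : coeff (c • T) γ = c * coeff T γ := rfl

/-! ### Existence of convolution operators -/

/-- Injectivity of σ means that every coordinate of ξ enters at most once, so the norm is bounded by
the supremum of the weights. Convolution by a function supported in a bisection has this form. -/
lemma exists_weighted_partial_op {ι : Type*} (D : Set ι) (σ : D → ι) (hσ : Function.Injective σ)
    (h : D → ℂ) {C : ℝ} (hC : 0 ≤ C) (hh : ∀ i, ‖h i‖ ≤ C) :
    ∃ T : lp (fun _ : ι => ℂ) 2 →L[ℂ] lp (fun _ : ι => ℂ) 2, ‖T‖ ≤ C ∧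
      (∀ ξ (i : D), T ξ i.1 = h i * ξ (σ i)) ∧ ∀ ξ, ∀ i ∉ D, T ξ i = 0 := by
  classical
  let f : lp (fun _ : ι => ℂ) 2 → ι → ℂ := fun ξ i =>
    if hi : i ∈ D then h ⟨i, hi⟩ * ξ (σ ⟨i, hi⟩) else 0
  have hsum : ∀ ξ (s : Finset ι),
      ∑ i ∈ s, ‖f ξ i‖ ^ (2 : ℝ≥0∞).toReal ≤ (C * ‖ξ‖) ^ (2 : ℝ≥0∞).toReal := by
    intro ξ s
    have h2 : (2 : ℝ≥0∞).toReal = 2 := by norm_num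
    have hle := lp.sum_rpow_le_norm_rpow (by norm_num) ξ
      ((s.subtype (· ∈ D)).image σ)
    rw [Finset.sum_image fun i _ j _ e => hσ e] at hle
    rw [h2] at hle ⊢
    simp only [Real.rpow_ofNat] at hle ⊢
    rw [mul_pow]
    refine le_trans ?_ (mul_le_mul_of_nonneg_left hle (sq_nonneg C))
    rw [Finset.mul_sum, ← Finset.sum_filter_add_sum_filter_not s (· ∈ D)]
    have hz : ∑ i ∈ s with i ∉ D, ‖f ξ i‖ ^ 2 = 0 := Finset.sum_eq_zero fun i hi => by
      simp [f, (Finset.mem_filter.1 hi).2]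
    rw [hz, add_zero, ← Finset.sum_subtype_eq_sum_filter]
    refine Finset.sum_le_sum fun i _ => ?_
    simp only [f]
    rw [dif_pos i.2, norm_mul, mul_pow]
    exact mul_le_mul_of_nonneg_right (pow_le_pow_left₀ (norm_nonneg _) (hh _) 2) (sq_nonneg _)
  have hmem : ∀ ξ, Memℓp (f ξ) 2 := fun ξ => memℓp_gen' (hsum ξ)
  let T : lp (fun _ : ι => ℂ) 2 →ₗ[ℂ] lp (fun _ : ι => ℂ) 2 :=
    { toFun := fun ξ => ⟨f ξ, hmem ξ⟩
      map_add' := fun ξ η => by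
        ext i
        change f (ξ + η) i = f ξ i + f η i
        simp only [f]
        split_ifs
        · rw [lp.coeFn_add, Pi.add_apply, mul_add]
        · simp
      map_smul' := fun c ξ => by
        ext i
        change f (c • ξ) i = c * f ξ i
        simp only [f]
        split_ifs
        · rw [lp.coeFn_smul, Pi.smul_apply, smul_eq_mul]; ring
        · simp }
  refine ⟨T.mkContinuous C fun ξ => ?_, LinearMap.mkContinuous_norm_le _ hC _, fun ξ i => ?_,
    fun ξ i hi => ?_⟩
  · exact lp.norm_le_of_forall_sum_le (by norm_num) (by positivity) (hsum ξ)
  · exact dif_pos i.2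
  · exact dif_neg hi

/-- Injectivity of the range on B leaves at most one term f(g)ξ(g⁻¹γ) in the convolution sum, the
one with r(g) = r(γ). Injectivity of the source makes γ ↦ g⁻¹γ injective, since s(g) is the range of
g⁻¹γ and determines g. -/
lemma exists_isConvOp_of_bisection {B : Set (Gpd G)} (hr : Set.InjOn Gpd.rng B)
    (hs : Set.InjOn Gpd.src B) {f : Gpd G → ℂ} (hf : ∀ γ ∉ B, f γ = 0) {C : ℝ} (hC : 0 ≤ C)
    (hfC : ∀ γ, ‖f γ‖ ≤ C) : ∃ T : Op G, IsConvOp f T ∧ ‖T‖ ≤ C := by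
  let D : Set (Gpd G) := {γ | ∃ g ∈ B, g.rng = γ.rng}
  choose g hgB hgr using fun γ : D => γ.2
  have hex : ∀ γ : D, ∃ δ : Gpd G, δ.rng = (g γ).src ∧ δ.lag = γ.1.lag - (g γ).lag ∧
      δ.src = γ.1.src := fun γ =>
    ⟨(g γ).inv.comp γ.1 (hgr γ), rfl, neg_add_eq_sub _ _, rfl⟩
  choose σ hσr hσl hσs using hex
  have hσ : Function.Injective σ := by
    intro γ γ' e
    have hg := hs (hgB γ) (hgB γ') (by rw [← hσr, ← hσr, e])
    have e3 := hσl γ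
    rw [e, hσl, hg] at e3
    exact Subtype.ext (Gpd.ext (by rw [← hgr γ, ← hgr γ', hg]) (by omega)
      (by rw [← hσs, ← hσs, e]))
  obtain ⟨T, hT, h1, h2⟩ := exists_weighted_partial_op D σ hσ (fun γ => f (g γ)) hC
    fun γ => hfC _
  refine ⟨T, isConvOp_iff.2 fun η γ => ?_, hT⟩
  by_cases hγ : γ ∈ D
  · have hT' := h1 (bv η) ⟨γ, hγ⟩
    rw [hT']
    have e1 := hgr ⟨γ, hγ⟩
    have e2 := hσr ⟨γ, hγ⟩
    have e3 := hσl ⟨γ, hγ⟩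
    have e4 := hσs ⟨γ, hγ⟩
    have hgB' := hgB ⟨γ, hγ⟩
    generalize g ⟨γ, hγ⟩ = k at *
    generalize σ ⟨γ, hγ⟩ = δ at *
    simp only at e1 e3 e4
    simp only [convKernel]
    by_cases hη : η = δ
    · subst hη
      have hg : γ.mulInv η e4 = k :=
        Gpd.ext e1.symm (by rw [Gpd.lag_mulInv, e3]; omega) e2
      rw [dif_pos e4, bv_apply_self, mul_one, hg]
    · rw [bv_apply_ne (Ne.symm hη), mul_zero]
      split_ifs with hsrc
      · symm
        refine hf _ fun hB => hη ?_
        have hgg : γ.mulInv η hsrc = k := hr hB hgB' e1.symm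
        have e5 : η.rng = k.src := congrArg Gpd.src hgg
        have e6 : (γ.mulInv η hsrc).lag = k.lag := congrArg Gpd.lag hgg
        rw [Gpd.lag_mulInv] at e6
        exact Gpd.ext (e5.trans e2.symm) (by rw [e3]; omega) (hsrc.trans e4.symm)
      · rfl
  · rw [h2 _ _ hγ, convKernel]
    split_ifs with hsrc
    · exact (hf (γ.mulInv η hsrc) fun hB => hγ ⟨_, hB, rfl⟩).symm
    · rfl

/-! ### The operators of the basic bisections -/

lemma exists_basicOp (μ ν : FinPath G) : ∃ T : Op G,
    IsConvOp ((basicBisection μ ν).indicator fun _ => (1 : ℂ)) T ∧ ‖T‖ ≤ 1 := by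
  classical
  refine exists_isConvOp_of_bisection (injOn_rng_basicBisection μ ν)
    (injOn_src_basicBisection μ ν) (fun γ h => Set.indicator_of_notMem h _) zero_le_one fun γ => ?_
  rw [Set.indicator_apply]
  split_ifs <;> simp

/-- The operator `S_μS_ν*`. -/
noncomputable def basicOp (μ ν : FinPath G) : Op G := (exists_basicOp μ ν).choose

lemma isConvOp_basicOp (μ ν : FinPath G) :
    IsConvOp ((basicBisection μ ν).indicator fun _ => (1 : ℂ)) (basicOp μ ν) :=
  (exists_basicOp μ ν).choose_spec.1

lemma basicOp_eq_zero {μ ν : FinPath G} (h : μ.range ≠ ν.range) : basicOp μ ν = 0 := by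
  refine (isConvOp_basicOp μ ν).unique ?_
  rw [basicBisection_eq_empty h]
  simpa using isConvOp_zero (G := G)

lemma Gpd.exists_translate {μ ν : FinPath G} {x : PathSpace G} (h : x.src = μ.range)
    (h' : x.src = ν.range) {γ : Gpd G} (hγ : γ.rng = concat μ x h) :
    ∃ δ : Gpd G, δ.rng = concat ν x h' ∧ δ.lag = γ.lag - μ.length + ν.length ∧ δ.src = γ.src :=
  ⟨(Gpd.mk' ν μ x h' h).comp γ (show concat μ x h = γ.rng from hγ.symm), rfl, by
    change (ν.length : ℤ) - μ.length + γ.lag = _; omega, rfl⟩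

/-- S_μS_ν* exchanges the initial segments μ and ν of the range and leaves the source alone. All
product formulas below are read off from this. -/
lemma basicOp_apply_of_eq {μ ν : FinPath G} {x : PathSpace G} (h : x.src = μ.range)
    (h' : x.src = ν.range) (ξ : HilbertG G) {γ δ : Gpd G} (hγ : γ.rng = concat μ x h)
    (h1 : δ.rng = concat ν x h') (h2 : δ.lag = γ.lag - μ.length + ν.length)
    (h3 : δ.src = γ.src) : basicOp μ ν ξ γ = ξ δ := by
  refine (isConvOp_basicOp μ ν ξ γ).unique ?_
  have := hasSum_single (f := fun η : {η : Gpd G // η.src = γ.src} =>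
    (basicBisection μ ν).indicator (fun _ => (1 : ℂ)) (γ.mulInv η.1 η.2) * ξ η.1)
    ⟨δ, h3⟩ fun η hne => by
      rw [Set.indicator_of_notMem, zero_mul]
      intro hB
      refine hne (Subtype.ext ?_)
      have hgg : γ.mulInv η.1 η.2 = Gpd.mk' μ ν x h h' :=
        injOn_rng_basicBisection μ ν hB (mk'_mem_basicBisection _ _ _ _ _) hγ
      have e1 : η.1.rng = concat ν x h' := congrArg Gpd.src hgg
      have e2 : (γ.mulInv η.1 η.2).lag = (Gpd.mk' μ ν x h h').lag := congrArg Gpd.lag hgg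
      rw [Gpd.lag_mulInv, Gpd.lag_mk'] at e2
      exact Gpd.ext (e1.trans h1.symm) (by rw [h2]; omega) (η.2.trans h3.symm)
  have hmem : γ.mulInv δ h3 ∈ basicBisection μ ν := by
    refine mem_basicBisection.2 ⟨x, h, h', Gpd.ext hγ ?_ h1⟩
    rw [Gpd.lag_mulInv, Gpd.lag_mk']; omega
  simpa only [Set.indicator_of_mem hmem, one_mul] using this

lemma basicOp_apply_of_notMem {μ ν : FinPath G} (ξ : HilbertG G) {γ : Gpd G}
    (hγ : γ.rng ∉ cylinder μ) : basicOp μ ν ξ γ = 0 := by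
  refine (isConvOp_basicOp μ ν ξ γ).unique ?_
  convert hasSum_zero with η
  rw [Set.indicator_of_notMem, zero_mul]
  intro hB
  obtain ⟨x, h, h', e⟩ := mem_basicBisection.1 hB
  have e1 : γ.rng = concat μ x h := congrArg Gpd.rng e
  exact hγ (e1 ▸ concat_mem_cylinder _ _ _)

open Classical in
lemma basicOp_self_apply (μ : FinPath G) (ξ : HilbertG G) (γ : Gpd G) :
    basicOp μ μ ξ γ = if γ.rng ∈ cylinder μ then ξ γ else 0 := by
  split_ifs with h
  · obtain ⟨x, hx, e⟩ := mem_cylinder_iff.1 h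
    exact basicOp_apply_of_eq hx hx ξ e e (by omega) rfl
  · exact basicOp_apply_of_notMem ξ h

@[simp] lemma star_basicOp (μ ν : FinPath G) : star (basicOp μ ν) = basicOp ν μ := by
  classical
  refine ((isConvOp_basicOp μ ν).star).unique ?_
  convert isConvOp_basicOp ν μ using 1
  ext γ
  have : γ.inv ∈ basicBisection μ ν ↔ γ ∈ basicBisection ν μ := by
    simp only [mem_basicBisection]
    constructor
    · rintro ⟨x, h, h', e⟩
      exact ⟨x, h', h, by rw [← γ.inv_inv, e, Gpd.inv_mk']⟩
    · rintro ⟨x, h, h', rfl⟩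
      exact ⟨x, h', h, Gpd.inv_mk' _ _ _ _ _⟩
  simp only [Set.indicator_apply, this]
  split_ifs <;> simp

lemma basicOp_mul_basicOp {μ ν κ : FinPath G} (h : μ.range = ν.range) (h' : ν.range = κ.range) :
    basicOp μ ν * basicOp ν κ = basicOp μ κ := by
  ext ξ γ
  rw [mul_apply_eq_comp]
  by_cases hγ : γ.rng ∈ cylinder μ
  · obtain ⟨x, hx, e⟩ := mem_cylinder_iff.1 hγ
    obtain ⟨δ, a1, a2, a3⟩ := Gpd.exists_translate hx (hx.trans h) e
    obtain ⟨ε, b1, b2, b3⟩ := Gpd.exists_translate (hx.trans h) ((hx.trans h).trans h') a1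
    rw [basicOp_apply_of_eq hx (hx.trans h) _ e a1 a2 a3,
      basicOp_apply_of_eq (hx.trans h) ((hx.trans h).trans h') _ a1 b1 b2 b3,
      basicOp_apply_of_eq hx ((hx.trans h).trans h') _ e b1 (by omega) (b3.trans a3)]
  · rw [basicOp_apply_of_notMem _ hγ, basicOp_apply_of_notMem _ hγ]

lemma basicOp_mul_diag {μ ν ρ : FinPath G} (h : ρ.src = μ.range) (h' : ρ.src = ν.range) :
    basicOp μ ν * basicOp (ν.append ρ h') (ν.append ρ h') =
      basicOp (μ.append ρ h) (ν.append ρ h') := by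
  classical
  ext ξ γ
  rw [mul_apply_eq_comp]
  by_cases hγ : γ.rng ∈ cylinder μ
  · obtain ⟨x, hx, e⟩ := mem_cylinder_iff.1 hγ
    have hx' : x.src = ν.range := hx.trans (h.symm.trans h')
    obtain ⟨δ, a1, a2, a3⟩ := Gpd.exists_translate hx hx' e
    rw [basicOp_apply_of_eq hx hx' _ e a1 a2 a3, basicOp_self_apply, a1]
    simp only [concat_mem_cylinder_append]
    split_ifs with hρ
    · obtain ⟨y, hy, rfl⟩ := mem_cylinder_iff.1 hρ
      refine (basicOp_apply_of_eq (hy.trans (μ.range_append ρ h).symm)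
        (hy.trans (ν.range_append ρ h').symm) ξ ?_ ?_ ?_ a3).symm
      · rw [concat_append μ ρ y h hy, e]
      · rw [concat_append ν ρ y h' hy, a1]
      · rw [a2, length_append, length_append]; push_cast; ring
    · rw [basicOp_apply_of_notMem]
      rw [e, concat_mem_cylinder_append]
      exact hρ
  · rw [basicOp_apply_of_notMem _ hγ, basicOp_apply_of_notMem _
      fun h => hγ (cylinder_append_subset _ _ _ h)]

lemma basicOp_diag_mul_diag_of_disjoint {μ ν : FinPath G}
    (h : Disjoint (cylinder μ) (cylinder ν)) : basicOp μ μ * basicOp ν ν = 0 := by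
  classical
  ext ξ γ
  rw [mul_apply_eq_comp, basicOp_self_apply, basicOp_self_apply]
  split_ifs with h1 h2
  · exact absurd h2 (Set.disjoint_left.1 h h1)
  · rfl
  · rfl

lemma basicOp_mul_basicOp_of_disjoint {μ ν κ τ : FinPath G}
    (h : Disjoint (cylinder ν) (cylinder κ)) : basicOp μ ν * basicOp κ τ = 0 := by
  by_cases h1 : μ.range = ν.range
  · by_cases h2 : κ.range = τ.range
    · rw [← basicOp_mul_basicOp h1 rfl, ← basicOp_mul_basicOp rfl h2, mul_assoc,
        ← mul_assoc (basicOp ν ν), basicOp_diag_mul_diag_of_disjoint h, zero_mul, mul_zero]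
    · rw [basicOp_eq_zero h2, mul_zero]
  · rw [basicOp_eq_zero h1, zero_mul]

variable (G) in
/-- The linear span of the operators `S_μS_ν*`. -/
noncomputable def coreSpan : Submodule ℂ (Op G) :=
  Submodule.span ℂ (Set.range fun p : FinPath G × FinPath G => basicOp p.1 p.2)

lemma basicOp_mem (μ ν : FinPath G) : basicOp μ ν ∈ coreSpan G :=
  Submodule.subset_span ⟨(μ, ν), rfl⟩

/-- The product vanishes if Z(ν) and Z(κ) are disjoint. Otherwise one of ν, κ extends the other, the
extension is absorbed into the other factor, and the product is again a single operator of this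
kind. -/
lemma basicOp_mul_mem (μ ν κ τ : FinPath G) : basicOp μ ν * basicOp κ τ ∈ coreSpan G := by
  by_cases h1 : μ.range = ν.range
  swap
  · rw [basicOp_eq_zero h1, zero_mul]; exact zero_mem _
  by_cases h2 : κ.range = τ.range
  swap
  · rw [basicOp_eq_zero h2, mul_zero]; exact zero_mem _
  by_cases hd : Disjoint (cylinder ν) (cylinder κ)
  · rw [basicOp_mul_basicOp_of_disjoint hd]; exact zero_mem _
  obtain ⟨x, hν, hκ⟩ := Set.not_disjoint_iff.1 hd
  rcases le_total ν.length κ.length with hl | hl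
  · obtain ⟨ρ, hρ, rfl⟩ := exists_append_of_mem_cylinder hν hκ hl
    have hρ' := hρ.trans h1.symm
    rw [← basicOp_mul_basicOp rfl h2, ← mul_assoc, basicOp_mul_diag hρ' hρ,
      basicOp_mul_basicOp ((FinPath.range_append _ _ _).trans (FinPath.range_append _ _ _).symm) h2]
    exact basicOp_mem _ _
  · obtain ⟨ρ, hρ, rfl⟩ := exists_append_of_mem_cylinder hκ hν hl
    have hρ' := hρ.trans h2
    -- When ν extends κ, the absorption takes place on the other side and is the adjoint of the
    -- previous rule.
    have hd := congrArg star (basicOp_mul_diag hρ' hρ)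
    rw [star_mul, star_basicOp, star_basicOp, star_basicOp] at hd
    rw [← basicOp_mul_basicOp h1 rfl, mul_assoc, hd,
      basicOp_mul_basicOp h1 ((FinPath.range_append _ _ _).trans (FinPath.range_append _ _ _).symm)]
    exact basicOp_mem _ _

lemma mul_mem_coreSpan {a b : Op G} (ha : a ∈ coreSpan G) (hb : b ∈ coreSpan G) :
    a * b ∈ coreSpan G := by
  induction ha using Submodule.span_induction with
  | mem a ha =>
    obtain ⟨p, rfl⟩ := ha
    induction hb using Submodule.span_induction with
    | mem b hb => obtain ⟨q, rfl⟩ := hb; exact basicOp_mul_mem _ _ _ _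
    | zero => rw [mul_zero]; exact zero_mem _
    | add x y _ _ hx hy => rw [mul_add]; exact add_mem hx hy
    | smul c x _ hx => rw [mul_smul_comm]; exact Submodule.smul_mem _ _ hx
  | zero => rw [zero_mul]; exact zero_mem _
  | add x y _ _ hx hy => rw [add_mul]; exact add_mem hx hy
  | smul c x _ hx => rw [smul_mul_assoc]; exact Submodule.smul_mem _ _ hx

lemma star_mem_coreSpan {a : Op G} (ha : a ∈ coreSpan G) : star a ∈ coreSpan G := by
  induction ha using Submodule.span_induction with
  | mem a ha => obtain ⟨p, rfl⟩ := ha; rw [star_basicOp]; exact basicOp_mem _ _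
  | zero => rw [star_zero]; exact zero_mem _
  | add x y _ _ hx hy => rw [star_add]; exact add_mem hx hy
  | smul c x _ hx => rw [star_smul]; exact Submodule.smul_mem _ _ hx

variable (G) in
/-- The linear span of the operators `S_μS_ν*`, as a `*`-algebra. -/
noncomputable def coreAlg : NonUnitalStarSubalgebra ℂ (Op G) :=
  { coreSpan G with
    mul_mem' := mul_mem_coreSpan
    star_mem' := star_mem_coreSpan }

end Operators

end GraphKMS

namespace GraphKMS

section Density

open Filter

variable {V E : Type*} {G : EGraph V E}

/-! ### Density of the span of the operators `S_μS_ν*` -/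

lemma mkOn_injective (μ ν : FinPath G) (h : μ.range = ν.range) :
    Function.Injective (Gpd.mkOn μ ν h) := fun _ _ e =>
  Subtype.ext (concat_injective μ _ _ (congrArg Gpd.rng e))

/-- The characteristic function of `Z(κ)` on the compact space `Z(v)`. -/
noncomputable def cylInd (v : V) (κ : FinPath G) : C(cylinder (FinPath.ofVertex G v), ℂ) :=
  ⟨fun x => (cylinder κ).indicator (fun _ => 1) x.1,
    ((isClopen_cylinder κ).continuous_indicator continuous_const).comp continuous_subtype_val⟩

open Classical in
lemma cylInd_apply (v : V) (κ : FinPath G) (x : cylinder (FinPath.ofVertex G v)) :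
    cylInd v κ x = if x.1 ∈ cylinder κ then 1 else 0 :=
  Set.indicator_apply (cylinder κ) (fun _ => (1 : ℂ)) x.1

variable (G) in
/-- The span of the functions `1_{Z(κ)}` on `Z(v)`. -/
noncomputable def cylSpan (v : V) : Submodule ℂ C(cylinder (FinPath.ofVertex G v), ℂ) :=
  Submodule.span ℂ (Set.range (cylInd v))

lemma cylInd_mem (v : V) (κ : FinPath G) : cylInd v κ ∈ cylSpan G v :=
  Submodule.subset_span ⟨κ, rfl⟩

lemma one_mem_cylSpan (v : V) : (1 : C(cylinder (FinPath.ofVertex G v), ℂ)) ∈ cylSpan G v := by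
  classical
  convert cylInd_mem v (FinPath.ofVertex G v)
  ext x
  rw [cylInd_apply, if_pos x.2]
  rfl

lemma cylInd_mul_mem (v : V) (κ τ : FinPath G) : cylInd v κ * cylInd v τ ∈ cylSpan G v := by
  classical
  by_cases hd : (cylinder κ ∩ cylinder τ).Nonempty
  · obtain ⟨ρ, hρ⟩ := isPiSystem_cylinder _ ⟨κ, rfl⟩ _ ⟨τ, rfl⟩ hd
    convert cylInd_mem v ρ
    ext x
    rw [ContinuousMap.mul_apply, cylInd_apply, cylInd_apply, cylInd_apply, hρ]
    simp only [Set.mem_inter_iff]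
    split_ifs <;> simp_all
  · convert zero_mem (cylSpan G v)
    ext x
    rw [ContinuousMap.mul_apply, cylInd_apply, cylInd_apply]
    have : ¬ (x.1 ∈ cylinder κ ∧ x.1 ∈ cylinder τ) := fun h => hd ⟨x.1, h⟩
    split_ifs <;> simp_all

lemma mul_mem_cylSpan {v : V} {a b : C(cylinder (FinPath.ofVertex G v), ℂ)}
    (ha : a ∈ cylSpan G v) (hb : b ∈ cylSpan G v) : a * b ∈ cylSpan G v := by
  induction ha using Submodule.span_induction with
  | mem a ha =>
    obtain ⟨p, rfl⟩ := ha
    induction hb using Submodule.span_induction with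
    | mem b hb => obtain ⟨q, rfl⟩ := hb; exact cylInd_mul_mem _ _ _
    | zero => rw [mul_zero]; exact zero_mem _
    | add x y _ _ hx hy => rw [mul_add]; exact add_mem hx hy
    | smul c x _ hx => rw [mul_smul_comm]; exact Submodule.smul_mem _ _ hx
  | zero => rw [zero_mul]; exact zero_mem _
  | add x y _ _ hx hy => rw [add_mul]; exact add_mem hx hy
  | smul c x _ hx => rw [smul_mul_assoc]; exact Submodule.smul_mem _ _ hx

lemma star_mem_cylSpan {v : V} {a : C(cylinder (FinPath.ofVertex G v), ℂ)}
    (ha : a ∈ cylSpan G v) : star a ∈ cylSpan G v := by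
  classical
  induction ha using Submodule.span_induction with
  | mem a ha =>
    obtain ⟨p, rfl⟩ := ha
    convert cylInd_mem v p
    ext x
    rw [ContinuousMap.star_apply, cylInd_apply]
    split_ifs <;> simp
  | zero => rw [star_zero]; exact zero_mem _
  | add x y _ _ hx hy => rw [star_add]; exact add_mem hx hy
  | smul c x _ hx => rw [star_smul]; exact Submodule.smul_mem _ _ hx

/-- Stone–Weierstrass on the compact space Z(v): a product of two cylinder indicators is zero or
another one, so their span is a unital *-algebra, and it separates points. -/
lemma exists_cylSpan_near (v : V) (f : C(cylinder (FinPath.ofVertex G v), ℂ)) {ε : ℝ}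
    (hε : 0 < ε) : ∃ g ∈ cylSpan G v, ‖f - g‖ < ε := by
  classical
  let A : StarSubalgebra ℂ C(cylinder (FinPath.ofVertex G v), ℂ) :=
    { cylSpan G v with
      mul_mem' := mul_mem_cylSpan
      one_mem' := one_mem_cylSpan v
      algebraMap_mem' := fun c => by
        rw [Algebra.algebraMap_eq_smul_one]
        exact Submodule.smul_mem _ _ (one_mem_cylSpan v)
      star_mem' := star_mem_cylSpan }
  have hA : A.topologicalClosure = ⊤ := by
    refine ContinuousMap.starSubalgebra_topologicalClosure_eq_top_of_separatesPoints A ?_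
    intro x y hxy
    have : ∃ μ, ¬ (x.1 ∈ cylinder μ ↔ y.1 ∈ cylinder μ) := by
      by_contra! h
      exact hxy (Subtype.ext (PathSpace.eq_of_cylinder h))
    obtain ⟨μ, hμ⟩ := this
    refine ⟨cylInd v μ, ⟨cylInd v μ, cylInd_mem v μ, rfl⟩, ?_⟩
    simp only [cylInd_apply]
    split_ifs <;> simp_all
  have hf : f ∈ closure (A : Set C(cylinder (FinPath.ofVertex G v), ℂ)) := by
    have : f ∈ A.topologicalClosure := by rw [hA]; trivial
    exact this
  obtain ⟨g, hg, hfg⟩ := Metric.mem_closure_iff.1 hf ε hε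
  exact ⟨g, hg, by rwa [← dist_eq_norm]⟩

lemma extend_cylInd (μ ν : FinPath G) (h : μ.range = ν.range) (κ : FinPath G)
    (hκ : κ.src = μ.range) :
    Function.extend (Gpd.mkOn μ ν h) (cylInd μ.range κ) 0 =
      (basicBisection (μ.append κ hκ) (ν.append κ (hκ.trans h))).indicator fun _ => (1 : ℂ) := by
  classical
  ext γ
  by_cases hγ : γ ∈ basicBisection μ ν
  · rw [← range_mkOn μ ν h] at hγ
    obtain ⟨x, rfl⟩ := hγ
    rw [(mkOn_injective μ ν h).extend_apply, cylInd_apply, Set.indicator_apply]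
    congr 1
    rw [eq_iff_iff, mem_basicBisection]
    constructor
    · intro hx
      obtain ⟨x, hx'⟩ := x
      obtain ⟨y, hy, rfl⟩ := mem_cylinder_iff.1 (show x ∈ cylinder κ from hx)
      exact ⟨y, _, _, (Gpd.mk'_append μ ν κ y hκ (hκ.trans h) hy).symm⟩
    · rintro ⟨y, k, k', e⟩
      have e1 : concat μ x.1 (mem_cylinder_ofVertex.1 x.2) = concat (μ.append κ hκ) y k :=
        congrArg Gpd.rng e
      have := concat_mem_cylinder (μ.append κ hκ) y k
      rw [← e1, concat_mem_cylinder_append] at this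
      exact this
  · rw [Function.extend_apply', Set.indicator_of_notMem]
    · rfl
    · intro hγ'
      refine hγ ?_
      obtain ⟨y, k, k', rfl⟩ := mem_basicBisection.1 hγ'
      rw [Gpd.mk'_append μ ν κ y hκ (hκ.trans h) (k.trans (μ.range_append κ hκ))]
      exact mk'_mem_basicBisection _ _ _ _ _
    · rintro ⟨x, rfl⟩
      exact hγ (by rw [← range_mkOn μ ν h]; exact ⟨x, rfl⟩)

lemma exists_core_of_cylSpan (μ ν : FinPath G) (h : μ.range = ν.range)
    {g : C(cylinder (FinPath.ofVertex G μ.range), ℂ)} (hg : g ∈ cylSpan G μ.range) :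
    ∃ T ∈ coreSpan G, IsConvOp (Function.extend (Gpd.mkOn μ ν h) g 0) T := by
  classical
  have hinj := mkOn_injective μ ν h
  induction hg using Submodule.span_induction with
  | mem a ha =>
    obtain ⟨κ, rfl⟩ := ha
    by_cases hκ : κ.src = μ.range
    · rw [extend_cylInd μ ν h κ hκ]
      exact ⟨_, basicOp_mem _ _, isConvOp_basicOp _ _⟩
    · refine ⟨0, zero_mem _, ?_⟩
      convert isConvOp_zero (G := G) using 1
      ext γ
      by_cases hγ : ∃ x, Gpd.mkOn μ ν h x = γ
      · obtain ⟨x, rfl⟩ := hγ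
        rw [hinj.extend_apply, cylInd_apply, if_neg]
        exact fun hx => hκ (hx.1.symm.trans (mem_cylinder_ofVertex.1 x.2))
      · rw [Function.extend_apply' _ _ _ hγ]; rfl
  | zero =>
    refine ⟨0, zero_mem _, ?_⟩
    convert isConvOp_zero (G := G) using 1
    ext γ
    by_cases hγ : ∃ x, Gpd.mkOn μ ν h x = γ
    · obtain ⟨x, rfl⟩ := hγ
      rw [hinj.extend_apply]; rfl
    · rw [Function.extend_apply' _ _ _ hγ]; rfl
  | add x y _ _ hx hy =>
    obtain ⟨S, hS, hS'⟩ := hx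
    obtain ⟨T, hT, hT'⟩ := hy
    refine ⟨S + T, add_mem hS hT, ?_⟩
    convert hS'.add hT' using 1
    ext γ
    by_cases hγ : ∃ x, Gpd.mkOn μ ν h x = γ
    · obtain ⟨z, rfl⟩ := hγ
      simp only [hinj.extend_apply]; rfl
    · simp only [Function.extend_apply' _ _ _ hγ]; simp
  | smul c x _ hx =>
    obtain ⟨S, hS, hS'⟩ := hx
    refine ⟨c • S, Submodule.smul_mem _ _ hS, ?_⟩
    convert hS'.smul c using 1
    ext γ
    by_cases hγ : ∃ x, Gpd.mkOn μ ν h x = γ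
    · obtain ⟨z, rfl⟩ := hγ
      simp only [hinj.extend_apply]; rfl
    · simp only [Function.extend_apply' _ _ _ hγ]; simp

/-- Convolution by continuous functions supported in a basic bisection. -/
lemma exists_isConvOp_of_support {μ ν : FinPath G} {f : Gpd G → ℂ} (hf : Continuous f)
    (hs : ∀ γ ∉ basicBisection μ ν, f γ = 0) :
    ∃ T ∈ (coreSpan G).topologicalClosure, IsConvOp f T := by
  classical
  by_cases h : μ.range = ν.range
  swap
  · refine ⟨0, zero_mem _, ?_⟩
    convert isConvOp_zero (G := G) using 1
    ext γ
    exact hs γ (by rw [basicBisection_eq_empty h]; simp)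
  let f' : C(cylinder (FinPath.ofVertex G μ.range), ℂ) :=
    ⟨fun x => f (Gpd.mkOn μ ν h x), hf.comp (continuous_mkOn μ ν h)⟩
  -- On a single bisection the operator norm is at most the sup norm, so uniform approximation of f
  -- becomes approximation in norm of the operator.
  have key : ∀ ε > 0, ∃ T ∈ coreSpan G, ∃ S : Op G, IsConvOp f (T + S) ∧ ‖S‖ ≤ ε := by
    intro ε hε
    obtain ⟨g, hg, hfg⟩ := exists_cylSpan_near μ.range f' hε
    obtain ⟨T, hT, hT'⟩ := exists_core_of_cylSpan μ ν h hg
    obtain ⟨S, hS, hS'⟩ := exists_isConvOp_of_bisection (injOn_rng_basicBisection μ ν)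
      (injOn_src_basicBisection μ ν)
      (f := fun γ => f γ - Function.extend (Gpd.mkOn μ ν h) g 0 γ) (fun γ hγ => by
        rw [hs γ hγ, Function.extend_apply' _ _ _ fun hx => hγ (by
          rw [← range_mkOn μ ν h]; exact hx)]
        simp) hε.le (fun γ => by
        by_cases hγ : γ ∈ basicBisection μ ν
        · rw [← range_mkOn μ ν h] at hγ
          obtain ⟨x, rfl⟩ := hγ
          rw [(mkOn_injective μ ν h).extend_apply]
          exact ((f' - g).norm_coe_le_norm x).trans hfg.le
        · rw [hs γ hγ, Function.extend_apply' _ _ _ fun hx => hγ (by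
            rw [← range_mkOn μ ν h]; exact hx)]
          simpa using hε.le)
    refine ⟨T, hT, S, ?_, hS'⟩
    convert hT'.add hS using 1
    ext γ
    ring
  -- Any one decomposition gives the operator. The others represent the same function, hence the
  -- same operator, with ever smaller remainders.
  obtain ⟨T₀, -, S₀, h₀, -⟩ := key 1 one_pos
  refine ⟨T₀ + S₀, ?_, h₀⟩
  change T₀ + S₀ ∈ closure (coreSpan G : Set (Op G))
  rw [Metric.mem_closure_iff]
  intro ε hε
  obtain ⟨T, hT, S, hTS, hS⟩ := key (ε / 2) (half_pos hε)
  refine ⟨T, hT, ?_⟩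
  rw [h₀.unique hTS, dist_eq_norm, add_sub_cancel_left]
  linarith

/-- Finitely many basic bisections cover the support, and since they are clopen f splits into
continuous pieces, each supported in one of them. -/
lemma exists_isConvOp {f : Gpd G → ℂ} (hf : IsCc G f) :
    ∃ T ∈ (coreSpan G).topologicalClosure, IsConvOp f T := by
  classical
  obtain ⟨t, ht⟩ := hf.2.isCompact.elim_finite_subcover
    (fun p : FinPath G × FinPath G => basicBisection p.1 p.2)
    (fun p => isOpen_basicBisection _ _) (by rw [iUnion_basicBisection]; exact Set.subset_univ _)
  have key : ∀ (t : Finset (FinPath G × FinPath G)) (f : Gpd G → ℂ), Continuous f →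
      (∀ γ, (∀ p ∈ t, γ ∉ basicBisection p.1 p.2) → f γ = 0) →
      ∃ T ∈ (coreSpan G).topologicalClosure, IsConvOp f T := by
    intro t
    induction t using Finset.induction_on with
    | empty =>
      intro f hf h
      refine ⟨0, zero_mem _, ?_⟩
      convert isConvOp_zero (G := G) using 1
      ext γ
      exact h γ (by simp)
    | insert p t _ ih =>
      intro f hf h
      have hB := isClopen_basicBisection p.1 p.2
      obtain ⟨S, hS, hS'⟩ := exists_isConvOp_of_support (f := (basicBisection p.1 p.2).indicator f)
        (hB.continuous_indicator hf) fun γ hγ => Set.indicator_of_notMem hγ _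
      obtain ⟨T, hT, hT'⟩ := ih ((basicBisection p.1 p.2)ᶜ.indicator f)
        (hB.compl.continuous_indicator hf) fun γ hγ => by
          by_cases hp : γ ∈ basicBisection p.1 p.2
          · exact Set.indicator_of_notMem (fun h' : γ ∈ (basicBisection p.1 p.2)ᶜ => h' hp) _
          · rw [Set.indicator_of_mem (show γ ∈ (basicBisection p.1 p.2)ᶜ from hp)]
            refine h γ fun q hq => ?_
            rcases Finset.mem_insert.1 hq with rfl | hq
            · exact hp
            · exact hγ q hq
      refine ⟨S + T, add_mem hS hT, ?_⟩
      convert hS'.add hT' using 1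
      ext γ
      exact (Set.indicator_self_add_compl_apply _ _ _).symm
  refine key t f hf.1 fun γ hγ => image_eq_zero_of_notMem_tsupport fun h => ?_
  obtain ⟨p, hp, hγp⟩ := Set.mem_iUnion₂.1 (ht h)
  exact hγ p hp hγp

lemma isCc_indicator_basicBisection (μ ν : FinPath G) :
    IsCc G ((basicBisection μ ν).indicator fun _ => (1 : ℂ)) :=
  ⟨(isClopen_basicBisection μ ν).continuous_indicator continuous_const,
    HasCompactSupport.intro (isCompact_basicBisection μ ν) fun _ h => Set.indicator_of_notMem h _⟩

/-- The closed span of the S_μS_ν* is a *-algebra containing convolution by every f ∈ C_c(𝒢).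
Conversely, the indicator of a basic bisection is in C_c(𝒢). -/
lemma mem_cstarSub_iff {T : Op G} : T ∈ cstarSub G ↔ T ∈ closure (coreSpan G : Set (Op G)) := by
  constructor
  · intro hT
    have h1 : NonUnitalStarAlgebra.adjoin ℂ (convOps G) ≤ (coreAlg G).topologicalClosure := by
      refine NonUnitalStarAlgebra.adjoin_le ?_
      rintro S ⟨f, hf, hS⟩
      obtain ⟨S', hS', hfS'⟩ := exists_isConvOp hf
      rw [hS.unique hfS']
      exact hS'
    exact closure_minimal h1 isClosed_closure hT
  · intro hT
    have h1 : coreSpan G ≤ (NonUnitalStarAlgebra.adjoin ℂ (convOps G)).toSubmodule := by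
      refine Submodule.span_le.2 ?_
      rintro _ ⟨p, rfl⟩
      exact NonUnitalStarAlgebra.subset_adjoin ℂ _
        ⟨_, isCc_indicator_basicBisection _ _, isConvOp_basicOp _ _⟩
    exact closure_mono h1 hT

lemma basicOp_mem_cstarSub (μ ν : FinPath G) : basicOp μ ν ∈ cstarSub G :=
  mem_cstarSub_iff.2 (subset_closure (basicOp_mem μ ν))

lemma exists_isConvOp_cstar {f : Gpd G → ℂ} (hf : IsCc G f) :
    ∃ T : CStarG G, IsConvOp f T.1 := by
  obtain ⟨T, hT, h⟩ := exists_isConvOp hf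
  exact ⟨⟨T, mem_cstarSub_iff.2 hT⟩, h⟩

/-- Closed linear properties of operators in C*(G) need only be checked on the generators S_μS_ν*.
-/
lemma cstar_induction {P : Op G → Prop} (hb : ∀ μ ν, P (basicOp μ ν))
    (hadd : ∀ S T, P S → P T → P (S + T)) (hsmul : ∀ (c : ℂ) T, P T → P (c • T)) (h0 : P 0)
    (hc : IsClosed {T | P T}) {T : Op G} (hT : T ∈ cstarSub G) : P T := by
  refine closure_minimal (fun S hS => ?_) hc (mem_cstarSub_iff.1 hT)
  change P S
  induction (show S ∈ coreSpan G from hS) using Submodule.span_induction with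
  | mem a ha => obtain ⟨p, rfl⟩ := ha; exact hb _ _
  | zero => exact h0
  | add x y hx hy hx' hy' => exact hadd _ _ (hx' hx) (hy' hy)
  | smul c x hx hx' => exact hsmul _ _ (hx' hx)

lemma continuous_op_apply (ξ : HilbertG G) (γ : Gpd G) : Continuous fun T : Op G => T ξ γ := by
  have : Continuous fun T : Op G => coord γ (T ξ) := by fun_prop
  simpa only [coord_apply] using this

/-- Every element of `C*(G)` is a convolution operator. -/
lemma isConvOp_coeff {T : Op G} (hT : T ∈ cstarSub G) : IsConvOp (coeff T) T := by
  refine cstar_induction (P := fun T => IsConvOp (coeff T) T) ?_ ?_ ?_ ?_ ?_ hT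
  · intro μ ν
    rw [(isConvOp_basicOp μ ν).coeff_eq]
    exact isConvOp_basicOp μ ν
  · exact fun S T hS hT => hS.add hT
  · exact fun c T hT => hT.smul c
  · exact isConvOp_zero (G := G)
  · simp only [isConvOp_iff, Set.ofPred_forall]
    refine isClosed_iInter fun η => isClosed_iInter fun γ => ?_
    refine isClosed_eq (continuous_op_apply _ _) ?_
    unfold convKernel
    split_ifs with h
    · exact continuous_op_apply _ _
    · exact continuous_const

/-- By `norm_coeff_le` norm convergence of operators is uniform convergence of coefficients, and
uniform limits of continuous functions are continuous. -/
lemma continuous_coeff {T : Op G} (hT : T ∈ cstarSub G) : Continuous (coeff T) := by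
  refine cstar_induction (P := fun T => Continuous (coeff T)) ?_ ?_ ?_ ?_ ?_ hT
  · intro μ ν
    rw [(isConvOp_basicOp μ ν).coeff_eq]
    exact (isCc_indicator_basicBisection μ ν).1
  · exact fun S T hS hT => hS.add hT
  · exact fun c T hT => continuous_const.mul hT
  · exact continuous_const
  · refine IsSeqClosed.isClosed fun Tn T hTn hT => ?_
    refine TendstoUniformly.continuous (F := fun n => coeff (Tn n)) (p := atTop) ?_
      (Frequently.of_forall hTn)
    rw [Metric.tendstoUniformly_iff]
    intro ε hε
    filter_upwards [Metric.tendsto_nhds.1 hT ε hε] with n hn γ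
    rw [dist_eq_norm, ← coeff_sub]
    refine (norm_coeff_le _ _).trans_lt ?_
    rwa [← dist_eq_norm, dist_comm]

lemma coeff_star {T : Op G} (hT : T ∈ cstarSub G) (γ : Gpd G) :
    coeff (star T) γ = star (coeff T γ.inv) := by
  rw [((isConvOp_coeff hT).star).coeff_eq]

open Classical in
lemma cstar_apply_unit {T : Op G} (hT : T ∈ cstarSub G) (x : PathSpace G) (γ : Gpd G) :
    T (bv (Gpd.unit x)) γ = if γ.src = x then coeff T γ else 0 := by
  split_ifs with h
  · rw [coeff, h]
  · rw [isConvOp_iff.1 (isConvOp_coeff hT), convKernel, dif_neg fun e => h e.symm]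

/-! ### The projections of the vertices -/

/-- The projection `P_v`. -/
noncomputable def vertexProj (v : V) : Op G :=
  basicOp (FinPath.ofVertex G v) (FinPath.ofVertex G v)

variable (G) in
/-- The projection `∑_{v ∈ X} P_v`. -/
noncomputable def finProj (X : Finset V) : Op G := ∑ v ∈ X, vertexProj v

open Classical in
lemma vertexProj_apply (v : V) (ξ : HilbertG G) (γ : Gpd G) :
    vertexProj v ξ γ = if γ.rng.src = v then ξ γ else 0 := by
  rw [vertexProj, basicOp_self_apply]
  simp only [mem_cylinder_ofVertex]

open Classical in
lemma finProj_apply (X : Finset V) (ξ : HilbertG G) (γ : Gpd G) :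
    finProj G X ξ γ = if γ.rng.src ∈ X then ξ γ else 0 := by
  have : finProj G X ξ γ = ∑ v ∈ X, vertexProj v ξ γ := by
    rw [← coord_apply, finProj, sum_apply, map_sum]
    simp only [coord_apply]
  rw [this]
  simp only [vertexProj_apply]
  rw [Finset.sum_ite_eq]

lemma star_vertexProj (v : V) : star (vertexProj v : Op G) = vertexProj v := star_basicOp _ _

lemma star_finProj (X : Finset V) : star (finProj G X) = finProj G X := by
  rw [finProj, star_sum]
  simp only [star_vertexProj]

lemma finProj_mul_self (X : Finset V) : finProj G X * finProj G X = finProj G X := by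
  classical
  ext ξ γ
  rw [mul_apply_eq_comp, finProj_apply, finProj_apply]
  split_ifs <;> rfl

lemma finProj_mem (X : Finset V) : finProj G X ∈ cstarSub G :=
  sum_mem fun _ _ => basicOp_mem_cstarSub _ _

lemma norm_finProj_le (X : Finset V) : ‖finProj G X‖ ≤ 1 := by
  have h := CStarRing.norm_star_mul_self (x := finProj G X)
  rw [star_finProj, finProj_mul_self] at h
  by_contra! h'
  nlinarith

lemma finProj_mul_basicOp {X : Finset V} {μ : FinPath G} (h : μ.src ∈ X) (ν : FinPath G) :
    finProj G X * basicOp μ ν = basicOp μ ν := by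
  classical
  ext ξ γ
  rw [mul_apply_eq_comp, finProj_apply]
  split_ifs with hγ
  · rfl
  · rw [basicOp_apply_of_notMem]
    exact fun hx => hγ (hx.1 ▸ h)

/-- The contractions P_X form an approximate unit: P_X fixes S_μS_ν* as soon as s(μ) ∈ X, and a
three-term estimate passes to the closure. -/
lemma tendsto_finProj_mul {T : Op G} (hT : T ∈ cstarSub G) :
    Tendsto (fun X => finProj G X * T) atTop (𝓝 T) := by
  classical
  refine cstar_induction (P := fun T => Tendsto (fun X => finProj G X * T) atTop (𝓝 T))
    ?_ ?_ ?_ ?_ ?_ hT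
  · intro μ ν
    refine tendsto_const_nhds.congr' ?_
    filter_upwards [eventually_ge_atTop {μ.src}] with X hX
    exact (finProj_mul_basicOp (Finset.singleton_subset_iff.1 hX) ν).symm
  · intro S T hS hT
    simpa only [mul_add] using hS.add hT
  · intro c T hT
    simpa only [mul_smul_comm] using hT.const_smul c
  · simp
  · refine IsSeqClosed.isClosed fun Tn T hTn hT => ?_
    rw [Set.mem_ofPred_eq, Metric.tendsto_nhds]
    intro ε hε
    obtain ⟨n, hn⟩ := (Metric.tendsto_nhds.1 hT (ε / 3) (by positivity)).exists
    filter_upwards [Metric.tendsto_nhds.1 (hTn n) (ε / 3) (by positivity)] with X hX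
    have h1 : dist (finProj G X * T) (finProj G X * Tn n) ≤ dist (Tn n) T := by
      rw [dist_eq_norm, ← mul_sub, dist_comm, dist_eq_norm]
      exact (norm_mul_le _ _).trans (mul_le_of_le_one_left (norm_nonneg _) (norm_finProj_le X))
    calc dist (finProj G X * T) T
        ≤ dist (finProj G X * T) (finProj G X * Tn n) + dist (finProj G X * Tn n) (Tn n) +
          dist (Tn n) T := dist_triangle4 _ _ _ _
      _ < ε := by linarith

lemma tendsto_mul_finProj {T : Op G} (hT : T ∈ cstarSub G) :
    Tendsto (fun X => T * finProj G X) atTop (𝓝 T) := by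
  have := (tendsto_finProj_mul (star_mem hT)).star
  simpa only [star_mul, star_star, star_finProj] using this

lemma tendsto_finProj_conj {T : Op G} (hT : T ∈ cstarSub G) :
    Tendsto (fun X => finProj G X * T * finProj G X) atTop (𝓝 T) := by
  have h1 := tendsto_mul_finProj hT
  have h2 : Tendsto (fun X => finProj G X * (T - T * finProj G X)) atTop (𝓝 0) := by
    refine squeeze_zero_norm (a := fun X => ‖T - T * finProj G X‖) (fun X => ?_) ?_
    · exact (norm_mul_le _ _).trans (mul_le_of_le_one_left (norm_nonneg _) (norm_finProj_le X))
    · have := (tendsto_const_nhds (x := T)).sub h1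
      simpa using this.norm
  have := (tendsto_finProj_mul hT).sub h2
  simp only [sub_zero] at this
  refine this.congr fun X => ?_
  rw [mul_sub, mul_assoc]
  abel

end Density

end GraphKMS

namespace GraphKMS

section AbstractWeights

open Filter

variable {A : Type*} [NonUnitalCStarAlgebra A]

attribute [local instance] CStarAlgebra.spectralOrder CStarAlgebra.spectralOrderedRing

/-! ### Weights as monotone maps and their linear extensions -/

/-- A positive element in the sense of the spectral order, as an element of the cone. -/
def posOf (a : A) (h : 0 ≤ a) : PosCone A :=
  ⟨a, CStarAlgebra.nonneg_iff_eq_star_mul_self.1 h⟩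

lemma PosCone.nonneg (a : PosCone A) : 0 ≤ (a : A) :=
  CStarAlgebra.nonneg_iff_eq_star_mul_self.2 a.2

lemma PosCone.isSelfAdjoint (a : PosCone A) : IsSelfAdjoint (a : A) :=
  IsSelfAdjoint.of_nonneg a.nonneg

@[simp] lemma coe_posOf (a : A) (h : 0 ≤ a) : (posOf a h : A) = a := rfl

@[simp] lemma coe_starMulSelf (a : A) : (starMulSelf a : A) = star a * a := rfl

namespace Weight

variable {φ : Weight A}

lemma congr (φ : Weight A) {a b : PosCone A} (h : (a : A) = b) : φ a = φ b := by
  rw [Subtype.ext h]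

lemma map_add_eq (φ : Weight A) (a b : PosCone A) :
    φ (posOf ((a : A) + b) (add_nonneg a.nonneg b.nonneg)) = φ a + φ b :=
  φ.map_add' a b _ rfl

lemma mono (φ : Weight A) {a b : PosCone A} (h : (a : A) ≤ b) : φ a ≤ φ b := by
  rw [φ.map_add' a (posOf (b - a) (sub_nonneg.2 h)) b (by simp)]
  exact le_self_add

lemma map_zero_eq (φ : Weight A) {a : PosCone A} (h : (a : A) = 0) : φ a = 0 := by
  have := φ.map_smul' 0 a a (by rw [h]; simp)
  simpa using this

lemma map_smul_le (φ : Weight A) {a b : PosCone A} {t : ℝ} (ht : 0 ≤ t)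
    (h : (b : A) ≤ t • (a : A)) : φ b ≤ ENNReal.ofReal t * φ a := by
  have h1 : 0 ≤ t • (a : A) := smul_nonneg ht a.nonneg
  refine (φ.mono (b := posOf _ h1) h).trans_eq ?_
  rw [φ.map_smul' (NNReal.mk t ht) a _ (Complex.coe_smul t (a : A)).symm,
    ENNReal.ofReal_eq_coe_nnreal ht]

lemma lt_top_of_le_smul {a b : PosCone A} {t : ℝ} (ht : 0 ≤ t) (h : (b : A) ≤ t • (a : A))
    (ha : φ a < ∞) : φ b < ∞ :=
  (φ.map_smul_le ht h).trans_lt (ENNReal.mul_lt_top ENNReal.ofReal_lt_top ha)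

lemma le_of_tendsto {ι : Type*} {l : Filter ι} [l.NeBot] (hφ : LowerSemicontinuous φ.toFun)
    {a : PosCone A} {f : ι → PosCone A} (hf : Tendsto (fun i => (f i : A)) l (𝓝 (a : A)))
    {C : ℝ≥0∞} (hC : ∀ᶠ i in l, φ (f i) ≤ C) : φ a ≤ C := by
  by_contra! h
  have h1 : Tendsto f l (𝓝 a) := tendsto_subtype_rng.2 hf
  obtain ⟨i, hi, hi'⟩ := ((h1.eventually (hφ a C h)).and hC).exists
  exact (hi.trans_le hi').false

/-! ### The linear extension -/

lemma hasValue_coe {p : PosCone A} (h : φ p < ∞) : φ.HasValue p ((φ p).toReal : ℂ) := by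
  have h0 : φ (posOf (0 : A) le_rfl) = 0 := φ.map_zero_eq rfl
  refine ⟨p, posOf 0 le_rfl, posOf 0 le_rfl, posOf 0 le_rfl, h, ?_, ?_, ?_, ?_, ?_⟩ <;>
    simp [h0]

lemma hasValue_zero : φ.HasValue 0 0 := by
  have h0 : φ (posOf (0 : A) le_rfl) = 0 := φ.map_zero_eq rfl
  simpa [h0] using hasValue_coe (φ := φ) (p := posOf 0 le_rfl) (by simp [h0])

lemma HasValue.add {a b : A} {z w : ℂ} (ha : φ.HasValue a z) (hb : φ.HasValue b w) :
    φ.HasValue (a + b) (z + w) := by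
  obtain ⟨p, q, u, v, hp, hq, hu, hv, rfl, rfl⟩ := ha
  obtain ⟨p', q', u', v', hp', hq', hu', hv', rfl, rfl⟩ := hb
  refine ⟨posOf _ (add_nonneg p.nonneg p'.nonneg), posOf _ (add_nonneg q.nonneg q'.nonneg),
    posOf _ (add_nonneg u.nonneg u'.nonneg), posOf _ (add_nonneg v.nonneg v'.nonneg), ?_, ?_, ?_,
    ?_, ?_, ?_⟩
  any_goals rw [map_add_eq]; exact ENNReal.add_lt_top.2 ⟨‹_›, ‹_›⟩
  · simp only [coe_posOf, smul_sub, smul_add]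
    abel
  · simp only [map_add_eq]
    rw [ENNReal.toReal_add hp.ne hp'.ne, ENNReal.toReal_add hq.ne hq'.ne,
      ENNReal.toReal_add hu.ne hu'.ne, ENNReal.toReal_add hv.ne hv'.ne]
    push_cast
    ring

lemma HasValue.neg {a : A} {z : ℂ} (ha : φ.HasValue a z) : φ.HasValue (-a) (-z) := by
  obtain ⟨p, q, u, v, hp, hq, hu, hv, rfl, rfl⟩ := ha
  refine ⟨q, p, v, u, hq, hp, hv, hu, ?_, ?_⟩
  · simp only [smul_sub]
    abel
  · push_cast
    ring

lemma HasValue.sub {a b : A} {z w : ℂ} (ha : φ.HasValue a z) (hb : φ.HasValue b w) :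
    φ.HasValue (a - b) (z - w) := by
  simpa only [sub_eq_add_neg] using ha.add hb.neg

lemma HasValue.I_smul {a : A} {z : ℂ} (ha : φ.HasValue a z) :
    φ.HasValue (Complex.I • a) (Complex.I * z) := by
  obtain ⟨p, q, u, v, hp, hq, hu, hv, rfl, rfl⟩ := ha
  refine ⟨v, u, p, q, hv, hu, hp, hq, ?_, ?_⟩
  · simp only [smul_add, smul_smul, Complex.I_mul_I, neg_smul, one_smul]
    abel
  · push_cast
    linear_combination (((φ u).toReal : ℂ) - (φ v).toReal) * Complex.I_mul_I

lemma HasValue.nnreal_smul {a : A} {z : ℂ} (ha : φ.HasValue a z) {t : ℝ} (ht : 0 ≤ t) :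
    φ.HasValue ((t : ℂ) • a) (t * z) := by
  obtain ⟨p, q, u, v, hp, hq, hu, hv, rfl, rfl⟩ := ha
  have key : ∀ p : PosCone A, ∃ p' : PosCone A, (p' : A) = (t : ℂ) • (p : A) ∧
      φ p' = (NNReal.mk t ht) * φ p := fun p =>
    ⟨posOf ((t : ℂ) • (p : A)) (by rw [Complex.coe_smul]; exact smul_nonneg ht p.nonneg), rfl,
      φ.map_smul' (NNReal.mk t ht) p _ rfl⟩
  obtain ⟨p', ep, hp'⟩ := key p
  obtain ⟨q', eq, hq'⟩ := key q
  obtain ⟨u', eu, hu'⟩ := key u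
  obtain ⟨v', ev, hv'⟩ := key v
  refine ⟨p', q', u', v', ?_, ?_, ?_, ?_, ?_, ?_⟩
  any_goals simp only [hp', hq', hu', hv']; exact ENNReal.mul_lt_top ENNReal.coe_lt_top ‹_›
  · rw [ep, eq, eu, ev]
    simp only [smul_add, smul_sub, smul_comm (t : ℂ) Complex.I]
  · rw [hp', hq', hu', hv']
    simp only [ENNReal.toReal_mul, ENNReal.coe_toReal, NNReal.coe_mk]
    push_cast
    ring

lemma HasValue.smul {a : A} {z : ℂ} (ha : φ.HasValue a z) (c : ℂ) :
    φ.HasValue (c • a) (c * z) := by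
  have hr : ∀ {a : A} {z : ℂ}, φ.HasValue a z → ∀ t : ℝ, φ.HasValue ((t : ℂ) • a) (t * z) := by
    intro a z ha t
    rcases le_total 0 t with ht | ht
    · exact ha.nnreal_smul ht
    · simpa using (ha.nnreal_smul (neg_nonneg.2 ht)).neg
  have h := (hr ha c.re).add (hr ha.I_smul c.im)
  rw [smul_smul, ← mul_assoc, ← add_smul, ← add_mul, Complex.re_add_im] at h
  exact h

lemma sub_eq_of_sub_eq {p q p' q' : PosCone A} (hp : φ p < ∞) (hq : φ q < ∞) (hp' : φ p' < ∞)
    (hq' : φ q' < ∞) (h : (p : A) - q = p' - q') :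
    (φ p).toReal - (φ q).toReal = (φ p').toReal - (φ q').toReal := by
  have h1 : φ p + φ q' = φ p' + φ q := by
    rw [← map_add_eq, ← map_add_eq]
    refine φ.congr ?_
    rw [sub_eq_sub_iff_add_eq_add] at h
    exact h
  have h2 := congrArg ENNReal.toReal h1
  rw [ENNReal.toReal_add hp.ne hq'.ne, ENNReal.toReal_add hp'.ne hq.ne] at h2
  linarith

/-- The two differences are the real and the imaginary part of a, so they do not depend on the
decomposition. With `sub_eq_of_sub_eq` this makes the linear extension well defined. -/
lemma sub_eq_smul_add_star {p q u v : PosCone A} {a : A}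
    (h : a = ((p : A) - q) + Complex.I • ((u : A) - v)) :
    (p : A) - q = (1 / 2 : ℂ) • (a + star a) ∧
      (u : A) - v = (1 / 2 : ℂ) • ((-Complex.I) • a + star ((-Complex.I) • a)) := by
  have hs : star a = ((p : A) - q) - Complex.I • ((u : A) - v) := by
    rw [h, star_add, star_smul, star_sub, star_sub, p.isSelfAdjoint.star_eq,
      q.isSelfAdjoint.star_eq, u.isSelfAdjoint.star_eq, v.isSelfAdjoint.star_eq]
    simp only [Complex.star_def, Complex.conj_I, neg_smul, sub_eq_add_neg]
  constructor
  · rw [hs, h]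
    module
  · rw [star_smul, hs, h]
    simp only [star_neg, Complex.star_def, Complex.conj_I, neg_neg]
    simp only [smul_add, smul_sub, smul_smul, neg_mul, Complex.I_mul_I]
    module

lemma HasValue.unique {a : A} {z w : ℂ} (ha : φ.HasValue a z) (hb : φ.HasValue a w) : z = w := by
  obtain ⟨p, q, u, v, hp, hq, hu, hv, h, rfl⟩ := ha
  obtain ⟨p', q', u', v', hp', hq', hu', hv', h', rfl⟩ := hb
  obtain ⟨h1, h2⟩ := sub_eq_smul_add_star h
  obtain ⟨h1', h2'⟩ := sub_eq_smul_add_star h'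
  rw [sub_eq_of_sub_eq hp hq hp' hq' (h1.trans h1'.symm),
    sub_eq_of_sub_eq hu hv hu' hv' (h2.trans h2'.symm)]

lemma HasValue.map {α : ℝ → A ≃⋆ₐ[ℂ] A} (hφ : φ.IsInvariant α) {a : A} {z : ℂ}
    (ha : φ.HasValue a z) (t : ℝ) : φ.HasValue (α t a) z := by
  obtain ⟨p, q, u, v, hp, hq, hu, hv, rfl, rfl⟩ := ha
  have key : ∀ p : PosCone A, ∃ p' : PosCone A, (p' : A) = α t p ∧ φ p' = φ p := by
    intro p
    obtain ⟨b, hb⟩ := p.2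
    refine ⟨starMulSelf (α t b), ?_, ?_⟩
    · rw [coe_starMulSelf, hb, map_mul, map_star]
    · exact hφ t p _ (by rw [coe_starMulSelf, hb, map_mul, map_star])
  obtain ⟨p', ep, hp'⟩ := key p
  obtain ⟨q', eq, hq'⟩ := key q
  obtain ⟨u', eu, hu'⟩ := key u
  obtain ⟨v', ev, hv'⟩ := key v
  refine ⟨p', q', u', v', hp' ▸ hp, hq' ▸ hq, hu' ▸ hu, hv' ▸ hv, ?_, ?_⟩
  · rw [ep, eq, eu, ev, map_add, map_smul, map_sub, map_sub]
  · rw [hp', hq', hu', hv']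

/-! ### The left ideal of square integrable elements -/

/-- The difference of the two sides is (a - b)*(a - b). -/
lemma sq_add_le (a b : A) : star (a + b) * (a + b) ≤ (2 : ℝ) • (star a * a + star b * b) := by
  have h := star_mul_self_nonneg (a - b)
  rw [← sub_nonneg]
  convert h using 1
  simp only [star_add, star_sub, add_mul, mul_add, sub_mul, mul_sub, two_smul]
  abel

lemma starMulSelf_add_lt_top {a b : A} (ha : φ (starMulSelf a) < ∞)
    (hb : φ (starMulSelf b) < ∞) : φ (starMulSelf (a + b)) < ∞ := by
  refine lt_top_of_le_smul (φ := φ) (a := posOf _ (add_nonneg (starMulSelf a).nonneg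
    (starMulSelf b).nonneg)) (t := 2) (by norm_num) (sq_add_le a b) ?_
  rw [map_add_eq]
  exact ENNReal.add_lt_top.2 ⟨ha, hb⟩

lemma starMulSelf_smul_lt_top {a : A} (ha : φ (starMulSelf a) < ∞) (c : ℂ) :
    φ (starMulSelf (c • a)) < ∞ := by
  refine lt_top_of_le_smul (φ := φ) (a := starMulSelf a) (t := ‖c‖ ^ 2) (by positivity)
    (le_of_eq ?_) ha
  rw [coe_starMulSelf, coe_starMulSelf, star_smul, smul_mul_smul_comm, ← Complex.coe_smul]
  congr 1
  rw [Complex.star_def, mul_comm, Complex.mul_conj, Complex.normSq_eq_norm_sq]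

/-- (ca)*(ca) ≤ ‖c*c‖ a*a, so the square integrable elements form a left ideal. -/
lemma starMulSelf_mul_lt_top {a : A} (ha : φ (starMulSelf a) < ∞) (c : A) :
    φ (starMulSelf (c * a)) < ∞ := by
  refine lt_top_of_le_smul (φ := φ) (a := starMulSelf a) (t := ‖star c * c‖) (norm_nonneg _) ?_ ha
  have := CStarAlgebra.star_left_conjugate_le_norm_smul (a := a) (b := star c * c)
    (IsSelfAdjoint.star_mul_self c)
  simpa only [coe_starMulSelf, star_mul, mul_assoc] using this

/-- Polarization, with the factor 1/4 moved into the arguments so that all four terms are of the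
form x*x and can be fed to a weight. -/
lemma star_mul_eq (y c : A) : star y * c =
    ((starMulSelf ((1 / 2 : ℂ) • (c + y)) : A) - starMulSelf ((1 / 2 : ℂ) • (c - y))) +
      Complex.I • ((starMulSelf ((1 / 2 : ℂ) • (c + Complex.I • y)) : A) -
        starMulSelf ((1 / 2 : ℂ) • (c - Complex.I • y))) := by
  have h1 : ∀ a : A, (starMulSelf ((1 / 2 : ℂ) • a) : A) = (1 / 4 : ℂ) • (star a * a) := by
    intro a
    rw [coe_starMulSelf, star_smul, smul_mul_smul_comm]
    congr 1
    rw [Complex.star_def, map_div₀, map_one, map_ofNat]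
    norm_num
  have h2 : star (Complex.I • y) = -(Complex.I • star y) := by
    rw [star_smul, Complex.star_def, Complex.conj_I, neg_smul]
  rw [h1, h1, h1, h1]
  simp only [star_add, star_sub, h2, add_mul, mul_add, sub_mul, mul_sub, neg_mul,
    smul_mul_assoc, mul_smul_comm, smul_add, smul_sub, smul_neg, smul_smul]
  have h3 : Complex.I * (1 / 4 * Complex.I) = -(1 / 4) := by
    linear_combination (1 / 4) * Complex.I_mul_I
  simp only [h3]
  module

lemma exists_hasValue_star_mul {y c : A} (hy : φ (starMulSelf y) < ∞)
    (hc : φ (starMulSelf c) < ∞) : ∃ z, φ.HasValue (star y * c) z := by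
  have hy' : φ (starMulSelf (-y)) < ∞ := by simpa using starMulSelf_smul_lt_top hy (-1)
  have hIy := starMulSelf_smul_lt_top hy Complex.I
  have hIy' : φ (starMulSelf (-(Complex.I • y))) < ∞ := by
    simpa using starMulSelf_smul_lt_top hy (-Complex.I)
  refine ⟨_, _, _, _, _, starMulSelf_smul_lt_top (starMulSelf_add_lt_top hc hy) _, ?_,
    starMulSelf_smul_lt_top (starMulSelf_add_lt_top hc hIy) _, ?_, star_mul_eq y c, rfl⟩
  · rw [sub_eq_add_neg]
    exact starMulSelf_smul_lt_top (starMulSelf_add_lt_top hc hy') _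
  · rw [sub_eq_add_neg]
    exact starMulSelf_smul_lt_top (starMulSelf_add_lt_top hc hIy') _

lemma star_mem_biDomain {a : A} (ha : a ∈ φ.biDomain) : star a ∈ φ.biDomain :=
  ⟨ha.2, by rw [star_star]; exact ha.1⟩

lemma exists_hasValue_mul {a b : A} (ha : a ∈ φ.biDomain) (hb : b ∈ φ.biDomain) :
    ∃ z, φ.HasValue (a * b) z := by
  simpa using exists_hasValue_star_mul ha.2 hb.1

/-- The real and the imaginary part k of x lie in the corner of P and satisfy ±k ≤ ‖x‖P, so each
contributes at most ‖x‖φ(P). This is the source of the factor 2. -/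
lemma HasValue.norm_le {P : A} (hP : IsSelfAdjoint P) (hPP : P * P = P) {p : PosCone A}
    (hp : (p : A) = P) (hpf : φ p < ∞) {x : A} (hx : P * x * P = x) {z : ℂ}
    (hz : φ.HasValue x z) : ‖z‖ ≤ 2 * ‖x‖ * (φ p).toReal := by
  have key : ∀ (u v : PosCone A) (y : A), φ u < ∞ → φ v < ∞ → P * y * P = y → ‖y‖ ≤ ‖x‖ →
      (u : A) - v = (1 / 2 : ℂ) • (y + star y) →
      |(φ u).toReal - (φ v).toReal| ≤ ‖x‖ * (φ p).toReal := by
    have one : ∀ (u v : PosCone A) (y : A), φ u < ∞ → φ v < ∞ → P * y * P = y → ‖y‖ ≤ ‖x‖ →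
        (u : A) - v = (1 / 2 : ℂ) • (y + star y) →
        (φ u).toReal - (φ v).toReal ≤ ‖x‖ * (φ p).toReal := by
      intro u v y hu hv hy hyx h
      set k := (1 / 2 : ℂ) • (y + star y) with hk
      have hks : IsSelfAdjoint k := by
        rw [← h]; exact u.isSelfAdjoint.sub v.isSelfAdjoint
      have hkn : ‖k‖ ≤ ‖x‖ := by
        rw [hk, norm_smul]
        have := norm_add_le y (star y)
        rw [norm_star] at this
        norm_num
        linarith
      have hkP : star P * k * P = k := by
        have hy' : P * star y * P = star y := by
          have := congrArg star hy
          simpa only [star_mul, hP.star_eq, mul_assoc] using this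
        rw [hP.star_eq, hk, mul_smul_comm, smul_mul_assoc, mul_add, add_mul, hy, hy']
      have h1 := CStarAlgebra.star_left_conjugate_le_norm_smul (a := P) (b := k) hks
      rw [hkP, hP.star_eq, hPP] at h1
      have h2 : (u : A) ≤ v + ‖x‖ • (p : A) := by
        rw [← sub_le_iff_le_add', h]
        refine h1.trans ?_
        rw [hp]
        refine smul_le_smul_of_nonneg_right hkn ?_
        rw [← hp]; exact p.nonneg
      have hxp : 0 ≤ ‖x‖ • (p : A) := smul_nonneg (norm_nonneg _) p.nonneg
      have h3 : φ u ≤ φ v + ENNReal.ofReal ‖x‖ * φ p := by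
        refine (φ.mono (b := posOf _ (add_nonneg v.nonneg hxp)) h2).trans ?_
        rw [φ.map_add' v (posOf _ hxp) _ rfl]
        gcongr
        exact φ.map_smul_le (norm_nonneg _) le_rfl
      have h4 : ENNReal.ofReal ‖x‖ * φ p ≠ ∞ := ENNReal.mul_ne_top ENNReal.ofReal_ne_top hpf.ne
      have h5 := ENNReal.toReal_mono (ENNReal.add_ne_top.2 ⟨hv.ne, h4⟩) h3
      rw [ENNReal.toReal_add hv.ne h4, ENNReal.toReal_mul,
        ENNReal.toReal_ofReal (norm_nonneg _)] at h5
      linarith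
    intro u v y hu hv hy hyx h
    refine abs_sub_le_iff.2 ⟨one u v y hu hv hy hyx h, one v u (-y) hv hu ?_ ?_ ?_⟩
    · rw [mul_neg, neg_mul, hy]
    · rwa [norm_neg]
    · rw [← neg_sub, h, star_neg]
      module
  obtain ⟨p', q, u, v, hp', hq, hu, hv, h, rfl⟩ := hz
  obtain ⟨h1, h2⟩ := sub_eq_smul_add_star h
  have k1 := key p' q x hp' hq hx le_rfl h1
  have k2 := key u v ((-Complex.I) • x) hu hv (by rw [mul_smul_comm, smul_mul_assoc, hx])
    (by rw [norm_smul]; simp) h2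
  refine (norm_add_le _ _).trans ?_
  rw [norm_mul, Complex.norm_I, one_mul, Complex.norm_real, Complex.norm_real, Real.norm_eq_abs,
    Real.norm_eq_abs]
  linarith

end Weight

end AbstractWeights

end GraphKMS

namespace GraphKMS

section KMSWeights

open Filter

variable {A : Type*} [NonUnitalCStarAlgebra A]

attribute [local instance] CStarAlgebra.spectralOrder CStarAlgebra.spectralOrderedRing

/-! ### Strips and the KMS condition on eigenvectors -/

/-- Multiplication by βi carries the vertical strip 0 ≤ Re w ≤ 1 of the three lines theorem to the
strip of the KMS condition, whatever the sign of β. -/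
lemma mapsTo_strip {β : ℝ} {w : ℂ} (hw : w.re ∈ Set.Icc (0 : ℝ) 1) :
    (β : ℂ) * Complex.I * w ∈ strip β := by
  have h1 : ((β : ℂ) * Complex.I * w).im = β * w.re := by simp
  change _ ∈ Set.uIcc 0 β
  rw [h1, Set.mem_uIcc]
  rcases le_total 0 β with h | h
  · exact Or.inl ⟨mul_nonneg h hw.1, mul_le_of_le_one_right h hw.2⟩
  · exact Or.inr ⟨by nlinarith [hw.1, hw.2], mul_nonpos_of_nonpos_of_nonneg h hw.1⟩

lemma isOpen_preimage_Ioo {β : ℝ} :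
    (fun z : ℂ => z.im) ⁻¹' Set.Ioo (min 0 β) (max 0 β) ⊆ interior (strip β) :=
  interior_maximal (fun _ hz => Set.Ioo_subset_Icc_self hz)
    (isOpen_Ioo.preimage Complex.continuous_im)

lemma mapsTo_interior_strip {β : ℝ} (hβ : β ≠ 0) {w : ℂ} (hw : w.re ∈ Set.Ioo (0 : ℝ) 1) :
    (β : ℂ) * Complex.I * w ∈ interior (strip β) := by
  refine isOpen_preimage_Ioo ?_
  have h1 : ((β : ℂ) * Complex.I * w).im = β * w.re := by simp
  rw [Set.mem_preimage, h1]
  rcases lt_or_gt_of_ne hβ with h | h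
  · rw [min_eq_right h.le, max_eq_left h.le]
    exact ⟨by nlinarith [hw.1, hw.2], mul_neg_of_neg_of_pos h hw.1⟩
  · rw [min_eq_left h.le, max_eq_right h.le]
    exact ⟨mul_pos h hw.1, mul_lt_of_lt_one_right h hw.2⟩

/-- A bounded function on the strip that is holomorphic in the interior and vanishes on the real
line is zero. -/
lemma eq_zero_of_strip {β : ℝ} (hβ : β ≠ 0) {g : ℂ → ℂ} (hc : ContinuousOn g (strip β))
    {C : ℝ} (hC : ∀ z ∈ strip β, ‖g z‖ ≤ C) (hd : DifferentiableOn ℂ g (interior (strip β)))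
    (h0 : ∀ t : ℝ, g t = 0) : g (β * Complex.I) = 0 := by
  let m : ℂ → ℂ := fun w => (β : ℂ) * Complex.I * w
  have hm : Continuous m := by fun_prop
  have hcl : closure (Complex.HadamardThreeLines.verticalStrip 0 1) =
      Complex.HadamardThreeLines.verticalClosedStrip 0 1 := by
    rw [Complex.HadamardThreeLines.verticalStrip, Complex.HadamardThreeLines.verticalClosedStrip,
      Complex.closure_preimage_re, closure_Ioo zero_ne_one]
  have hgm : ContinuousOn (g ∘ m) (Complex.HadamardThreeLines.verticalClosedStrip 0 1) :=
    hc.comp hm.continuousOn fun w hw => mapsTo_strip hw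
  have hd' : DiffContOnCl ℂ (g ∘ m) (Complex.HadamardThreeLines.verticalStrip 0 1) := by
    refine ⟨hd.comp (by fun_prop) fun w hw => mapsTo_interior_strip hβ hw, ?_⟩
    rw [hcl]
    exact hgm
  have hb : ∀ z ∈ Complex.HadamardThreeLines.verticalClosedStrip 0 1, ‖(g ∘ m) z‖ ≤ C :=
    fun z hz => hC _ (mapsTo_strip hz)
  -- With the bounds 0 on the left line and C on the right one, the three lines theorem gives |g| ≤
  -- 0^{1 - Re w} C^{Re w} = 0 as long as Re w < 1.
  have key : ∀ w : ℂ, w.re ∈ Set.Ico (0 : ℝ) 1 → (g ∘ m) w = 0 := by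
    intro w hw
    have := Complex.HadamardThreeLines.norm_le_interp_of_mem_verticalClosedStrip₀₁' (g ∘ m)
      (z := w) (a := 0) (b := C) (Set.Ico_subset_Icc_self hw) hd'
      ⟨C, by rintro _ ⟨z, hz, rfl⟩; exact hb z hz⟩ (fun z hz => ?_) (fun z hz => ?_)
    · rw [Real.zero_rpow (by linarith [hw.2]), zero_mul] at this
      exact norm_le_zero_iff.1 this
    · have hz0 : z.re = 0 := hz
      have : m z = ((-(β * z.im) : ℝ) : ℂ) := by
        apply Complex.ext <;> simp [m, hz0]
      simp only [Function.comp_apply]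
      rw [this, h0, norm_zero]
    · have hz1 : z.re = 1 := hz
      exact hb z (by change z.re ∈ Set.Icc (0 : ℝ) 1; rw [hz1]; simp)
  -- At Re w = 1 the interpolated bound is vacuous, so the value at βi is obtained by continuity
  -- from the left.
  have h1 : Tendsto (fun s : ℝ => (g ∘ m) s) (𝓝[<] 1) (𝓝 ((g ∘ m) (1 : ℝ))) := by
    have hw : ContinuousWithinAt (g ∘ m) (Complex.HadamardThreeLines.verticalClosedStrip 0 1)
        ((1 : ℝ) : ℂ) := hgm _ (by
          change ((1 : ℝ) : ℂ).re ∈ Set.Icc (0 : ℝ) 1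
          rw [Complex.ofReal_re]; simp)
    refine hw.tendsto.comp (tendsto_nhdsWithin_iff.2 ⟨?_, ?_⟩)
    · exact (Complex.continuous_ofReal.tendsto 1).mono_left nhdsWithin_le_nhds
    · filter_upwards [Ioo_mem_nhdsLT (zero_lt_one' ℝ)] with s hs
      change ((s : ℝ) : ℂ).re ∈ Set.Icc (0 : ℝ) 1
      rw [Complex.ofReal_re]
      exact ⟨hs.1.le, hs.2.le⟩
  have h2 : Tendsto (fun s : ℝ => (g ∘ m) s) (𝓝[<] 1) (𝓝 0) := by
    refine tendsto_const_nhds.congr' ?_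
    filter_upwards [Ioo_mem_nhdsLT (zero_lt_one' ℝ)] with s hs
    exact (key s (by rw [Complex.ofReal_re]; exact ⟨hs.1.le, hs.2⟩)).symm
  have := tendsto_nhds_unique h1 h2
  simpa [m] using this

namespace Weight

variable {φ : Weight A} {α : ℝ → A ≃⋆ₐ[ℂ] A} {β : ℝ}

/-- The KMS condition for an eigenvector `b` of `α`: `φ(ba) = e^{-βc} φ(ab)`. -/
lemma IsKMS.eigen (hφ : φ.IsKMS α β) {a b : A} (ha : a ∈ φ.biDomain) (hb : b ∈ φ.biDomain)
    {c : ℝ} (hc : ∀ t, α t b = Complex.exp ((t * c : ℝ) * Complex.I) • b) {z w : ℂ}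
    (hz : φ.HasValue (a * b) z) (hw : φ.HasValue (b * a) w) :
    w = Complex.exp (-(β * c) : ℝ) * z := by
  obtain ⟨f, hf, ⟨C, hC⟩, hd, hv⟩ := hφ.2.2 a ha b hb
  have h1 : ∀ t : ℝ, f t = Complex.exp ((t * c : ℝ) * Complex.I) * z := fun t => by
    have := (hv t).1
    rw [hc, mul_smul_comm] at this
    exact this.unique (hz.smul _)
  have h2 : f ((0 : ℝ) + β * Complex.I) = w := by
    have := (hv 0).2
    rw [hc, smul_mul_assoc] at this
    simpa using this.unique (hw.smul _)
  rw [Complex.ofReal_zero, zero_add] at h2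
  -- For β = 0 the strip has empty interior, but the two boundary conditions are then about the same
  -- points.
  by_cases hβ : β = 0
  · subst hβ
    have := h1 0
    simp only [Complex.ofReal_zero, zero_mul, Complex.exp_zero, one_mul] at this h2
    simp [← h2, this]
  -- On the real line f(t) = e^{itc}z, so e^{-icx}f(x) - z vanishes there and hence at iβ as well.
  let g : ℂ → ℂ := fun x => Complex.exp (-(Complex.I * x * c)) * f x - z
  have hexp : ∀ x ∈ strip β, ‖Complex.exp (-(Complex.I * x * c))‖ ≤ Real.exp (|β| * |c|) := by
    intro x hx
    rw [Complex.norm_exp]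
    refine Real.exp_le_exp.2 ?_
    have h3 : (-(Complex.I * x * c)).re = x.im * c := by simp
    have h4 : |x.im| ≤ |β| := by
      have := Set.abs_sub_left_of_mem_uIcc (show x.im ∈ Set.uIcc 0 β from hx)
      simpa using this
    rw [h3]
    exact (le_abs_self _).trans (by rw [abs_mul]; gcongr)
  have hg : g (β * Complex.I) = 0 := by
    refine eq_zero_of_strip hβ (C := Real.exp (|β| * |c|) * C + ‖z‖) ?_ ?_ ?_ ?_
    · exact ((by fun_prop : Continuous fun x : ℂ =>
        Complex.exp (-(Complex.I * x * c))).continuousOn.mul hf).sub continuousOn_const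
    · intro x hx
      refine (norm_sub_le _ _).trans ?_
      rw [norm_mul]
      gcongr
      · exact hexp x hx
      · exact hC x hx
    · exact ((by fun_prop : Differentiable ℂ fun x : ℂ =>
        Complex.exp (-(Complex.I * x * c))).differentiableOn.mul hd).sub_const z
    · intro t
      simp only [g]
      rw [h1, ← mul_assoc, ← Complex.exp_add]
      have : -(Complex.I * t * c) + (t * c : ℝ) * Complex.I = 0 := by push_cast; ring
      rw [this]
      simp
  simp only [g, h2, sub_eq_zero] at hg
  rw [← hg, ← mul_assoc, ← Complex.exp_add]
  have : ((-(β * c) : ℝ) : ℂ) + -(Complex.I * (β * Complex.I) * c) = 0 := by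
    push_cast
    linear_combination (-(β * c : ℂ)) * Complex.I_mul_I
  rw [this]
  simp

/-- Against elements fixed by the action φ behaves like a trace; this is the eigenvalue c = 0. -/
lemma IsKMS.fixed (hφ : φ.IsKMS α β) {a b : A} (ha : a ∈ φ.biDomain) (hb : b ∈ φ.biDomain)
    (hc : ∀ t, α t b = b) {z w : ℂ} (hz : φ.HasValue (a * b) z) (hw : φ.HasValue (b * a) w) :
    w = z := by
  have := hφ.eigen ha hb (c := 0) (fun t => by simp [hc]) hz hw
  simpa using this

lemma IsKMS.apply_starMulSelf (hφ : φ.IsKMS α β) {b : A} (hb : b ∈ φ.biDomain) {c : ℝ}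
    (hc : ∀ t, α t b = Complex.exp ((t * c : ℝ) * Complex.I) • b) :
    φ (starMulSelf (star b)) = ENNReal.ofReal (Real.exp (-(β * c))) * φ (starMulSelf b) := by
  have h1 := hasValue_coe hb.1
  have h2 := hasValue_coe hb.2
  simp only [coe_starMulSelf, star_star] at h1 h2
  have h := hφ.eigen (star_mem_biDomain hb) hb hc h1 h2
  rw [← Complex.ofReal_exp, ← Complex.ofReal_mul, Complex.ofReal_inj] at h
  rw [← ENNReal.ofReal_toReal hb.2.ne, h, ENNReal.ofReal_mul (Real.exp_pos _).le,
    ENNReal.ofReal_toReal hb.1.ne]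

/-! ### Positive elements with finite weight -/

/-- If a = b*b then a² = b*(bb*)b ≤ ‖a‖ b*b. -/
lemma sq_mem {a : PosCone A} (ha : φ a < ∞) : φ (starMulSelf (a : A)) < ∞ := by
  refine lt_top_of_le_smul (φ := φ) (a := a) (t := ‖(a : A)‖) (norm_nonneg _) ?_ ha
  obtain ⟨b, hb⟩ := a.2
  have h := CStarAlgebra.star_left_conjugate_le_norm_smul (a := b) (b := b * star b)
    (IsSelfAdjoint.mul_star_self b)
  rw [CStarRing.norm_self_mul_star, ← CStarRing.norm_star_mul_self, ← hb] at h
  rw [coe_starMulSelf, a.isSelfAdjoint.star_eq]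
  refine le_of_eq_of_le ?_ h
  rw [hb]
  simp only [mul_assoc]

lemma mem_biDomain {a : PosCone A} (ha : φ a < ∞) : (a : A) ∈ φ.biDomain :=
  ⟨sq_mem ha, by rw [a.isSelfAdjoint.star_eq]; exact sq_mem ha⟩

lemma mul_mem_biDomain {a b : A} (ha : φ (starMulSelf (star a)) < ∞)
    (hb : φ (starMulSelf b) < ∞) : a * b ∈ φ.biDomain :=
  ⟨starMulSelf_mul_lt_top hb a, by rw [star_mul]; exact starMulSelf_mul_lt_top ha _⟩

/-- A fixed projection in the closure of the fixed positive elements of finite weight has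
finite weight. -/
lemma IsKMS.lt_top_of_mem_closure (hφ : φ.IsKMS α β) {p : PosCone A}
    (hpp : (p : A) * p = p) (hp : ∀ t, α t p = p)
    (h : (p : A) ∈ closure {x : A | ∃ a : PosCone A, (a : A) = x ∧ φ a < ∞ ∧ ∀ t, α t a = a}) :
    φ p < ∞ := by
  set P : A := (p : A) with hP
  have hPs : star P = P := p.isSelfAdjoint.star_eq
  obtain ⟨u, hu, hlim⟩ := mem_closure_iff_seq_limit.1 h
  choose a ha haf hfix using hu
  -- One approximant b with b² within 1/2 of P is frozen, while the others run to the limit.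
  obtain ⟨k, hk⟩ : ∃ k, ‖P - (a k : A) * a k‖ ≤ 1 / 2 := by
    have h1 : Tendsto (fun n => ‖P - (a n : A) * a n‖) atTop (𝓝 0) := by
      have h2 : Tendsto (fun n => (a n : A)) atTop (𝓝 P) := by simpa only [ha] using hlim
      have h3 := ((tendsto_const_nhds (x := P)).sub (h2.mul h2)).norm
      rwa [hpp, sub_self, norm_zero] at h3
    exact ((h1.eventually (ge_mem_nhds (by norm_num : (0 : ℝ) < 1 / 2)))).exists
  set b : A := (a k : A) with hb
  have hbs : star b = b := (a k).isSelfAdjoint.star_eq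
  have hbN := sq_mem (haf k)
  rw [← hb] at hbN
  -- the elements `b p a_n`
  have hy : ∀ n, b * P * (a n : A) ∈ φ.biDomain := fun n =>
    mul_mem_biDomain (by rw [star_mul, hPs, hbs]; exact starMulSelf_mul_lt_top hbN P)
      (sq_mem (haf n))
  -- The element y = bPa_n is fixed, so φ(y*y) = φ(yy*), and yy* = bPa_n²Pb is at most K²·bPb, whose
  -- weight is finite and independent of n.
  have heq : ∀ n, φ (starMulSelf (b * P * (a n : A))) =
      φ (starMulSelf (star (b * P * (a n : A)))) := by
    intro n
    have := hφ.apply_starMulSelf (hy n) (c := 0) fun t => by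
      rw [map_mul, map_mul, hb, hfix k, hfix n, hp]
      simp
    simpa using this.symm
  obtain ⟨K, hK⟩ : ∃ K, ∀ n, ‖u n‖ ≤ K := by
    obtain ⟨K, hK⟩ := (Metric.isBounded_range_of_tendsto u hlim).exists_norm_le
    exact ⟨K, fun n => hK _ ⟨n, rfl⟩⟩
  have hK0 : 0 ≤ K := (norm_nonneg _).trans (hK 0)
  have hbound : ∀ n, φ (starMulSelf (b * P * (a n : A))) ≤
      ENNReal.ofReal (K * K) * φ (starMulSelf (P * b)) := by
    intro n
    rw [heq]
    refine φ.map_smul_le (by positivity) ?_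
    have h1 := CStarAlgebra.star_left_conjugate_le_norm_smul (a := P * b)
      (b := (a n : A) * a n) (by
        have := IsSelfAdjoint.star_mul_self (a n : A)
        rwa [(a n).isSelfAdjoint.star_eq] at this)
    have h2 : ‖(a n : A) * a n‖ ≤ K * K := by
      refine (norm_mul_le _ _).trans ?_
      rw [ha]
      gcongr <;> exact hK n
    have h3 := h1.trans (smul_le_smul_of_nonneg_right h2 (star_mul_self_nonneg (P * b)))
    refine le_of_eq_of_le ?_ h3
    simp only [coe_starMulSelf, star_mul, hPs, hbs, (a n).isSelfAdjoint.star_eq,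
      mul_assoc]
  -- As bPa_n tends to bP, lower semicontinuity carries the uniform bound over to φ(Pb²P).
  have hfin : φ (starMulSelf (b * P)) < ∞ := by
    refine (le_of_tendsto hφ.1.2.2 (f := fun n => starMulSelf (b * P * (a n : A))) (l := atTop)
      ?_ (Eventually.of_forall hbound)).trans_lt
      (ENNReal.mul_lt_top ENNReal.ofReal_lt_top (starMulSelf_mul_lt_top hbN P))
    have h1 : Tendsto (fun n => b * P * (a n : A)) atTop (𝓝 (b * P)) := by
      have h2 : Tendsto (fun n => (a n : A)) atTop (𝓝 P) := by simpa only [ha] using hlim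
      have h3 := h2.const_mul (b * P)
      rwa [mul_assoc, hpp] at h3
    exact h1.star.mul h1
  -- Compressing P - b² by P and using that its norm is at most 1/2 gives P ≤ 2Pb²P.
  refine lt_top_of_le_smul (φ := φ) (a := starMulSelf (b * P)) (t := 2) (by norm_num) ?_ hfin
  have h1 := CStarAlgebra.star_left_conjugate_le_norm_smul (a := P) (b := P - b * b) (by
    refine p.isSelfAdjoint.sub ?_
    have := IsSelfAdjoint.star_mul_self b
    rwa [hbs] at this)
  rw [hPs, hpp] at h1
  have h2 := h1.trans (smul_le_smul_of_nonneg_right hk p.nonneg)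
  have h3 : P * (P - b * b) * P = P - star (b * P) * (b * P) := by
    rw [star_mul, hPs, hbs]
    simp only [mul_sub, sub_mul, hpp, mul_assoc]
  rw [h3, sub_le_iff_le_add'] at h2
  have h4 : (1 / 2 : ℝ) • P ≤ star (b * P) * (b * P) := by
    have h5 : (1 / 2 : ℝ) • P = P - (1 / 2 : ℝ) • P := by module
    rw [h5, sub_le_iff_le_add]
    exact h2
  have h6 := smul_le_smul_of_nonneg_left h4 (by norm_num : (0 : ℝ) ≤ 2)
  rw [smul_smul] at h6
  simpa using h6

/-- Compression by a fixed projection of finite weight does not increase the weight. -/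
lemma IsKMS.compress_le (hφ : φ.IsKMS α β) {p : PosCone A} (hpp : (p : A) * p = p)
    (hp : ∀ t, α t p = p) (hpf : φ p < ∞) {a q : PosCone A} (hq : (q : A) = p * a * p) :
    φ q ≤ φ a := by
  rcases eq_or_ne (φ a) ∞ with h | haf
  · rw [h]; exact le_top
  have haf : φ a < ∞ := haf.lt_top
  set P : A := (p : A) with hP
  have hPs : star P = P := p.isSelfAdjoint.star_eq
  have hPd : P ∈ φ.biDomain := mem_biDomain hpf
  have had : (a : A) ∈ φ.biDomain := mem_biDomain haf
  have has : star (a : A) = a := a.isSelfAdjoint.star_eq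
  have haP : (a : A) * P ∈ φ.biDomain := mul_mem_biDomain had.2 hPd.1
  obtain ⟨z, hz⟩ := exists_hasValue_mul had hPd
  obtain ⟨z', hz'⟩ := exists_hasValue_mul hPd had
  have hqf : φ q < ∞ := by
    refine lt_top_of_le_smul (φ := φ) (a := p) (t := ‖(a : A)‖) (norm_nonneg _) ?_ hpf
    have := CStarAlgebra.star_left_conjugate_le_norm_smul (a := P) (b := (a : A)) a.isSelfAdjoint
    rwa [hPs, hpp, ← hq] at this
  have hqv := hasValue_coe hqf
  -- Since P is fixed, φ(Pa) = φ(aP) = φ(PaP). With a = b*b, the nonnegative number φ((b - bP)*(b -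
  -- bP)) therefore equals φ(a) - φ(PaP).
  have e1 : z' = z := hφ.fixed had hPd hp hz hz'
  have e2 : ((φ q).toReal : ℂ) = z := by
    refine hφ.fixed haP hPd hp ?_ ?_
    · rwa [mul_assoc, hpp]
    · rwa [← mul_assoc, ← hq]
  obtain ⟨b, hb⟩ := a.2
  have hbN : φ (starMulSelf b) < ∞ := by
    rwa [φ.congr (b := a)]
    rw [coe_starMulSelf, hb]
  have hbP : φ (starMulSelf (-(b * P))) < ∞ := by
    simpa using starMulSelf_smul_lt_top (starMulSelf_mul_lt_top hPd.1 b) (-1)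
  have hv := hasValue_coe (starMulSelf_add_lt_top hbN hbP)
  have hv' : φ.HasValue (starMulSelf (b + -(b * P)) : A) (((φ a).toReal : ℂ) - z - z' + z) := by
    have h1 := (((hasValue_coe haf).sub hz).sub hz').add (e2 ▸ hqv)
    convert h1 using 1
    rw [coe_starMulSelf, hq, hb]
    simp only [star_add, star_neg, star_mul, hPs, add_mul, mul_add, neg_mul, mul_neg, mul_assoc]
    abel
  have h3 := hv.unique hv'
  rw [e1, ← e2] at h3
  have h4 : (φ (starMulSelf (b + -(b * P)))).toReal = (φ a).toReal - (φ q).toReal := by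
    have : ((φ (starMulSelf (b + -(b * P)))).toReal : ℂ) =
      (((φ a).toReal - (φ q).toReal : ℝ) : ℂ) := by rw [h3]; push_cast; ring
    exact_mod_cast this
  have h5 : (φ q).toReal ≤ (φ a).toReal := by
    have := ENNReal.toReal_nonneg (a := φ (starMulSelf (b + -(b * P))))
    linarith
  exact (ENNReal.toReal_le_toReal hqf.ne haf.ne).1 h5

end Weight

end KMSWeights

end GraphKMS

namespace GraphKMS

section GaugeWeights

open Filter

variable {V E : Type*} {G : EGraph V E}

attribute [local instance] CStarAlgebra.spectralOrder CStarAlgebra.spectralOrderedRing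

/-! ### Faithful copies of the graph algebra -/

/-- A `C*`-algebra identified with the algebra of operators `C*(G)`, with the actions `α^F`. -/
structure GraphRep (G : EGraph V E) (A : Type*) [NonUnitalCStarAlgebra A] where
  toOp : A → Op G
  toOp_add : ∀ a b, toOp (a + b) = toOp a + toOp b
  toOp_mul : ∀ a b, toOp (a * b) = toOp a * toOp b
  toOp_star : ∀ a, toOp (star a) = star (toOp a)
  toOp_smul : ∀ (c : ℂ) a, toOp (c • a) = c • toOp a
  norm_toOp : ∀ a, ‖toOp a‖ = ‖a‖
  mem_iff : ∀ T, T ∈ cstarSub G ↔ ∃ a, toOp a = T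
  action : (E → ℝ) → ℝ → A ≃⋆ₐ[ℂ] A
  toOp_action : ∀ F t a, toOp (action F t a) = conjPhase F t (toOp a)

namespace GraphRep

variable {A : Type*} [NonUnitalCStarAlgebra A] (R : GraphRep G A)

lemma toOp_zero : R.toOp 0 = 0 := by
  have := R.toOp_smul 0 0
  simpa using this

lemma toOp_neg (a : A) : R.toOp (-a) = -R.toOp a := by
  have := R.toOp_smul (-1) a
  simpa using this

lemma toOp_sub (a b : A) : R.toOp (a - b) = R.toOp a - R.toOp b := by
  rw [sub_eq_add_neg, R.toOp_add, R.toOp_neg, sub_eq_add_neg]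

lemma toOp_sum {ι : Type*} (s : Finset ι) (f : ι → A) :
    R.toOp (∑ i ∈ s, f i) = ∑ i ∈ s, R.toOp (f i) := by
  classical
  induction s using Finset.induction_on with
  | empty => exact R.toOp_zero
  | insert i s hi ih => rw [Finset.sum_insert hi, Finset.sum_insert hi, R.toOp_add, ih]

lemma isometry : Isometry R.toOp :=
  Isometry.of_dist_eq fun a b => by rw [dist_eq_norm, dist_eq_norm, ← R.toOp_sub, R.norm_toOp]

lemma ext {a b : A} (h : R.toOp a = R.toOp b) : a = b := R.isometry.injective h

lemma toOp_mem (a : A) : R.toOp a ∈ cstarSub G := (R.mem_iff _).2 ⟨a, rfl⟩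

/-- The element corresponding to an operator in `C*(G)`. -/
noncomputable def lift (T : Op G) (hT : T ∈ cstarSub G) : A := ((R.mem_iff T).1 hT).choose

@[simp] lemma toOp_lift (T : Op G) (hT : T ∈ cstarSub G) : R.toOp (R.lift T hT) = T :=
  ((R.mem_iff T).1 hT).choose_spec

/-- The element `S_μS_ν*`. -/
noncomputable def elt (μ ν : FinPath G) : A := R.lift (basicOp μ ν) (basicOp_mem_cstarSub μ ν)

@[simp] lemma toOp_elt (μ ν : FinPath G) : R.toOp (R.elt μ ν) = basicOp μ ν := R.toOp_lift _ _

@[simp] lemma star_elt (μ ν : FinPath G) : star (R.elt μ ν) = R.elt ν μ :=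
  R.ext (by rw [R.toOp_star, toOp_elt, toOp_elt, star_basicOp])

lemma elt_mul_elt {μ ν κ : FinPath G} (h : μ.range = ν.range) (h' : ν.range = κ.range) :
    R.elt μ ν * R.elt ν κ = R.elt μ κ :=
  R.ext (by rw [R.toOp_mul, toOp_elt, toOp_elt, toOp_elt, basicOp_mul_basicOp h h'])

lemma elt_eq_zero {μ ν : FinPath G} (h : μ.range ≠ ν.range) : R.elt μ ν = 0 :=
  R.ext (by rw [toOp_elt, R.toOp_zero, basicOp_eq_zero h])

/-- The projection `S_μS_μ*`. -/
noncomputable def proj (μ : FinPath G) : PosCone A :=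
  ⟨R.elt μ μ, R.elt μ μ, by rw [star_elt, elt_mul_elt R rfl rfl]⟩

/-- The projection `P_v`. -/
noncomputable abbrev vertex (v : V) : PosCone A := R.proj (FinPath.ofVertex G v)

/-- The projection `∑_{v ∈ X} P_v`. -/
noncomputable def fin (X : Finset V) : PosCone A :=
  ⟨R.lift (finProj G X) (finProj_mem X), R.lift (finProj G X) (finProj_mem X), R.ext (by
    rw [R.toOp_mul, R.toOp_star, toOp_lift, star_finProj, finProj_mul_self])⟩

lemma coe_proj (μ : FinPath G) : (R.proj μ).1 = R.elt μ μ := rfl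

@[simp] lemma toOp_fin (X : Finset V) : R.toOp (R.fin X).1 = finProj G X :=
  R.toOp_lift _ (finProj_mem X)

lemma proj_mul_self (μ : FinPath G) : (R.proj μ).1 * (R.proj μ).1 = (R.proj μ).1 :=
  R.elt_mul_elt rfl rfl

lemma fin_mul_self (X : Finset V) : (R.fin X).1 * (R.fin X).1 = (R.fin X).1 :=
  R.ext (by rw [R.toOp_mul, toOp_fin, finProj_mul_self])

lemma vertex_mul_elt (μ ν : FinPath G) : (R.vertex μ.src).1 * R.elt μ ν = R.elt μ ν := by
  classical
  refine R.ext (ContinuousLinearMap.ext fun ξ => lp.ext (funext fun γ => ?_))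
  rw [R.toOp_mul, coe_proj, toOp_elt, toOp_elt]
  change vertexProj μ.src (basicOp μ ν ξ) γ = basicOp μ ν ξ γ
  rw [vertexProj_apply]
  split_ifs with h
  · rfl
  · rw [basicOp_apply_of_notMem]
    exact fun hx => h hx.1

lemma elt_mul_vertex (μ ν : FinPath G) : R.elt μ ν * (R.vertex ν.src).1 = R.elt μ ν := by
  have := congrArg star (R.vertex_mul_elt ν μ)
  rwa [star_mul, coe_proj, star_elt, star_elt] at this

lemma action_elt (F : E → ℝ) (t : ℝ) (μ ν : FinPath G) : R.action F t (R.elt μ ν) =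
    Complex.exp ((t * (μ.weight F - ν.weight F) : ℝ) * Complex.I) • R.elt μ ν := by
  classical
  refine R.ext ?_
  rw [R.toOp_action, R.toOp_smul, toOp_elt]
  refine (isConvOp_conjPhase F t (isConvOp_basicOp μ ν)).unique ?_
  convert (isConvOp_basicOp μ ν).smul
    (Complex.exp ((t * (μ.weight F - ν.weight F) : ℝ) * Complex.I)) using 1
  ext γ
  rw [Set.indicator_apply]
  split_ifs with h
  · obtain ⟨x, h1, h2, rfl⟩ := mem_basicBisection.1 h
    rw [cocycle_mk']
  · simp

lemma action_proj (F : E → ℝ) (t : ℝ) (μ : FinPath G) :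
    R.action F t (R.proj μ).1 = (R.proj μ).1 := by
  rw [coe_proj, action_elt]
  simp

lemma fin_eq_sum (X : Finset V) : (R.fin X).1 = ∑ v ∈ X, (R.vertex v).1 := by
  refine R.ext ?_
  rw [toOp_fin, R.toOp_sum]
  refine Finset.sum_congr rfl fun v _ => ?_
  rw [coe_proj, toOp_elt]
  rfl

lemma action_fin (F : E → ℝ) (t : ℝ) (X : Finset V) :
    R.action F t (R.fin X).1 = (R.fin X).1 := by
  rw [fin_eq_sum, map_sum]
  exact Finset.sum_congr rfl fun v _ => R.action_proj F t _

lemma induction {P : A → Prop} (hb : ∀ μ ν, P (R.elt μ ν))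
    (hadd : ∀ a b, P a → P b → P (a + b)) (hsmul : ∀ (c : ℂ) a, P a → P (c • a)) (h0 : P 0)
    (hc : IsClosed {a | P a}) (a : A) : P a := by
  have key : ∀ T ∈ cstarSub G, ∃ a, R.toOp a = T ∧ P a := by
    intro T hT
    refine cstar_induction (P := fun T => ∃ a, R.toOp a = T ∧ P a)
      (fun μ ν => ⟨_, R.toOp_elt μ ν, hb μ ν⟩) ?_ ?_ ⟨0, R.toOp_zero, h0⟩ ?_ hT
    · rintro _ _ ⟨a, rfl, ha⟩ ⟨b, rfl, hb⟩
      exact ⟨a + b, R.toOp_add a b, hadd _ _ ha hb⟩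
    · rintro c _ ⟨a, rfl, ha⟩
      exact ⟨c • a, R.toOp_smul c a, hsmul c _ ha⟩
    · have h1 : {T | ∃ a, R.toOp a = T ∧ P a} = R.toOp '' {a | P a} :=
        Set.ext fun T => ⟨fun ⟨a, h, ha⟩ => ⟨a, ha, h⟩, fun ⟨a, ha, h⟩ => ⟨a, h, ha⟩⟩
      rw [h1]
      exact R.isometry.isClosedEmbedding.isClosedMap _ hc
  obtain ⟨b, hb, hb'⟩ := key _ (R.toOp_mem a)
  exact R.ext hb ▸ hb'

end GraphRep

/-! ### Averages over the action -/

/-- The averages of `a` over the first `n + 1` powers of an automorphism. -/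
noncomputable def average {A : Type*} [NonUnitalCStarAlgebra A] (α : ℝ → A ≃⋆ₐ[ℂ] A) (h : ℝ)
    (n : ℕ) (a : A) : A :=
  ((n + 1 : ℝ)⁻¹ : ℂ) • ∑ k ∈ Finset.range (n + 1), α (k * h) a

section average

variable {A : Type*} [NonUnitalCStarAlgebra A] {α : ℝ → A ≃⋆ₐ[ℂ] A} {h : ℝ}

lemma average_add (n : ℕ) (a b : A) :
    average α h n (a + b) = average α h n a + average α h n b := by
  simp only [average, map_add, Finset.sum_add_distrib, smul_add]

lemma average_sub (n : ℕ) (a b : A) :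
    average α h n (a - b) = average α h n a - average α h n b := by
  simp only [average, map_sub, Finset.sum_sub_distrib, smul_sub]

lemma average_smul (n : ℕ) (c : ℂ) (a : A) :
    average α h n (c • a) = c • average α h n a := by
  simp only [average, map_smul, ← Finset.smul_sum, smul_smul]
  rw [mul_comm]

lemma norm_average_le (n : ℕ) (a : A) : ‖average α h n a‖ ≤ ‖a‖ := by
  have h1 : ‖∑ k ∈ Finset.range (n + 1), α (k * h) a‖ ≤ (n + 1 : ℝ) * ‖a‖ := by
    refine (norm_sum_le _ _).trans_eq ?_
    simp only [StarAlgEquiv.norm_map]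
    simp
  have h2 : (0 : ℝ) < n + 1 := by positivity
  rw [average, norm_smul, norm_inv]
  have h3 : ‖((n + 1 : ℝ) : ℂ)‖ = (n + 1 : ℝ) := by
    rw [Complex.norm_real, Real.norm_of_nonneg h2.le]
  push_cast at h3 ⊢
  rw [h3, inv_mul_le_iff₀ h2]
  exact h1

lemma average_of_fixed (n : ℕ) {a : A} (ha : ∀ t, α t a = a) : average α h n a = a := by
  have h2 : (n + 1 : ℂ) ≠ 0 := by exact_mod_cast Nat.succ_ne_zero n
  simp only [average, ha, Finset.sum_const, Finset.card_range]
  rw [← Nat.cast_smul_eq_nsmul ℂ, smul_smul]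
  push_cast
  rw [inv_mul_cancel₀ h2, one_smul]

/-- On an eigenvector the sum is geometric with ratio e^{ihc} ≠ 1, hence bounded, and it is divided
by n + 1. -/
lemma tendsto_average_eigen {a : A} {c : ℝ}
    (ha : ∀ t, α t a = Complex.exp ((t * c : ℝ) * Complex.I) • a)
    (hc : Complex.exp ((h * c : ℝ) * Complex.I) ≠ 1) :
    Tendsto (fun n => average α h n a) atTop (𝓝 0) := by
  set z := Complex.exp ((h * c : ℝ) * Complex.I) with hz
  have hzn : ‖z‖ = 1 := Complex.norm_exp_ofReal_mul_I _
  have h1 : ∀ n, average α h n a = (((n + 1 : ℝ)⁻¹ : ℂ) * ((z ^ (n + 1) - 1) / (z - 1))) • a := by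
    intro n
    rw [← geom_sum_eq hc, ← smul_smul, Finset.sum_smul, average]
    congr 1
    refine Finset.sum_congr rfl fun k _ => ?_
    rw [ha, hz, ← Complex.exp_nat_mul]
    congr 2
    push_cast
    ring
  have hz1 : 0 < ‖z - 1‖ := norm_pos_iff.2 (sub_ne_zero.2 hc)
  refine squeeze_zero_norm (a := fun n : ℕ => (1 / ((n : ℝ) + 1)) * (2 / ‖z - 1‖ * ‖a‖)) ?_ ?_
  · intro n
    rw [h1, norm_smul, norm_mul, norm_div, norm_inv]
    have h3 : ‖((n + 1 : ℝ) : ℂ)‖ = (n + 1 : ℝ) := by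
      rw [Complex.norm_real, Real.norm_of_nonneg (by positivity)]
    push_cast at h3 ⊢
    rw [h3, mul_assoc, one_div]
    gcongr
    refine (norm_sub_le _ _).trans ?_
    rw [norm_pow, hzn]
    norm_num
  · have := (tendsto_one_div_add_atTop_nhds_zero_nat (𝕜 := ℝ)).mul_const (2 / ‖z - 1‖ * ‖a‖)
    rwa [zero_mul] at this

lemma Weight.apply_average {φ : Weight A} (hφ : φ.IsInvariant α) (n : ℕ) (a : PosCone A) :
    ∃ b : PosCone A, (b : A) = average α h n a ∧ φ b = φ a := by
  have key : ∀ n : ℕ, ∃ s : PosCone A, (s : A) = ∑ k ∈ Finset.range n, α (k * h) (a : A) ∧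
      φ s = n * φ a := by
    intro n
    induction n with
    | zero => exact ⟨posOf 0 le_rfl, by simp, by rw [φ.map_zero_eq rfl]; simp⟩
    | succ n ih =>
      obtain ⟨s, hs, hs'⟩ := ih
      obtain ⟨c, hc⟩ := a.2
      let r : PosCone A := starMulSelf (α (n * h) c)
      have hr : (r : A) = α (n * h) a := by
        rw [coe_starMulSelf, hc, map_mul, map_star]
      refine ⟨posOf _ (add_nonneg s.nonneg r.nonneg), ?_, ?_⟩
      · rw [coe_posOf, Finset.sum_range_succ, hs, hr]
      · rw [Weight.map_add_eq, hs', hφ _ a r hr]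
        push_cast
        ring
  obtain ⟨s, hs, hs'⟩ := key (n + 1)
  have h0 : (0 : ℝ) ≤ (n + 1 : ℝ)⁻¹ := by positivity
  have h1 : average α h n (a : A) = (((n + 1 : ℝ)⁻¹ : ℝ) : ℂ) • (s : A) := by
    rw [hs, average]
    push_cast
    rfl
  refine ⟨posOf (average α h n (a : A)) ?_, rfl, ?_⟩
  · rw [h1, Complex.coe_smul]
    exact smul_nonneg h0 s.nonneg
  · rw [φ.map_smul' (NNReal.mk _ h0) s _ h1, hs', ← mul_assoc]
    have : ((NNReal.mk _ h0 : ℝ≥0) : ℝ≥0∞) * ((n + 1 : ℕ) : ℝ≥0∞) = 1 := by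
      rw [← ENNReal.coe_natCast, ← ENNReal.coe_mul, ← ENNReal.coe_one]
      congr 1
      apply NNReal.eq
      push_cast
      exact inv_mul_cancel₀ (by positivity)
    rw [this, one_mul]

/-- A fixed projection has finite weight when the averages of all elements converge to fixed
elements. -/
lemma Weight.IsKMS.lt_top_of_average {φ : Weight A} {β : ℝ} (hφ : φ.IsKMS α β)
    (hav : ∀ a : A, ∃ L, Tendsto (fun n => average α h n a) atTop (𝓝 L) ∧ ∀ t, α t L = L)
    {p : PosCone A} (hpp : (p : A) * p = p) (hp : ∀ t, α t p = p) : φ p < ∞ := by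
  refine hφ.lt_top_of_mem_closure hpp hp (Metric.mem_closure_iff.2 fun ε hε => ?_)
  have hcont : Continuous fun a : PosCone A => dist (a : A) (p : A) :=
    (continuous_subtype_val (p := fun a : A => ∃ b : A, a = star b * b)).dist continuous_const
  obtain ⟨a, ha, hpa⟩ := hφ.1.2.1.inter_open_nonempty _
    (isOpen_lt hcont (continuous_const (y := ε / 2)))
    ⟨p, by rw [Set.mem_ofPred_eq, dist_self]; exact half_pos hε⟩
  obtain ⟨L, hL, hLfix⟩ := hav a
  -- By invariance the averages of a have the weight of a, so lower semicontinuity makes φ(L)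
  -- finite. Averaging is contractive and leaves p unchanged, so L is at least as close to p as the
  -- bound on a allows.
  choose b hb hb' using fun n => Weight.apply_average (h := h) hφ.2.1 n a
  have hL' : Tendsto (fun n => (b n : A)) atTop (𝓝 L) := by simpa only [hb] using hL
  have hL0 : 0 ≤ L := ge_of_tendsto' hL' fun n => (b n).nonneg
  refine ⟨L, ⟨posOf L hL0, rfl, ?_, hLfix⟩, ?_⟩
  · refine (Weight.le_of_tendsto hφ.1.2.2 (a := posOf L hL0) hL' (C := φ a)
      (Eventually.of_forall fun n => (hb' n).le)).trans_lt ?_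
    exact hpa
  · have h1 : ‖(p : A) - L‖ ≤ ε / 2 := by
      refine _root_.le_of_tendsto ((tendsto_const_nhds (x := (p : A))).sub hL).norm
        (Eventually.of_forall fun n => ?_)
      have h2 : (p : A) - average α h n (a : A) = average α h n ((p : A) - a) := by
        rw [average_sub, average_of_fixed n hp]
      rw [h2]
      refine (norm_average_le n _).trans ?_
      rw [← dist_eq_norm, dist_comm]
      exact ha.le
    rw [dist_eq_norm]
    linarith

end average

/-- For each c ≠ 0 only the countably many multiples of 2π/c are excluded. -/
lemma exists_generic {C : Set ℝ} (hC : C.Countable) :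
    ∃ h : ℝ, ∀ c ∈ C, c ≠ 0 → Complex.exp ((h * c : ℝ) * Complex.I) ≠ 1 := by
  have h1 : (⋃ c ∈ C, Set.range fun n : ℤ => n * (2 * Real.pi) / c).Countable :=
    hC.biUnion fun c _ => Set.countable_range _
  obtain ⟨h, hh⟩ := (h1.dense_compl ℝ).nonempty
  refine ⟨h, fun c hc hc0 he => hh ?_⟩
  obtain ⟨n, hn⟩ := Complex.exp_eq_one_iff.1 he
  refine Set.mem_iUnion₂.2 ⟨c, hc, n, ?_⟩
  have h2 : ((h * c : ℝ) : ℂ) = ((n * (2 * Real.pi) : ℝ) : ℂ) := by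
    have := Complex.I_ne_zero
    push_cast at hn ⊢
    apply mul_right_cancel₀ this
    rw [hn]
    ring
  have h3 : h * c = n * (2 * Real.pi) := by exact_mod_cast h2
  change n * (2 * Real.pi) / c = h
  rw [← h3, mul_div_assoc, div_self hc0, mul_one]

/-- The action multiplies S_μS_ν* by e^{itc} with c from a countable set. For h without resonance
with any c ≠ 0 the averages of S_μS_ν* tend to zero unless c = 0, so the limits are fixed at all
times t although only multiples of h are used. Contractivity extends this to the whole algebra. -/
lemma GraphRep.exists_average_limit [Countable V] [Countable E] {A : Type*}
    [NonUnitalCStarAlgebra A] (R : GraphRep G A) (F : E → ℝ) :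
    ∃ h : ℝ, ∀ a : A, ∃ L, Tendsto (fun n => average (R.action F) h n a) atTop (𝓝 L) ∧
      ∀ t, R.action F t L = L := by
  obtain ⟨h, hh⟩ := exists_generic (Set.countable_range
    fun p : FinPath G × FinPath G => p.1.weight F - p.2.weight F)
  refine ⟨h, R.induction ?_ ?_ ?_ ?_ ?_⟩
  · intro μ ν
    by_cases hc : μ.weight F - ν.weight F = 0
    · have hfix : ∀ t, R.action F t (R.elt μ ν) = R.elt μ ν := fun t => by
        rw [R.action_elt, hc]
        simp
      exact ⟨R.elt μ ν, by simp only [average_of_fixed _ hfix, tendsto_const_nhds], hfix⟩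
    · exact ⟨0, tendsto_average_eigen (fun t => R.action_elt F t μ ν)
        (hh _ ⟨(μ, ν), rfl⟩ hc), fun t => map_zero _⟩
  · rintro S T ⟨L, hL, hL'⟩ ⟨M, hM, hM'⟩
    exact ⟨L + M, by simpa only [average_add] using hL.add hM, fun t => by rw [map_add, hL', hM']⟩
  · rintro c T ⟨L, hL, hL'⟩
    exact ⟨c • L, by simpa only [average_smul] using hL.const_smul c,
      fun t => by rw [map_smul, hL']⟩
  · exact ⟨0, by simp [average], fun t => map_zero _⟩
  · refine IsSeqClosed.isClosed fun Tn T hTn hT => ?_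
    choose L hL hL' using hTn
    -- The averages are contractions, uniformly in n, so the Cauchy property passes from the
    -- approximants to the limit.
    have hcauchy : CauchySeq fun n => average (R.action F) h n T := by
      rw [Metric.cauchySeq_iff']
      intro ε hε
      obtain ⟨k, hk⟩ := (Metric.tendsto_nhds.1 hT (ε / 4) (by positivity)).exists
      obtain ⟨N, hN⟩ := Metric.cauchySeq_iff'.1 (hL k).cauchySeq (ε / 4) (by positivity)
      refine ⟨N, fun n hn => ?_⟩
      have h1 : ∀ n, dist (average (R.action F) h n T) (average (R.action F) h n (Tn k)) ≤
          ε / 4 := fun n => by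
        rw [dist_eq_norm, ← average_sub]
        refine (norm_average_le n _).trans ?_
        rw [← dist_eq_norm, dist_comm]
        exact hk.le
      calc dist (average (R.action F) h n T) (average (R.action F) h N T)
          ≤ _ := dist_triangle4 _ (average (R.action F) h n (Tn k))
            (average (R.action F) h N (Tn k)) _
        _ < ε := by
          have h2 := h1 n
          have h3 := h1 N
          rw [dist_comm] at h3
          have h4 := hN n hn
          linarith
    obtain ⟨M, hM⟩ := cauchySeq_tendsto_of_complete hcauchy
    have hLM : Tendsto L atTop (𝓝 M) := by
      rw [Metric.tendsto_nhds]
      intro ε hε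
      filter_upwards [Metric.tendsto_nhds.1 hT (ε / 2) (half_pos hε)] with k hk
      refine lt_of_le_of_lt (le_of_tendsto ((hL k).dist hM) (Eventually.of_forall fun n => ?_))
        (half_lt_self hε)
      rw [dist_eq_norm, ← average_sub]
      refine (norm_average_le n _).trans ?_
      rw [← dist_eq_norm]
      exact hk.le
    refine ⟨M, hM, fun t => ?_⟩
    have h1 : Tendsto (fun k => R.action F t (L k)) atTop (𝓝 (R.action F t M)) :=
      ((StarAlgEquiv.isometry (R.action F t)).continuous.tendsto M).comp hLM
    simp only [hL'] at h1
    exact tendsto_nhds_unique h1 hLM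

end GaugeWeights

end GraphKMS

namespace GraphKMS

/-! ### Gauge invariant KMS weights are determined by the values φ(P_v). -/

section GaugeInvariantKMS

open Filter

variable {V E : Type*} {G : EGraph V E}

attribute [local instance] CStarAlgebra.spectralOrder CStarAlgebra.spectralOrderedRing

lemma Weight.map_sum_eq {A : Type*} [NonUnitalCStarAlgebra A] (φ : Weight A) {ι : Type*}
    (s : Finset ι) (f : ι → PosCone A) {a : PosCone A} (h : (a : A) = ∑ i ∈ s, (f i).1) :
    φ a = ∑ i ∈ s, φ (f i) := by
  classical
  induction s using Finset.induction_on generalizing a with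
  | empty => exact φ.map_zero_eq (by simpa using h)
  | insert i s hi ih =>
    rw [Finset.sum_insert hi] at h ⊢
    have h0 : 0 ≤ ∑ i ∈ s, (f i).1 := Finset.sum_nonneg fun i _ => (f i).nonneg
    rw [← ih (a := posOf _ h0) rfl]
    exact φ.map_add' _ _ _ h

namespace GraphRep

variable {A : Type*} [NonUnitalCStarAlgebra A] (R : GraphRep G A) {F : E → ℝ} {β : ℝ}
  {φ ψ : Weight A}

/-- Gauge invariant `β`-KMS weights for `α^F`. -/
def IsGaugeKMS (F : E → ℝ) (β : ℝ) (φ : Weight A) : Prop :=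
  φ.IsKMS (R.action F) β ∧ φ.IsInvariant (R.action fun _ => 1)

lemma apply_proj_lt_top [Countable V] [Countable E] (hφ : φ.IsKMS (R.action F) β)
    (μ : FinPath G) : φ (R.proj μ) < ∞ := by
  obtain ⟨h, hh⟩ := R.exists_average_limit F
  exact hφ.lt_top_of_average hh (R.proj_mul_self μ) fun t => R.action_proj F t μ

lemma apply_fin (X : Finset V) : φ (R.fin X) = ∑ v ∈ X, φ (R.vertex v) :=
  φ.map_sum_eq X _ (R.fin_eq_sum X)

lemma elt_mem_biDomain (h : ∀ v, φ (R.vertex v) < ∞) (μ ν : FinPath G) :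
    R.elt μ ν ∈ φ.biDomain := by
  have key : ∀ μ ν : FinPath G, φ (starMulSelf (R.elt μ ν)) < ∞ := fun μ ν => by
    rw [← R.elt_mul_vertex]
    exact Weight.starMulSelf_mul_lt_top (Weight.sq_mem (h _)) _
  exact ⟨key μ ν, by rw [star_elt]; exact key ν μ⟩

lemma exists_hasValue_elt (h : ∀ v, φ (R.vertex v) < ∞) (μ ν : FinPath G) :
    ∃ z, φ.HasValue (R.elt μ ν) z := by
  rw [← R.vertex_mul_elt]
  exact Weight.exists_hasValue_mul (R.elt_mem_biDomain h _ _) (R.elt_mem_biDomain h μ ν)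

lemma action_one_elt (t : ℝ) (μ ν : FinPath G) : R.action (fun _ => 1) t (R.elt μ ν) =
    Complex.exp ((t * (μ.length - ν.length) : ℝ) * Complex.I) • R.elt μ ν := by
  rw [action_elt]
  simp [FinPath.weight, FinPath.length]

/-- The partial isometry b = S_μ, realized as the element of the pair (μ, r(μ)), is an eigenvector
with c = F(μ), and bb* = S_μS_μ*, b*b = P_{r(μ)}. -/
lemma apply_proj (hφ : φ.IsKMS (R.action F) β) (h : ∀ v, φ (R.vertex v) < ∞) (μ : FinPath G) :
    φ (R.proj μ) = pathFactor F β μ * φ (R.vertex μ.range) := by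
  have h1 := hφ.apply_starMulSelf (R.elt_mem_biDomain h μ (FinPath.ofVertex G μ.range))
    (c := μ.weight F) fun t => by
      rw [action_elt]
      simp [FinPath.weight, FinPath.ofVertex]
  have h2 : φ (starMulSelf (star (R.elt μ (FinPath.ofVertex G μ.range)))) = φ (R.proj μ) :=
    φ.congr (by rw [coe_starMulSelf, star_star, star_elt]; exact R.elt_mul_elt rfl rfl)
  have h3 : φ (starMulSelf (R.elt μ (FinPath.ofVertex G μ.range))) = φ (R.vertex μ.range) :=
    φ.congr (by rw [coe_starMulSelf, star_elt]; exact R.elt_mul_elt rfl rfl)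
  rw [h2, h3] at h1
  rw [h1, pathFactor, neg_mul]

/-- For paths of equal length Z(μ) and Z(ν) are disjoint, and moving the fixed projection S_μS_μ*
from the left of S_μS_ν* to the right gives zero. For different lengths gauge invariance alone
forces the value zero. -/
lemma hasValue_elt_of_ne (hφ : R.IsGaugeKMS F β φ) (h : ∀ v, φ (R.vertex v) < ∞)
    {μ ν : FinPath G} (hμν : μ ≠ ν) : φ.HasValue (R.elt μ ν) 0 := by
  obtain ⟨z, hz⟩ := R.exists_hasValue_elt h μ ν
  convert hz
  by_cases hl : μ.length = ν.length
  · have hd : Disjoint (cylinder ν) (cylinder μ) := Set.disjoint_left.2 fun x hx hx' =>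
      hμν (eq_of_mem_cylinder hx' hx hl)
    refine (hφ.1.fixed (R.elt_mem_biDomain h μ ν) (R.elt_mem_biDomain h μ μ)
      (fun t => R.action_proj F t μ) ?_ ?_).symm
    · have h0 : R.elt μ ν * R.elt μ μ = 0 := R.ext (by
        rw [R.toOp_mul, toOp_elt, toOp_elt, R.toOp_zero, basicOp_mul_basicOp_of_disjoint hd])
      rw [h0]
      exact Weight.hasValue_zero
    · by_cases hr : μ.range = ν.range
      · rwa [R.elt_mul_elt rfl hr]
      · rw [R.elt_eq_zero hr] at hz ⊢
        rwa [mul_zero]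
  · have h0 : (μ.length : ℝ) - ν.length ≠ 0 := sub_ne_zero.2 (by exact_mod_cast hl)
    -- At this time the gauge action multiplies S_μS_ν* by e^{iπ} = -1.
    have h1 := hz.map hφ.2 (Real.pi / (μ.length - ν.length))
    rw [action_one_elt, div_mul_cancel₀ _ h0, Complex.exp_pi_mul_I] at h1
    have h2 := h1.unique (hz.smul (-1))
    linear_combination (-(1 / 2 : ℂ)) * h2

lemma exists_common_value [Countable V] [Countable E] (hφ : R.IsGaugeKMS F β φ)
    (hψ : R.IsGaugeKMS F β ψ) (h : ∀ v, φ (R.vertex v) = ψ (R.vertex v)) {T : Op G}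
    (hT : T ∈ coreSpan G) : ∃ a z, R.toOp a = T ∧ φ.HasValue a z ∧ ψ.HasValue a z := by
  have hφf : ∀ v, φ (R.vertex v) < ∞ := fun v => R.apply_proj_lt_top hφ.1 _
  have hψf : ∀ v, ψ (R.vertex v) < ∞ := fun v => R.apply_proj_lt_top hψ.1 _
  induction hT using Submodule.span_induction with
  | mem T hT =>
    obtain ⟨⟨μ, ν⟩, rfl⟩ := hT
    by_cases hμν : μ = ν
    · subst hμν
      refine ⟨R.elt μ μ, _, R.toOp_elt _ _, Weight.hasValue_coe (R.apply_proj_lt_top hφ.1 μ), ?_⟩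
      have h1 := Weight.hasValue_coe (R.apply_proj_lt_top hψ.1 μ)
      rwa [R.apply_proj hψ.1 hψf, ← h, ← R.apply_proj hφ.1 hφf] at h1
    · exact ⟨_, 0, R.toOp_elt μ ν, R.hasValue_elt_of_ne hφ hφf hμν,
        R.hasValue_elt_of_ne hψ hψf hμν⟩
  | zero => exact ⟨0, 0, R.toOp_zero, Weight.hasValue_zero, Weight.hasValue_zero⟩
  | add S T _ _ hS hT =>
    obtain ⟨a, z, rfl, ha, ha'⟩ := hS
    obtain ⟨b, w, rfl, hb, hb'⟩ := hT
    exact ⟨_, _, R.toOp_add a b, ha.add hb, ha'.add hb'⟩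
  | smul c T _ hT =>
    obtain ⟨a, z, rfl, ha, ha'⟩ := hT
    exact ⟨_, _, R.toOp_smul c a, ha.smul c, ha'.smul c⟩

lemma finProj_mem_coreSpan (X : Finset V) : finProj G X ∈ coreSpan G :=
  sum_mem fun _ _ => basicOp_mem _ _

lemma apply_le_of_fin (X : Finset V) {q : PosCone A}
    (hq : (R.fin X).1 * q.1 * (R.fin X).1 = q.1) :
    φ q ≤ ENNReal.ofReal ‖q.1‖ * φ (R.fin X) := by
  refine φ.map_smul_le (norm_nonneg _) ?_
  have := CStarAlgebra.star_left_conjugate_le_norm_smul (a := (R.fin X).1) (b := q.1)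
    q.isSelfAdjoint
  rwa [(R.fin X).isSelfAdjoint.star_eq, fin_mul_self, hq] at this

/-- On the corner of P_X both weights are norm bounded by `Weight.HasValue.norm_le`, and they agree
on the compressed span of the S_μS_ν*, which is dense in the corner. -/
lemma eq_on_corner [Countable V] [Countable E] (hφ : R.IsGaugeKMS F β φ)
    (hψ : R.IsGaugeKMS F β ψ) (h : ∀ v, φ (R.vertex v) = ψ (R.vertex v)) {X : Finset V}
    {q : PosCone A} (hq : (R.fin X).1 * q.1 * (R.fin X).1 = q.1) : φ q = ψ q := by
  have hfin : ∀ {χ : Weight A}, R.IsGaugeKMS F β χ → ∀ X, χ (R.fin X) < ∞ := fun hχ X => by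
    rw [apply_fin]
    exact ENNReal.sum_lt_top.2 fun v _ => R.apply_proj_lt_top hχ.1 _
  have hqf : ∀ {χ : Weight A}, R.IsGaugeKMS F β χ → χ q < ∞ := fun hχ =>
    (R.apply_le_of_fin X hq).trans_lt
      (ENNReal.mul_lt_top ENNReal.ofReal_lt_top (hfin hχ X))
  obtain ⟨T, hT, hTq⟩ := mem_closure_iff_seq_limit.1 (mem_cstarSub_iff.1 (R.toOp_mem q.1))
  choose b z hb hbφ hbψ using fun n => R.exists_common_value hφ hψ h
    (mul_mem_coreSpan (mul_mem_coreSpan (finProj_mem_coreSpan X) (hT n)) (finProj_mem_coreSpan X))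
  have hbq : Tendsto b atTop (𝓝 q.1) := by
    rw [R.isometry.isEmbedding.tendsto_nhds_iff]
    have h1 := (hTq.const_mul (finProj G X)).mul_const (finProj G X)
    have h2 : finProj G X * R.toOp q.1 * finProj G X = R.toOp q.1 := by
      rw [← R.toOp_fin, ← R.toOp_mul, ← R.toOp_mul, hq]
    rw [h2] at h1
    exact h1.congr fun n => (hb n).symm
  have hbc : ∀ n, (R.fin X).1 * b n * (R.fin X).1 = b n := fun n => R.ext (by
    rw [R.toOp_mul, R.toOp_mul, hb, toOp_fin]
    simp only [mul_assoc, finProj_mul_self]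
    simp only [← mul_assoc, finProj_mul_self])
  have key : ∀ {χ : Weight A}, R.IsGaugeKMS F β χ → (∀ n, χ.HasValue (b n) (z n)) →
      Tendsto z atTop (𝓝 ((χ q).toReal : ℂ)) := by
    intro χ hχ hv
    have h1 : Tendsto (fun n => ((χ q).toReal : ℂ) - z n) atTop (𝓝 0) := by
      refine squeeze_zero_norm (a := fun n => 2 * ‖q.1 - b n‖ * (χ (R.fin X)).toReal)
        (fun n => ?_) ?_
      · refine Weight.HasValue.norm_le (R.fin X).isSelfAdjoint (R.fin_mul_self X) rfl (hfin hχ X)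
          ?_ ((Weight.hasValue_coe (hqf hχ)).sub (hv n))
        rw [mul_sub, sub_mul, hq, hbc]
      · have := ((tendsto_const_nhds (x := q.1)).sub hbq).norm
        rw [sub_self, norm_zero] at this
        simpa using (this.const_mul 2).mul_const (χ (R.fin X)).toReal
    have h2 := (tendsto_const_nhds (x := ((χ q).toReal : ℂ))).sub h1
    simpa using h2
  have := tendsto_nhds_unique (key hφ hbφ) (key hψ hbψ)
  rw [Complex.ofReal_inj] at this
  exact (ENNReal.toReal_eq_toReal_iff' (hqf hφ).ne (hqf hψ).ne).1 this

/-- The compression of a positive element by `∑_{v ∈ X} P_v`. -/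
noncomputable def compress (X : Finset V) (a : PosCone A) : PosCone A :=
  posOf ((R.fin X).1 * a.1 * (R.fin X).1) (by
    have := star_left_conjugate_nonneg a.nonneg (R.fin X).1
    rwa [(R.fin X).isSelfAdjoint.star_eq] at this)

lemma coe_compress (X : Finset V) (a : PosCone A) :
    (R.compress X a).1 = (R.fin X).1 * a.1 * (R.fin X).1 := rfl

lemma compress_corner (X : Finset V) (a : PosCone A) :
    (R.fin X).1 * (R.compress X a).1 * (R.fin X).1 = (R.compress X a).1 := by
  rw [coe_compress]
  simp only [mul_assoc, fin_mul_self]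
  simp only [← mul_assoc, fin_mul_self]

lemma tendsto_compress (a : PosCone A) :
    Tendsto (fun X => (R.compress X a).1) atTop (𝓝 a.1) := by
  rw [R.isometry.isEmbedding.tendsto_nhds_iff]
  refine (tendsto_finProj_conj (R.toOp_mem a.1)).congr fun X => ?_
  rw [Function.comp_apply, coe_compress, R.toOp_mul, R.toOp_mul, toOp_fin]

/-- Lower semicontinuity of φ bounds φ(a) through the values φ(P_XaP_X) = ψ(P_XaP_X), and these are
at most ψ(a) because compression does not increase ψ. -/
lemma le_of_vertex_eq [Countable V] [Countable E] (hφ : R.IsGaugeKMS F β φ)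
    (hψ : R.IsGaugeKMS F β ψ) (h : ∀ v, φ (R.vertex v) = ψ (R.vertex v)) (a : PosCone A) :
    φ a ≤ ψ a := by
  classical
  refine Weight.le_of_tendsto hφ.1.1.2.2 (R.tendsto_compress a) (Eventually.of_forall fun X => ?_)
  rw [R.eq_on_corner hφ hψ h (R.compress_corner X a)]
  refine hψ.1.compress_le (R.fin_mul_self X) (fun t => R.action_fin F t X) ?_ rfl
  rw [apply_fin]
  exact ENNReal.sum_lt_top.2 fun v _ => R.apply_proj_lt_top hψ.1 _

/-- Gauge invariant KMS weights are determined by their values at the projections `P_v`. -/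
lemma eq_of_vertex_eq [Countable V] [Countable E] (hφ : R.IsGaugeKMS F β φ)
    (hψ : R.IsGaugeKMS F β ψ) (h : ∀ v, φ (R.vertex v) = ψ (R.vertex v)) : φ = ψ :=
  Weight.ext (funext fun a => le_antisymm (R.le_of_vertex_eq hφ hψ h a)
    (R.le_of_vertex_eq hψ hφ (fun v => (h v).symm) a))

/-- If φ vanished on all P_v, it would vanish on all corners and so, by lower semicontinuity,
everywhere. -/
lemma vertex_ne_zero [Countable V] [Countable E] (hφ : φ.IsKMS (R.action F) β) :
    (fun v => φ (R.vertex v)) ≠ 0 := by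
  classical
  intro h
  obtain ⟨a, ha⟩ := hφ.1.1
  have hX : ∀ X, φ (R.fin X) = 0 := fun X => by
    rw [apply_fin]
    exact Finset.sum_eq_zero fun v _ => congrFun h v
  refine ha (le_zero_iff.1 (Weight.le_of_tendsto hφ.1.2.2 (R.tendsto_compress a)
    (Eventually.of_forall fun X => ?_)))
  refine (R.apply_le_of_fin X (R.compress_corner X a)).trans ?_
  rw [hX, mul_zero]

/-! ### Almost harmonicity of the vector (φ(P_v)). -/

open Classical in
lemma toOp_sum_snoc_apply (v : V) (s : Finset {e : E // G.s e = v}) (ξ : HilbertG G) (γ : Gpd G) :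
    R.toOp (∑ e ∈ s, (R.proj ((FinPath.ofVertex G v).snoc e.1 e.2)).1) ξ γ =
      if ∃ e ∈ s, γ.rng ∈ cylinder ((FinPath.ofVertex G v).snoc e.1 e.2) then ξ γ else 0 := by
  have h1 : R.toOp (∑ e ∈ s, (R.proj ((FinPath.ofVertex G v).snoc e.1 e.2)).1) ξ γ =
      ∑ e ∈ s, if γ.rng ∈ cylinder ((FinPath.ofVertex G v).snoc e.1 e.2) then ξ γ else 0 := by
    rw [R.toOp_sum, ← coord_apply, sum_apply, map_sum]
    refine Finset.sum_congr rfl fun e _ => ?_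
    rw [coord_apply, coe_proj, toOp_elt, basicOp_self_apply]
  rw [h1]
  split_ifs with h
  · obtain ⟨e, he, hγ⟩ := h
    rw [Finset.sum_eq_single e, if_pos hγ]
    · intro e' _ hne
      rw [if_neg]
      exact fun h' => Set.disjoint_left.1
        (disjoint_cylinder_snoc (FinPath.ofVertex G v) (i := e') (j := e) hne) h' hγ
    · exact fun h' => absurd he h'
  · exact Finset.sum_eq_zero fun e he => if_neg fun h' => h ⟨e, he, h'⟩

/-- The difference D is multiplication by the indicator of the γ whose range lies in Z(v) but in
none of the Z(e), e ∈ s. It is a projection, so D = D*D. -/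
lemma sum_snoc_le (v : V) (s : Finset {e : E // G.s e = v}) :
    ∑ e ∈ s, (R.proj ((FinPath.ofVertex G v).snoc e.1 e.2)).1 ≤ (R.vertex v).1 := by
  classical
  set D := (R.vertex v).1 - ∑ e ∈ s, (R.proj ((FinPath.ofVertex G v).snoc e.1 e.2)).1 with hD
  have hDs : star D = D := by
    rw [hD, star_sub, star_sum, (R.vertex v).isSelfAdjoint.star_eq]
    simp only [(R.proj _).isSelfAdjoint.star_eq]
  have hDa : ∀ (ξ : HilbertG G) (γ : Gpd G), R.toOp D ξ γ =
      if γ.rng ∈ cylinder (FinPath.ofVertex G v) ∧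
        ¬ ∃ e ∈ s, γ.rng ∈ cylinder ((FinPath.ofVertex G v).snoc e.1 e.2) then ξ γ else 0 := by
    intro ξ γ
    have h1 : R.toOp D ξ γ = R.toOp (R.vertex v).1 ξ γ -
        R.toOp (∑ e ∈ s, (R.proj ((FinPath.ofVertex G v).snoc e.1 e.2)).1) ξ γ := by
      rw [hD, R.toOp_sub]; rfl
    rw [h1, toOp_sum_snoc_apply, coe_proj, toOp_elt, basicOp_self_apply]
    by_cases h2 : ∃ e ∈ s, γ.rng ∈ cylinder ((FinPath.ofVertex G v).snoc e.1 e.2)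
    · have h3 : γ.rng ∈ cylinder (FinPath.ofVertex G v) := by
        obtain ⟨e, -, he⟩ := h2
        exact cylinder_snoc_subset _ _ _ he
      simp [h2, h3]
    · simp [h2]
  have hDD : D = star D * D := by
    rw [hDs]
    refine R.ext (ContinuousLinearMap.ext fun ξ => lp.ext (funext fun γ => ?_))
    rw [R.toOp_mul, mul_apply_eq_comp, hDa, hDa, hDa]
    split_ifs <;> rfl
  rw [← sub_nonneg, ← hD, hDD]
  exact star_mul_self_nonneg D

/-- Since φ(S_eS_e*) = e^{-βF(e)} φ(P_{r(e)}), the inequality Σ S_eS_e* ≤ P_v over finite sets of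
edges becomes the one for the vector. When v ∉ V_∞ all edges leaving v can be taken, and the
projections add up to P_v. -/
lemma isAlmostHarmonic [Countable V] [Countable E] (hφ : φ.IsKMS (R.action F) β) :
    IsAlmostHarmonic G F β fun v => φ (R.vertex v) := by
  classical
  have hf : ∀ v, φ (R.vertex v) < ∞ := fun v => R.apply_proj_lt_top hφ _
  have key : ∀ v, ∑' w, weightMatrix G F β v w * φ (R.vertex w) =
      ∑' e : {e : E // G.s e = v}, φ (R.proj ((FinPath.ofVertex G v).snoc e.1 e.2)) := by
    intro v
    rw [tsum_weightMatrix]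
    refine tsum_congr fun e => ?_
    have he : G.s e.1 = (FinPath.ofVertex G v).range := e.2
    have h1 : φ (R.proj ((FinPath.ofVertex G v).snoc e.1 he)) =
        ENNReal.ofReal (Real.exp (-β * F e.1)) * φ (R.vertex (G.r e.1)) := by
      rw [R.apply_proj hφ hf, FinPath.range_snoc, pathFactor, FinPath.weight_snoc,
        FinPath.weight_ofVertex, zero_add]
    exact h1.symm
  have hsum : ∀ v (s : Finset {e : E // G.s e = v}),
      ∑ e ∈ s, φ (R.proj ((FinPath.ofVertex G v).snoc e.1 e.2)) =
        φ (posOf (∑ e ∈ s, (R.proj ((FinPath.ofVertex G v).snoc e.1 e.2)).1)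
          (Finset.sum_nonneg fun e _ => (R.proj _).nonneg)) := fun v s =>
    (φ.map_sum_eq s _ rfl).symm
  refine ⟨fun v => (hf v).ne, fun v => ?_, fun v hv => ?_⟩
  · rw [key, ENNReal.tsum_eq_iSup_sum]
    refine iSup_le fun s => ?_
    rw [hsum]
    exact φ.mono (R.sum_snoc_le v s)
  · have hfin : Finite {e : E // G.s e = v} := by
      simp only [EGraph.singular, Set.mem_ofPred_eq, not_or, Set.not_infinite] at hv
      exact hv.2
    have := Fintype.ofFinite {e : E // G.s e = v}
    rw [key, tsum_fintype, hsum]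
    refine φ.congr (R.ext (ContinuousLinearMap.ext fun ξ => lp.ext (funext fun γ => ?_)))
    rw [coe_posOf, toOp_sum_snoc_apply, coe_proj, toOp_elt, basicOp_self_apply]
    have h1 := cylinder_eq_iUnion_of_notMem (μ := FinPath.ofVertex G v) hv
    have h2 : γ.rng ∈ cylinder (FinPath.ofVertex G v) ↔ ∃ e ∈ (Finset.univ : Finset
        {e : E // G.s e = v}), γ.rng ∈ cylinder ((FinPath.ofVertex G v).snoc e.1 e.2) := by
      rw [h1, Set.mem_iUnion]
      simp only [Finset.mem_univ, true_and]
      rfl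
    simp only [h2]

end GraphRep

end GaugeInvariantKMS

end GraphKMS

namespace GraphKMS

section GroupoidMeasure

open MeasureTheory

variable {V E : Type*} {G : EGraph V E}

/-! ### The measure on the groupoid induced by a conformal measure -/

instance : MeasurableSpace (Gpd G) := borel _

instance : BorelSpace (Gpd G) := ⟨rfl⟩

/-- The measure on `𝒢` with `∫ f dμ = ∫ ∑_{s(γ) = x} f(γ) dm(x)`. -/
noncomputable def gpdMeasure (F : E → ℝ) (β : ℝ) (m : Measure (PathSpace G)) : Measure (Gpd G) :=
  -- The source of (μx, ·, νx) is νx, and on Z(ν) the measure m is e^{-βF(ν)} times its copy on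
  -- Z(r(ν)).
  Measure.sum fun p : ReducedPair G => pathFactor F β p.1.2 •
    (m.restrict (cylinder (FinPath.ofVertex G p.1.2.range))).map (mkD p.1.1 p.1.2)

lemma lintegral_gpdMeasure (F : E → ℝ) (β : ℝ) (m : Measure (PathSpace G)) {f : Gpd G → ℝ≥0∞}
    (hf : Measurable f) : ∫⁻ γ, f γ ∂(gpdMeasure F β m) = ∑' p : ReducedPair G,
      pathFactor F β p.1.2 *
        ∫⁻ x in cylinder (FinPath.ofVertex G p.1.2.range), f (mkD p.1.1 p.1.2 x) ∂m := by
  rw [gpdMeasure, lintegral_sum_measure]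
  refine tsum_congr fun p => ?_
  rw [lintegral_smul_measure, lintegral_map hf (continuous_mkD _ _).measurable, smul_eq_mul]

lemma mkD_inv {μ ν : FinPath G} {x : PathSpace G} (h : x.src = μ.range) (h' : x.src = ν.range) :
    (mkD μ ν x).inv = mkD ν μ x := by
  rw [mkD_of_eq h h', mkD_of_eq h' h, Gpd.inv_mk']

lemma measurable_inv : Measurable (Gpd.inv : Gpd G → Gpd G) := continuous_inv.measurable

lemma measurable_cocycle (F : E → ℝ) : Measurable (cocycle F : Gpd G → ℝ) :=
  (continuous_cocycle F).measurable

/-- The swap of a reduced pair. -/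
def ReducedPair.swap : ReducedPair G ≃ ReducedPair G where
  toFun p := ⟨(p.1.2, p.1.1), p.2.symm⟩
  invFun p := ⟨(p.1.2, p.1.1), p.2.symm⟩
  left_inv _ := rfl
  right_inv _ := rfl

/-- Inversion swaps (μ, ν) with (ν, μ). The factors e^{-βF(μ)} and e^{-βF(ν)} of the two pieces have
the quotient e^{-βc_F}, and c_F is constant on the piece. This is where the KMS condition for φ_m
comes from. -/
lemma lintegral_gpdMeasure_inv (F : E → ℝ) (β : ℝ) (m : Measure (PathSpace G))
    {f : Gpd G → ℝ≥0∞} (hf : Measurable f) : ∫⁻ γ, f γ.inv ∂(gpdMeasure F β m) =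
      ∫⁻ γ, ENNReal.ofReal (Real.exp (-(β * cocycle F γ))) * f γ ∂(gpdMeasure F β m) := by
  have hd : Measurable fun γ : Gpd G => ENNReal.ofReal (Real.exp (-(β * cocycle F γ))) := by
    have := measurable_cocycle (G := G) F
    fun_prop
  rw [lintegral_gpdMeasure F β m (f := fun γ => f γ.inv) (hf.comp measurable_inv),
    lintegral_gpdMeasure F β m (f := fun γ => ENNReal.ofReal (Real.exp (-(β * cocycle F γ))) * f γ)
      (hd.mul hf), ← ReducedPair.swap.tsum_eq]
  refine tsum_congr fun p => ?_
  obtain ⟨⟨μ, ν⟩, hp⟩ := p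
  have hr : μ.range = ν.range := hp.1
  have hmeas : Measurable fun x => f (mkD μ ν x) := hf.comp (continuous_mkD μ ν).measurable
  change pathFactor F β μ * ∫⁻ x in cylinder (FinPath.ofVertex G μ.range), f (mkD ν μ x).inv ∂m =
    pathFactor F β ν * ∫⁻ x in cylinder (FinPath.ofVertex G ν.range),
      ENNReal.ofReal (Real.exp (-(β * cocycle F (mkD μ ν x)))) * f (mkD μ ν x) ∂m
  rw [hr]
  have h1 : ∫⁻ x in cylinder (FinPath.ofVertex G ν.range), f (mkD ν μ x).inv ∂m =
      ∫⁻ x in cylinder (FinPath.ofVertex G ν.range), f (mkD μ ν x) ∂m := by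
    refine setLIntegral_congr_fun (measurableSet_cylinder _) fun x hx => ?_
    have hx' := mem_cylinder_ofVertex.1 hx
    change f (mkD ν μ x).inv = f (mkD μ ν x)
    rw [mkD_inv hx' (hx'.trans hr.symm)]
  have h2 : ∫⁻ x in cylinder (FinPath.ofVertex G ν.range),
      ENNReal.ofReal (Real.exp (-(β * cocycle F (mkD μ ν x)))) * f (mkD μ ν x) ∂m =
      ∫⁻ x in cylinder (FinPath.ofVertex G ν.range),
        ENNReal.ofReal (Real.exp (-(β * (μ.weight F - ν.weight F)))) * f (mkD μ ν x) ∂m := by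
    refine setLIntegral_congr_fun (measurableSet_cylinder _) fun x hx => ?_
    have hx' := mem_cylinder_ofVertex.1 hx
    have h3 := mkD_of_eq (hx'.trans hr.symm) hx'
    simp only [h3, cocycle_mk']
  rw [h1, h2, lintegral_const_mul _ hmeas, ← mul_assoc, pathFactor, pathFactor,
    ← ENNReal.ofReal_mul (Real.exp_pos _).le, ← Real.exp_add]
  congr 4
  ring

lemma map_inv_gpdMeasure (F : E → ℝ) (β : ℝ) (m : Measure (PathSpace G)) :
    (gpdMeasure F β m).map Gpd.inv = (gpdMeasure F β m).withDensity
      fun γ => ENNReal.ofReal (Real.exp (-(β * cocycle F γ))) := by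
  refine Measure.ext fun s hs => ?_
  rw [Measure.map_apply measurable_inv hs, withDensity_apply _ hs,
    ← lintegral_indicator_one (measurable_inv hs), ← lintegral_indicator hs]
  have h1 := lintegral_gpdMeasure_inv F β m (f := s.indicator 1) (measurable_one.indicator hs)
  refine Eq.trans ?_ (h1.trans ?_)
  · rfl
  · refine lintegral_congr fun γ => ?_
    by_cases h : γ ∈ s <;> simp [h]

section

variable {F : E → ℝ} {β : ℝ} {m : Measure (PathSpace G)}

lemma exp_smul_eq (γ : Gpd G) (z : ℂ) :
    (ENNReal.ofReal (Real.exp (-(β * cocycle F γ)))).toReal • z =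
      (Real.exp (-(β * cocycle F γ)) : ℂ) * z := by
  rw [ENNReal.toReal_ofReal (Real.exp_pos _).le, Complex.real_smul]

lemma measurable_density (F : E → ℝ) (β : ℝ) :
    Measurable fun γ : Gpd G => ENNReal.ofReal (Real.exp (-(β * cocycle F γ))) := by
  have := measurable_cocycle (G := G) F
  fun_prop

lemma integral_gpdMeasure_inv {f : Gpd G → ℂ} (hf : Measurable f) :
    ∫ γ, f γ.inv ∂(gpdMeasure F β m) =
      ∫ γ, (Real.exp (-(β * cocycle F γ)) : ℂ) * f γ ∂(gpdMeasure F β m) := by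
  rw [← integral_map measurable_inv.aemeasurable hf.aestronglyMeasurable, map_inv_gpdMeasure,
    integral_withDensity_eq_integral_toReal_smul (measurable_density F β)
      (Filter.Eventually.of_forall fun _ => ENNReal.ofReal_lt_top)]
  exact integral_congr_ae (Filter.Eventually.of_forall fun γ => exp_smul_eq γ (f γ))

lemma integrable_gpdMeasure_inv {f : Gpd G → ℂ} (hf : Measurable f) :
    Integrable (fun γ => f γ.inv) (gpdMeasure F β m) ↔
      Integrable (fun γ => (Real.exp (-(β * cocycle F γ)) : ℂ) * f γ) (gpdMeasure F β m) := by
  have h1 := integrable_map_measure (μ := gpdMeasure F β m) (f := Gpd.inv) (g := f)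
    hf.aestronglyMeasurable measurable_inv.aemeasurable
  rw [map_inv_gpdMeasure, integrable_withDensity_iff_integrable_smul' (measurable_density F β)
    (Filter.Eventually.of_forall fun _ => ENNReal.ofReal_lt_top)] at h1
  simp only [exp_smul_eq] at h1
  exact h1.symm

end

/-! ### Square integrable coefficients -/

lemma norm_sq_eq_tsum (ξ : HilbertG G) :
    ENNReal.ofReal (‖ξ‖ ^ 2) = ∑' γ, ENNReal.ofReal (‖ξ γ‖ ^ 2) := by
  have h1 : HasSum (fun γ => ‖ξ γ‖ ^ 2) (‖ξ‖ ^ 2) := by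
    have := lp.hasSum_norm (p := 2) (by norm_num) ξ
    simpa using this
  rw [← h1.tsum_eq, ENNReal.ofReal_tsum_of_nonneg (fun _ => by positivity) h1.summable]

lemma tsum_eq_tsum_reducedPair (f : Gpd G → ℝ≥0∞) : ∑' γ, f γ = ∑' p : ReducedPair G, ∑' γ,
    (basicBisection p.1.1 p.1.2).indicator f γ := by
  rw [ENNReal.tsum_comm]
  refine tsum_congr fun γ => ?_
  obtain ⟨μ, ν, x, h, h', hr, e⟩ := γ.exists_reduced
  have hm : γ ∈ basicBisection μ ν := by rw [e]; exact mk'_mem_basicBisection _ _ _ _ _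
  rw [tsum_eq_single (⟨(μ, ν), hr⟩ : ReducedPair G), Set.indicator_of_mem hm]
  intro p hp
  refine Set.indicator_of_notMem (fun hγ => hp ?_) _
  exact ReducedPair.eq_of_mem hγ hm

/-- At most one element of the bisection has source y, and S_νS_μ* moves it to the unit at y. The
right hand side depends continuously on y, which settles measurability. -/
lemma tsum_bisection {T : Op G} (hT : T ∈ cstarSub G) (y : PathSpace G) (p : ReducedPair G) :
    ∑' γ, (basicBisection p.1.1 p.1.2).indicator
      (fun γ => ENNReal.ofReal (‖T (bv (Gpd.unit y)) γ‖ ^ 2)) γ =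
      ENNReal.ofReal (‖coeff (basicOp p.1.2 p.1.1 * T) (Gpd.unit y)‖ ^ 2) := by
  classical
  obtain ⟨⟨μ, ν⟩, hp⟩ := p
  change ∑' γ, (basicBisection μ ν).indicator _ γ =
    ENNReal.ofReal (‖coeff (basicOp ν μ * T) (Gpd.unit y)‖ ^ 2)
  have h0 : coeff (basicOp ν μ * T) (Gpd.unit y) =
      basicOp ν μ (T (bv (Gpd.unit y))) (Gpd.unit y) := rfl
  by_cases hy : y ∈ cylinder ν
  · obtain ⟨x, hx, rfl⟩ := mem_cylinder_iff.1 hy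
    have hx' : x.src = μ.range := hx.trans hp.1.symm
    rw [tsum_eq_single (Gpd.mk' μ ν x hx' hx), Set.indicator_of_mem
      (mk'_mem_basicBisection _ _ _ _ _), h0]
    · congr 3
      refine (basicOp_apply_of_eq hx hx' _ (γ := Gpd.unit (concat ν x hx))
        (δ := Gpd.mk' μ ν x hx' hx) rfl rfl ?_ rfl).symm
      simp only [Gpd.lag_mk', Gpd.lag_unit]
      ring
    · intro γ hγ
      by_cases hγ' : γ ∈ basicBisection μ ν
      · rw [Set.indicator_of_mem hγ', cstar_apply_unit hT, if_neg]
        · simp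
        · intro hs
          exact hγ (injOn_src_basicBisection μ ν hγ' (mk'_mem_basicBisection _ _ _ _ _) hs)
      · exact Set.indicator_of_notMem hγ' _
  · rw [h0, basicOp_apply_of_notMem _ (by exact hy)]
    simp only [norm_zero, ne_eq, OfNat.ofNat_ne_zero, not_false_eq_true, zero_pow,
      ENNReal.ofReal_zero, ENNReal.tsum_eq_zero]
    intro γ
    by_cases hγ' : γ ∈ basicBisection μ ν
    · rw [Set.indicator_of_mem hγ', cstar_apply_unit hT, if_neg]
      · simp
      · intro hs
        obtain ⟨x, h, h', rfl⟩ := mem_basicBisection.1 hγ'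
        exact hy (hs ▸ concat_mem_cylinder _ _ _)
    · exact Set.indicator_of_notMem hγ' _

lemma measurable_coeff {T : Op G} (hT : T ∈ cstarSub G) : Measurable (coeff T) :=
  (continuous_coeff hT).measurable

lemma continuous_coeff_unit {T : Op G} (hT : T ∈ cstarSub G) :
    Continuous fun x => coeff T (Gpd.unit x) :=
  (continuous_coeff hT).comp continuous_unit

variable [Countable V] [Countable E] {F : E → ℝ} {β : ℝ} {m : Measure (PathSpace G)}

/-- `∫ ‖T e_x‖² dm(x)` as an integral over the groupoid. -/
lemma lintegral_norm_sq (hm : IsCylinderConformal F β m) {T : Op G} (hT : T ∈ cstarSub G) :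
    ∫⁻ x, ENNReal.ofReal (‖T (bv (Gpd.unit x))‖ ^ 2) ∂m =
      ∫⁻ γ, ENNReal.ofReal (‖coeff T γ‖ ^ 2) ∂(gpdMeasure F β m) := by
  have hmem : ∀ p : ReducedPair G, basicOp p.1.2 p.1.1 * T ∈ cstarSub G := fun p =>
    mul_mem (basicOp_mem_cstarSub _ _) hT
  have hmeas : ∀ p : ReducedPair G, Measurable fun x : PathSpace G =>
      ENNReal.ofReal (‖coeff (basicOp p.1.2 p.1.1 * T) (Gpd.unit x)‖ ^ 2) := fun p =>
    ENNReal.measurable_ofReal.comp (((continuous_coeff_unit (hmem p)).norm.pow 2).measurable)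
  have hmeas' : Measurable fun γ : Gpd G => ENNReal.ofReal (‖coeff T γ‖ ^ 2) :=
    ENNReal.measurable_ofReal.comp (((continuous_coeff hT).norm.pow 2).measurable)
  -- The squared norm of the column at x is a sum of squared entries, grouped by reduced pairs into
  -- terms that are continuous in x.
  simp only [norm_sq_eq_tsum, tsum_eq_tsum_reducedPair, tsum_bisection hT]
  rw [lintegral_tsum fun p => (hmeas p).aemeasurable, lintegral_gpdMeasure F β m hmeas']
  refine tsum_congr fun p => ?_
  obtain ⟨⟨μ, ν⟩, hp⟩ := p
  have h0 : ∫⁻ x, ENNReal.ofReal (‖coeff (basicOp ν μ * T) (Gpd.unit x)‖ ^ 2) ∂m =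
      ∫⁻ x in cylinder ν, ENNReal.ofReal (‖coeff (basicOp ν μ * T) (Gpd.unit x)‖ ^ 2) ∂m := by
    rw [← lintegral_indicator (measurableSet_cylinder ν)]
    refine lintegral_congr fun x => ?_
    by_cases hx : x ∈ cylinder ν
    · rw [Set.indicator_of_mem hx]
    · have h1 : coeff (basicOp ν μ * T) (Gpd.unit x) = 0 := by
        change basicOp ν μ (T (bv (Gpd.unit x))) (Gpd.unit x) = 0
        exact basicOp_apply_of_notMem _ hx
      rw [Set.indicator_of_notMem hx, h1]
      simp
  change ∫⁻ x, ENNReal.ofReal (‖coeff (basicOp ν μ * T) (Gpd.unit x)‖ ^ 2) ∂m =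
    pathFactor F β ν * ∫⁻ x in cylinder (FinPath.ofVertex G ν.range),
      ENNReal.ofReal (‖coeff T (mkD μ ν x)‖ ^ 2) ∂m
  rw [h0, hm.lintegral_cylinder ν (hmeas ⟨(μ, ν), hp⟩)]
  congr 1
  refine setLIntegral_congr_fun (measurableSet_cylinder _) fun x hx => ?_
  have hx' := mem_cylinder_ofVertex.1 hx
  have hx'' : x.src = μ.range := hx'.trans hp.1.symm
  have h1 : coeff (basicOp ν μ * T) (Gpd.unit (concatD ν x)) = coeff T (mkD μ ν x) := by
    rw [concatD_of_eq hx', mkD_of_eq hx'' hx']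
    change basicOp ν μ (T (bv (Gpd.unit (concat ν x hx')))) (Gpd.unit (concat ν x hx')) =
      T (bv (Gpd.unit (concat ν x hx'))) (Gpd.mk' μ ν x hx'' hx')
    refine basicOp_apply_of_eq hx' hx'' _ (γ := Gpd.unit (concat ν x hx'))
      (δ := Gpd.mk' μ ν x hx'' hx') rfl rfl ?_ rfl
    simp only [Gpd.lag_mk', Gpd.lag_unit]
    ring
  simp only [h1]

end GroupoidMeasure

end GraphKMS

namespace GraphKMS

section StripIntegral

open MeasureTheory Filter

/-! ### Functions `z ↦ ∫ u e^{izc}` on a strip -/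

variable {X : Type*} [MeasurableSpace X] {μ : Measure X} {u : X → ℂ} {c : X → ℝ} {β : ℝ}

lemma norm_exp_I_mul (z : ℂ) (c : ℝ) :
    ‖Complex.exp (Complex.I * z * c)‖ = Real.exp (-(z.im * c)) := by
  rw [Complex.norm_exp]
  congr 1
  simp

/-- The exponent is linear in Im z, so it is at most the larger of its values 0 and -βc on the two
boundary lines. -/
lemma exp_le_of_mem_strip {z : ℂ} (hz : z ∈ strip β) (c : ℝ) :
    Real.exp (-(z.im * c)) ≤ 1 + Real.exp (-(β * c)) := by
  have h : -(z.im * c) ≤ max 0 (-(β * c)) := by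
    have hz' : z.im ∈ Set.uIcc 0 β := hz
    rcases Set.mem_uIcc.1 hz' with ⟨h1, h2⟩ | ⟨h1, h2⟩ <;> rcases le_total 0 c with hc | hc <;>
      simp only [le_max_iff] <;> [left; right; right; left] <;> nlinarith
  rcases le_max_iff.1 h with h | h
  · have := Real.exp_le_exp.2 h
    rw [Real.exp_zero] at this
    linarith [Real.exp_pos (-(β * c))]
  · have := Real.exp_le_exp.2 h
    linarith

lemma integrable_bound (hu : Integrable u μ)
    (hu' : Integrable (fun x => (Real.exp (-(β * c x)) : ℂ) * u x) μ) :
    Integrable (fun x => (1 + Real.exp (-(β * c x))) * ‖u x‖) μ := by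
  refine (hu.norm.add hu'.norm).congr (Eventually.of_forall fun x => ?_)
  simp only [Pi.add_apply, norm_mul, Complex.norm_real, Real.norm_eq_abs, Real.abs_exp]
  ring

omit [MeasurableSpace X] in
lemma norm_integrand_le {z : ℂ} (hz : z ∈ strip β) (x : X) :
    ‖Complex.exp (Complex.I * z * c x) * u x‖ ≤ (1 + Real.exp (-(β * c x))) * ‖u x‖ := by
  rw [norm_mul, norm_exp_I_mul]
  gcongr
  exact exp_le_of_mem_strip hz _

lemma aestronglyMeasurable_integrand (hc : Measurable c) (hu : Integrable u μ) (z : ℂ) :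
    AEStronglyMeasurable (fun x => Complex.exp (Complex.I * z * c x) * u x) μ := by
  have : Measurable fun x => Complex.exp (Complex.I * z * c x) := by fun_prop
  exact this.aestronglyMeasurable.mul hu.aestronglyMeasurable

lemma continuousOn_stripIntegral (hc : Measurable c) (hu : Integrable u μ)
    (hu' : Integrable (fun x => (Real.exp (-(β * c x)) : ℂ) * u x) μ) :
    ContinuousOn (fun z => ∫ x, Complex.exp (Complex.I * z * c x) * u x ∂μ) (strip β) := by
  refine continuousOn_of_dominated (fun z _ => aestronglyMeasurable_integrand hc hu z)
    (fun z hz => Eventually.of_forall (norm_integrand_le hz)) (integrable_bound hu hu')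
    (Eventually.of_forall fun x => ?_)
  fun_prop

lemma norm_stripIntegral_le (hu : Integrable u μ)
    (hu' : Integrable (fun x => (Real.exp (-(β * c x)) : ℂ) * u x) μ) {z : ℂ}
    (hz : z ∈ strip β) : ‖∫ x, Complex.exp (Complex.I * z * c x) * u x ∂μ‖ ≤
      ∫ x, (1 + Real.exp (-(β * c x))) * ‖u x‖ ∂μ :=
  norm_integral_le_of_norm_le (integrable_bound hu hu') (Eventually.of_forall (norm_integrand_le hz))

/-- From δ|c| ≤ e^{δc} + e^{-δc}: a factor c is paid for by moving the exponent by δ in both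
directions. This dominates the derivative of the integrand. -/
lemma abs_mul_exp_le {δ : ℝ} (hδ : 0 < δ) (y c : ℝ) :
    |c| * Real.exp (-(y * c)) ≤
      δ⁻¹ * (Real.exp (-((y - δ) * c)) + Real.exp (-((y + δ) * c))) := by
  have h1 : δ * |c| ≤ Real.exp (δ * c) + Real.exp (-(δ * c)) := by
    have h2 := Real.add_one_le_exp (δ * c)
    have h3 := Real.add_one_le_exp (-(δ * c))
    have h4 := Real.exp_pos (δ * c)
    have h5 := Real.exp_pos (-(δ * c))
    rcases abs_cases c with ⟨h, -⟩ | ⟨h, -⟩ <;> rw [h] <;> linarith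
  have h2 : Real.exp (-((y - δ) * c)) + Real.exp (-((y + δ) * c)) =
      (Real.exp (δ * c) + Real.exp (-(δ * c))) * Real.exp (-(y * c)) := by
    rw [add_mul (Real.exp (δ * c)), ← Real.exp_add, ← Real.exp_add (-(δ * c))]
    congr 1 <;> congr 1 <;> ring
  rw [h2, ← mul_assoc]
  gcongr
  rw [inv_mul_eq_div, le_div_iff₀ hδ, mul_comm]
  exact h1

lemma differentiableOn_stripIntegral (hc : Measurable c) (hu : Integrable u μ)
    (hu' : Integrable (fun x => (Real.exp (-(β * c x)) : ℂ) * u x) μ) :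
    DifferentiableOn ℂ (fun z => ∫ x, Complex.exp (Complex.I * z * c x) * u x ∂μ)
      (interior (strip β)) := by
  intro z₀ hz₀
  obtain ⟨ε, hε, hball⟩ := Metric.isOpen_iff.1 isOpen_interior z₀ hz₀
  -- Half the radius, so that points of the δ-ball moved vertically by at most δ still lie in the
  -- strip.
  set δ := ε / 2 with hδ
  have hδ0 : 0 < δ := half_pos hε
  have hstrip : ∀ z ∈ Metric.ball z₀ δ, ∀ s : ℝ, |s| ≤ δ → z + s * Complex.I ∈ strip β := by
    intro z hz s hs
    refine interior_subset (hball ?_)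
    rw [Metric.mem_ball, dist_eq_norm] at hz ⊢
    have h1 : z + s * Complex.I - z₀ = (z - z₀) + s * Complex.I := by ring
    rw [h1]
    refine (norm_add_le _ _).trans_lt ?_
    rw [norm_mul, Complex.norm_real, Complex.norm_I, mul_one, Real.norm_eq_abs]
    linarith
  have hmem : z₀ ∈ strip β := interior_subset hz₀
  have key := hasDerivAt_integral_of_dominated_loc_of_deriv_le (μ := μ) (𝕜 := ℂ)
    (F := fun z x => Complex.exp (Complex.I * z * c x) * u x)
    (F' := fun z x => Complex.exp (Complex.I * z * c x) * (Complex.I * c x) * u x)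
    (x₀ := z₀) (s := Metric.ball z₀ δ)
    (bound := fun x => δ⁻¹ * 2 * ((1 + Real.exp (-(β * c x))) * ‖u x‖))
    (Metric.ball_mem_nhds z₀ hδ0)
    (Eventually.of_forall fun z => aestronglyMeasurable_integrand hc hu z)
    ((integrable_bound hu hu').mono' (aestronglyMeasurable_integrand hc hu z₀)
      (Eventually.of_forall (norm_integrand_le hmem))) ?_ ?_ ((integrable_bound hu hu').const_mul _)
    ?_
  · exact key.2.differentiableAt.differentiableWithinAt
  · have : Measurable fun x => Complex.exp (Complex.I * z₀ * c x) * (Complex.I * c x) := by fun_prop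
    exact this.aestronglyMeasurable.mul hu.aestronglyMeasurable
  · refine Eventually.of_forall fun x z hz => ?_
    have h1 := exp_le_of_mem_strip (hstrip z hz δ (abs_of_pos hδ0).le) (c x)
    have h2 := exp_le_of_mem_strip (hstrip z hz (-δ) (by rw [abs_neg, abs_of_pos hδ0])) (c x)
    have h3 : (z + (δ : ℂ) * Complex.I).im = z.im + δ := by simp
    have h4 : (z + ((-δ : ℝ) : ℂ) * Complex.I).im = z.im - δ := by simp [sub_eq_add_neg]
    rw [h3] at h1
    rw [h4] at h2
    rw [norm_mul, norm_mul, norm_mul, norm_exp_I_mul, Complex.norm_I, one_mul, Complex.norm_real,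
      Real.norm_eq_abs, mul_comm (Real.exp _)]
    have h5 : |c x| * Real.exp (-(z.im * c x)) ≤ δ⁻¹ * 2 * (1 + Real.exp (-(β * c x))) := by
      refine (abs_mul_exp_le hδ0 z.im (c x)).trans ?_
      rw [mul_assoc]
      gcongr
      linarith
    have := mul_le_mul_of_nonneg_right h5 (norm_nonneg (u x))
    rwa [mul_assoc (δ⁻¹ * 2)] at this
  · refine Eventually.of_forall fun x z _ => ?_
    have h1 : HasDerivAt (fun z : ℂ => Complex.I * z * c x) (Complex.I * c x) z := by
      simpa using ((hasDerivAt_id z).const_mul Complex.I).mul_const (c x : ℂ)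
    exact h1.cexp.mul_const (u x)

end StripIntegral

end GraphKMS

namespace GraphKMS

section MeasureWeight

open MeasureTheory Filter

variable {V E : Type*} {G : EGraph V E}

attribute [local instance] CStarAlgebra.spectralOrder CStarAlgebra.spectralOrderedRing

/-! ### The weight of a conformal measure -/

lemma coeff_star_mul_self (T : Op G) (x : PathSpace G) :
    coeff (star T * T) (Gpd.unit x) = ((‖T (bv (Gpd.unit x))‖ ^ 2 : ℝ) : ℂ) := by
  change (star T) (T (bv (Gpd.unit x))) (Gpd.unit x) = _
  rw [← inner_bv_left, ContinuousLinearMap.star_eq_adjoint,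
    ContinuousLinearMap.adjoint_inner_right, inner_self_eq_norm_sq_to_K]
  push_cast
  rfl

lemma coeff_conjPhase (F : E → ℝ) (t : ℝ) {T : Op G} (hT : T ∈ cstarSub G) (γ : Gpd G) :
    coeff (conjPhase F t T) γ =
      Complex.exp ((t * cocycle F γ : ℝ) * Complex.I) * coeff T γ :=
  congrFun (isConvOp_conjPhase F t (isConvOp_coeff hT)).coeff_eq γ

lemma cocycle_unit (F : E → ℝ) (x : PathSpace G) : cocycle F (Gpd.unit x) = 0 := by
  have h := unit_mem_basicBisection_self (mem_cylinder_ofVertex.2 (rfl : x.src = x.src))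
  obtain ⟨y, h1, h2, e⟩ := mem_basicBisection.1 h
  rw [e, cocycle_mk', sub_self]

/-- The sources of the support of f form a compact set, which lies in finitely many Z(v). Columns η
with range outside these Z(v) are zero. -/
lemma exists_mul_finProj {f : Gpd G → ℂ} (hf : IsCc G f) {T : Op G} (hT : IsConvOp f T) :
    ∃ X, T * finProj G X = T := by
  classical
  obtain ⟨X, hX⟩ := IsCompact.exists_finset_vertex (hf.2.isCompact.image continuous_src)
  refine ⟨X, op_ext fun η γ => ?_⟩
  rw [mul_apply_eq_comp]
  by_cases h : η.rng.src ∈ X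
  · have h1 : finProj G X (bv η) = bv η := by
      refine lp.ext (funext fun ζ => ?_)
      rw [finProj_apply]
      split_ifs with hζ
      · rfl
      · exact (bv_apply_ne fun e => hζ (by rw [e]; exact h)).symm
    rw [h1]
  · have h1 : finProj G X (bv η) = 0 := by
      refine lp.ext (funext fun ζ => ?_)
      rw [finProj_apply]
      split_ifs with hζ
      · exact bv_apply_ne fun e => h (e ▸ hζ)
      · rfl
    rw [h1, map_zero, isConvOp_iff.1 hT, convKernel]
    split_ifs with hs
    · by_contra h2
      have h3 : γ.mulInv η hs ∈ tsupport f := subset_tsupport f fun e => h2 e.symm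
      have h4 := hX ⟨_, h3, rfl⟩
      simp only [Set.mem_iUnion, mem_cylinder_ofVertex] at h4
      obtain ⟨v, hv, h5⟩ := h4
      exact h (h5 ▸ hv)
    · rfl

lemma isCc_star {f : Gpd G → ℂ} (hf : IsCc G f) : IsCc G fun γ => star (f γ.inv) := by
  refine ⟨(hf.1.comp continuous_inv).star, ?_⟩
  refine HasCompactSupport.intro (hf.2.isCompact.image continuous_inv) fun γ hγ => ?_
  have h0 : f γ.inv = 0 :=
    image_eq_zero_of_notMem_tsupport fun h => hγ ⟨γ.inv, h, γ.inv_inv⟩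
  rw [h0, star_zero]

/-- The scalar counterpart of `Weight.star_mul_eq`, with the same four terms. -/
lemma polarization_complex (f g : ℂ) :
    (((‖(1 / 2 : ℂ) * (g + f)‖ ^ 2 - ‖(1 / 2 : ℂ) * (g - f)‖ ^ 2 : ℝ) : ℂ)) +
      Complex.I * ((‖(1 / 2 : ℂ) * (g + Complex.I * f)‖ ^ 2 -
        ‖(1 / 2 : ℂ) * (g - Complex.I * f)‖ ^ 2 : ℝ) : ℂ) = star f * g := by
  simp only [Complex.sq_norm, Complex.normSq_apply]
  apply Complex.ext <;> simp <;> ring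

namespace GraphRep

variable {A : Type*} [NonUnitalCStarAlgebra A] (R : GraphRep G A)

lemma coeff_nonneg (a : PosCone A) (x : PathSpace G) :
    0 ≤ (coeff (R.toOp a.1) (Gpd.unit x)).re ∧ (coeff (R.toOp a.1) (Gpd.unit x)).im = 0 := by
  obtain ⟨b, hb⟩ := a.2
  rw [hb, R.toOp_mul, R.toOp_star, coeff_star_mul_self]
  exact ⟨by rw [Complex.ofReal_re]; positivity, Complex.ofReal_im _⟩

lemma measurable_diag (a : A) :
    Measurable fun x => ENNReal.ofReal (coeff (R.toOp a) (Gpd.unit x)).re :=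
  ENNReal.measurable_ofReal.comp
    (Complex.continuous_re.comp (continuous_coeff_unit (R.toOp_mem a))).measurable

/-- The weight `φ_m`. -/
noncomputable def kmsWeight (m : Measure (PathSpace G)) : Weight A where
  toFun a := ∫⁻ x, ENNReal.ofReal (coeff (R.toOp a.1) (Gpd.unit x)).re ∂m
  map_add' a b c h := by
    rw [← lintegral_add_left (R.measurable_diag a.1)]
    refine lintegral_congr fun x => ?_
    rw [h, R.toOp_add, coeff_add, Complex.add_re,
      ENNReal.ofReal_add (R.coeff_nonneg a x).1 (R.coeff_nonneg b x).1]
  map_smul' t a b h := by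
    rw [← lintegral_const_mul _ (R.measurable_diag a.1)]
    refine lintegral_congr fun x => ?_
    rw [h, R.toOp_smul, coeff_smul, Complex.re_ofReal_mul]
    exact (ENNReal.ofReal_mul t.coe_nonneg).trans (by rw [ENNReal.ofReal_coe_nnreal])

lemma kmsWeight_apply (m : Measure (PathSpace G)) (a : PosCone A) :
    R.kmsWeight m a = ∫⁻ x, ENNReal.ofReal (coeff (R.toOp a.1) (Gpd.unit x)).re ∂m := rfl

lemma kmsWeight_add_smul (m m' : Measure (PathSpace G)) (a b : ℝ≥0) :
    R.kmsWeight (a • m + b • m') = a • R.kmsWeight m + b • R.kmsWeight m' := by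
  refine Weight.ext (funext fun c => ?_)
  change ∫⁻ x, _ ∂(a • m + b • m') = (a : ℝ≥0∞) * ∫⁻ x, _ ∂m + (b : ℝ≥0∞) * ∫⁻ x, _ ∂m'
  rw [lintegral_add_measure, lintegral_smul_measure, lintegral_smul_measure]
  rfl

lemma kmsWeight_proj [Countable V] [Countable E] (m : Measure (PathSpace G)) (μ : FinPath G) :
    R.kmsWeight m (R.proj μ) = m (cylinder μ) := by
  classical
  rw [kmsWeight_apply, ← lintegral_indicator_one (measurableSet_cylinder μ)]
  refine lintegral_congr fun x => ?_
  rw [coe_proj, toOp_elt, (isConvOp_basicOp μ μ).coeff_eq, basicBisection_self]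
  by_cases hx : x ∈ cylinder μ
  · rw [Set.indicator_of_mem (Set.mem_image_of_mem _ hx), Set.indicator_of_mem hx]
    simp
  · rw [Set.indicator_of_notMem hx, Set.indicator_of_notMem]
    · simp
    · rintro ⟨y, hy, e⟩
      have e' : y = x := congrArg Gpd.src e
      exact hx (e' ▸ hy)

/-- A positive element has a nonnegative diagonal, whose integral is its weight. Linearity covers
every decomposition allowed in `Weight.HasValue`. -/
lemma hasValue_kmsWeight {m : Measure (PathSpace G)} {a : A} {z : ℂ}
    (h : (R.kmsWeight m).HasValue a z) :
    Integrable (fun x => coeff (R.toOp a) (Gpd.unit x)) m ∧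
      z = ∫ x, coeff (R.toOp a) (Gpd.unit x) ∂m := by
  have key : ∀ p : PosCone A, R.kmsWeight m p < ∞ →
      Integrable (fun x => coeff (R.toOp p.1) (Gpd.unit x)) m ∧
        ∫ x, coeff (R.toOp p.1) (Gpd.unit x) ∂m = ((R.kmsWeight m p).toReal : ℂ) := by
    intro p hp
    have hre : ∀ x, coeff (R.toOp p.1) (Gpd.unit x) =
        ((coeff (R.toOp p.1) (Gpd.unit x)).re : ℂ) := fun x =>
      Complex.ext rfl (by rw [(R.coeff_nonneg p x).2, Complex.ofReal_im])
    have hc : Continuous fun x => (coeff (R.toOp p.1) (Gpd.unit x)).re :=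
      Complex.continuous_re.comp (continuous_coeff_unit (R.toOp_mem p.1))
    have hi : Integrable (fun x => (coeff (R.toOp p.1) (Gpd.unit x)).re) m := by
      refine ⟨hc.measurable.aestronglyMeasurable, ?_⟩
      rw [hasFiniteIntegral_iff_ofReal (Eventually.of_forall fun x => (R.coeff_nonneg p x).1)]
      exact hp
    constructor
    · exact hi.ofReal.congr (Eventually.of_forall fun x => (hre x).symm)
    · rw [integral_congr_ae (Eventually.of_forall hre), integral_complex_ofReal,
        integral_eq_lintegral_of_nonneg_ae
          (Eventually.of_forall fun x => (R.coeff_nonneg p x).1)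
          hc.measurable.aestronglyMeasurable]
      rfl
  obtain ⟨p, q, u, w, hp, hq, hu, hw, rfl, rfl⟩ := h
  obtain ⟨ip, ep⟩ := key p hp
  obtain ⟨iq, eq⟩ := key q hq
  obtain ⟨iu, eu⟩ := key u hu
  obtain ⟨iw, ew⟩ := key w hw
  have hcoe : ∀ x, coeff (R.toOp ((p.1 - q.1) + Complex.I • (u.1 - w.1))) (Gpd.unit x) =
      (coeff (R.toOp p.1) (Gpd.unit x) - coeff (R.toOp q.1) (Gpd.unit x)) +
        Complex.I * (coeff (R.toOp u.1) (Gpd.unit x) - coeff (R.toOp w.1) (Gpd.unit x)) := by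
    intro x
    rw [R.toOp_add, R.toOp_smul, R.toOp_sub, R.toOp_sub, coeff_add, coeff_smul, coeff_sub,
      coeff_sub]
  have i1 : Integrable (fun x => coeff (R.toOp p.1) (Gpd.unit x) -
    coeff (R.toOp q.1) (Gpd.unit x)) m := ip.sub iq
  have i2 : Integrable (fun x => Complex.I * (coeff (R.toOp u.1) (Gpd.unit x) -
    coeff (R.toOp w.1) (Gpd.unit x))) m := (iu.sub iw).const_mul Complex.I
  refine ⟨(i1.add i2).congr (Eventually.of_forall fun x => (hcoe x).symm), ?_⟩
  refine Eq.trans ?_ (integral_congr_ae (Eventually.of_forall hcoe)).symm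
  rw [integral_add i1 i2, integral_sub ip iq, integral_const_mul, integral_sub iu iw, ep, eq,
    eu, ew, Complex.ofReal_sub, Complex.ofReal_sub]

variable [Countable V] [Countable E] {F : E → ℝ} {β : ℝ} {m : Measure (PathSpace G)}

/-- The diagonal entry of b*b at x is the squared norm of the column of b at x, so the elements with
φ_m(b*b) < ∞ are those with coefficients in L² of the groupoid measure. -/
lemma kmsWeight_starMulSelf (hm : IsCylinderConformal F β m) (b : A) :
    R.kmsWeight m (starMulSelf b) =
      ∫⁻ γ, ENNReal.ofReal (‖coeff (R.toOp b) γ‖ ^ 2) ∂(gpdMeasure F β m) := by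
  rw [← lintegral_norm_sq hm (R.toOp_mem b), kmsWeight_apply]
  refine lintegral_congr fun x => ?_
  have h1 : R.toOp (starMulSelf b).1 = star (R.toOp b) * R.toOp b := by
    rw [← R.toOp_star, ← R.toOp_mul]
    rfl
  rw [h1, coeff_star_mul_self, Complex.ofReal_re]

omit [Countable V] [Countable E] in
lemma measurable_coeff_toOp (b : A) : Measurable (coeff (R.toOp b)) :=
  measurable_coeff (R.toOp_mem b)

lemma integrable_norm_sq (hm : IsCylinderConformal F β m) {b : A}
    (hb : R.kmsWeight m (starMulSelf b) < ∞) :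
    Integrable (fun γ => ‖coeff (R.toOp b) γ‖ ^ 2) (gpdMeasure F β m) := by
  refine ⟨((R.measurable_coeff_toOp b).norm.pow_const 2).aestronglyMeasurable, ?_⟩
  rw [hasFiniteIntegral_iff_ofReal (Eventually.of_forall fun γ => by positivity),
    ← R.kmsWeight_starMulSelf hm]
  exact hb

lemma toReal_kmsWeight (hm : IsCylinderConformal F β m) (b : A) :
    (R.kmsWeight m (starMulSelf b)).toReal =
      ∫ γ, ‖coeff (R.toOp b) γ‖ ^ 2 ∂(gpdMeasure F β m) := by
  rw [integral_eq_lintegral_of_nonneg_ae (Eventually.of_forall fun γ => by positivity)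
    ((R.measurable_coeff_toOp b).norm.pow_const 2).aestronglyMeasurable,
    R.kmsWeight_starMulSelf hm]

lemma integrable_star_mul (hm : IsCylinderConformal F β m) {y c : A}
    (hy : R.kmsWeight m (starMulSelf y) < ∞) (hc : R.kmsWeight m (starMulSelf c) < ∞) :
    Integrable (fun γ => star (coeff (R.toOp y) γ) * coeff (R.toOp c) γ) (gpdMeasure F β m) := by
  refine ((R.integrable_norm_sq hm hy).add (R.integrable_norm_sq hm hc)).mono'
    ((continuous_star.measurable.comp (R.measurable_coeff_toOp y)).mul (R.measurable_coeff_toOp c)).aestronglyMeasurable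
    (Eventually.of_forall fun γ => ?_)
  rw [norm_mul, norm_star, Pi.add_apply]
  nlinarith [sq_nonneg (‖coeff (R.toOp y) γ‖ - ‖coeff (R.toOp c) γ‖),
    sq_nonneg ‖coeff (R.toOp y) γ‖, sq_nonneg ‖coeff (R.toOp c) γ‖]

/-- `φ_m(y*c)` is the inner product of the coefficients. -/
lemma hasValue_star_mul (hm : IsCylinderConformal F β m) {y c : A}
    (hy : R.kmsWeight m (starMulSelf y) < ∞) (hc : R.kmsWeight m (starMulSelf c) < ∞) :
    (R.kmsWeight m).HasValue (star y * c)
      (∫ γ, star (coeff (R.toOp y) γ) * coeff (R.toOp c) γ ∂(gpdMeasure F β m)) := by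
  have hy' : R.kmsWeight m (starMulSelf (-y)) < ∞ := by
    simpa using Weight.starMulSelf_smul_lt_top hy (-1)
  have hIy := Weight.starMulSelf_smul_lt_top hy Complex.I
  have hIy' : R.kmsWeight m (starMulSelf (-(Complex.I • y))) < ∞ := by
    simpa using Weight.starMulSelf_smul_lt_top hy (-Complex.I)
  have h1 := Weight.starMulSelf_smul_lt_top (Weight.starMulSelf_add_lt_top hc hy) (1 / 2)
  have h2 := Weight.starMulSelf_smul_lt_top (Weight.starMulSelf_add_lt_top hc hy') (1 / 2)
  have h3 := Weight.starMulSelf_smul_lt_top (Weight.starMulSelf_add_lt_top hc hIy) (1 / 2)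
  have h4 := Weight.starMulSelf_smul_lt_top (Weight.starMulSelf_add_lt_top hc hIy') (1 / 2)
  rw [← sub_eq_add_neg] at h2 h4
  refine ⟨_, _, _, _, h1, h2, h3, h4, Weight.star_mul_eq y c, ?_⟩
  have i1 := R.integrable_norm_sq hm h1
  have i2 := R.integrable_norm_sq hm h2
  have i3 := R.integrable_norm_sq hm h3
  have i4 := R.integrable_norm_sq hm h4
  simp only [R.toReal_kmsWeight hm]
  rw [← integral_sub i1 i2, ← integral_sub i3 i4, ← integral_complex_ofReal,
    ← integral_complex_ofReal, ← integral_const_mul,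
    ← integral_add (i1.sub i2).ofReal ((i3.sub i4).ofReal.const_mul _)]
  refine integral_congr_ae (Eventually.of_forall fun γ => ?_)
  simp only [R.toOp_smul, R.toOp_add, R.toOp_sub, coeff_smul, coeff_add, coeff_sub]
  exact (polarization_complex _ _).symm

omit [Countable V] [Countable E] in
lemma isInvariant_kmsWeight (m : Measure (PathSpace G)) (F : E → ℝ) :
    (R.kmsWeight m).IsInvariant (R.action F) := by
  intro t a b h
  rw [kmsWeight_apply, kmsWeight_apply]
  refine lintegral_congr fun x => ?_
  rw [h, R.toOp_action, coeff_conjPhase F t (R.toOp_mem _), cocycle_unit]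
  simp

omit [Countable V] [Countable E] in
-- Fatou's lemma: each diagonal coefficient depends continuously on the element.
lemma lowerSemicontinuous_kmsWeight (m : Measure (PathSpace G)) :
    LowerSemicontinuous (R.kmsWeight m).toFun := by
  rw [lowerSemicontinuous_iff_isClosed_preimage]
  intro C
  have : SequentialSpace (PosCone A) :=
    inferInstanceAs (SequentialSpace {a : A // ∃ b : A, a = star b * b})
  refine IsSeqClosed.isClosed fun an a han ha => ?_
  have ha' : Tendsto (fun n => (an n).1) atTop (𝓝 a.1) := tendsto_subtype_rng.1 ha
  have hx : ∀ x, Tendsto (fun n => ENNReal.ofReal (coeff (R.toOp (an n).1) (Gpd.unit x)).re) atTop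
      (𝓝 (ENNReal.ofReal (coeff (R.toOp a.1) (Gpd.unit x)).re)) := by
    intro x
    have h1 : Continuous fun b : A => ENNReal.ofReal (coeff (R.toOp b) (Gpd.unit x)).re :=
      ENNReal.continuous_ofReal.comp (Complex.continuous_re.comp
        ((continuous_op_apply _ _).comp R.isometry.continuous))
    exact (h1.tendsto _).comp ha'
  change R.kmsWeight m a ≤ C
  calc R.kmsWeight m a = ∫⁻ x, liminf
        (fun n => ENNReal.ofReal (coeff (R.toOp (an n).1) (Gpd.unit x)).re) atTop ∂m :=
      lintegral_congr fun x => (hx x).liminf_eq.symm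
    _ ≤ liminf (fun n => R.kmsWeight m (an n)) atTop :=
      lintegral_liminf_le fun n => R.measurable_diag _
    _ ≤ C := liminf_le_of_le (by isBoundedDefault) fun b hb => by
      obtain ⟨n, hn⟩ := hb.exists
      exact hn.trans (han n)

lemma kmsWeight_fin_lt_top (hm : IsCylinderConformal F β m) (X : Finset V) :
    R.kmsWeight m (R.fin X) < ∞ := by
  rw [apply_fin]
  exact ENNReal.sum_lt_top.2 fun v _ => by
    rw [kmsWeight_proj]
    exact (hm.ne_top v).lt_top

/-- Non-zero because φ_m(P_v) = m(Z(v)) and the Z(v) cover Ω_G. Densely defined because the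
compressions P_XaP_X have finite weight and converge to a. -/
lemma isProper_kmsWeight (hm : IsCylinderConformal F β m) (h0 : m ≠ 0) :
    (R.kmsWeight m).IsProper := by
  refine ⟨?_, fun a => ?_, R.lowerSemicontinuous_kmsWeight m⟩
  · by_contra! h
    refine h0 ?_
    rw [← Measure.measure_univ_eq_zero, ← iUnion_cylinder_ofVertex, measure_iUnion_null_iff]
    exact fun v => by rw [← R.kmsWeight_proj]; exact h _
  · classical
    refine mem_closure_of_tendsto (f := fun X => R.compress X a) (b := atTop)
      (tendsto_subtype_rng.2 (R.tendsto_compress a)) (Eventually.of_forall fun X => ?_)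
    exact (R.apply_le_of_fin X (R.compress_corner X a)).trans_lt
      (ENNReal.mul_lt_top ENNReal.ofReal_lt_top (R.kmsWeight_fin_lt_top hm X))

/-- With u(γ) = a(γ⁻¹)b(γ), the value φ_m(aα_t(b)) is ∫ e^{itc_F}u. The value φ_m(α_t(b)a) is the
integral of the inverted function, so the change of density under inversion inserts e^{-βc_F}, which
is the effect of replacing t by t + iβ. -/
lemma isKMS_kmsWeight (hm : IsCylinderConformal F β m) (h0 : m ≠ 0) :
    (R.kmsWeight m).IsKMS (R.action F) β := by
  refine ⟨R.isProper_kmsWeight hm h0, R.isInvariant_kmsWeight m F, fun a ha b hb => ?_⟩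
  set M := gpdMeasure F β m with hM
  let u : Gpd G → ℂ := fun γ => coeff (R.toOp a) γ.inv * coeff (R.toOp b) γ
  let k : Gpd G → ℂ := fun γ => coeff (R.toOp b) γ.inv * coeff (R.toOp a) γ
  have hcs : ∀ (c : A) γ, star (coeff (R.toOp (star c)) γ) = coeff (R.toOp c) γ.inv := by
    intro c γ
    rw [R.toOp_star, coeff_star (R.toOp_mem c), star_star]
  have huk : ∀ γ, u γ = k γ.inv := fun γ => by
    simp only [u, k, Gpd.inv_inv, mul_comm]
  have hkm : Measurable k := ((R.measurable_coeff_toOp b).comp measurable_inv).mul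
    (R.measurable_coeff_toOp a)
  have hum : Measurable u := ((R.measurable_coeff_toOp a).comp measurable_inv).mul
    (R.measurable_coeff_toOp b)
  have hu : Integrable u M := by
    refine (R.integrable_star_mul hm ha.2 hb.1).congr (Eventually.of_forall fun γ => ?_)
    simp only [hcs, u]
  have hk : Integrable k M := by
    refine (R.integrable_star_mul hm hb.2 ha.1).congr (Eventually.of_forall fun γ => ?_)
    simp only [hcs, k]
  -- Integrability with the extra factor e^{-βc_F} is integrability of u∘inv = k, a product of the
  -- square integrable coefficients of b* (conjugated) and a.
  have hu' : Integrable (fun γ => (Real.exp (-(β * cocycle F γ)) : ℂ) * u γ) M := by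
    rw [← integrable_gpdMeasure_inv hum]
    refine hk.congr (Eventually.of_forall fun γ => ?_)
    simp only [huk, Gpd.inv_inv]
  have hαb : ∀ t, R.kmsWeight m (starMulSelf (R.action F t b)) < ∞ ∧
      R.kmsWeight m (starMulSelf (star (R.action F t b))) < ∞ := by
    intro t
    refine ⟨?_, ?_⟩
    · rw [R.isInvariant_kmsWeight m F t (starMulSelf b) (starMulSelf (R.action F t b))
        (by simp only [coe_starMulSelf, map_mul, map_star])]
      exact hb.1
    · rw [R.isInvariant_kmsWeight m F t (starMulSelf (star b))
        (starMulSelf (star (R.action F t b))) (by simp only [coe_starMulSelf, map_mul, map_star])]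
      exact hb.2
  have hαc : ∀ t γ, coeff (R.toOp (R.action F t b)) γ =
      Complex.exp ((t * cocycle F γ : ℝ) * Complex.I) * coeff (R.toOp b) γ := by
    intro t γ
    rw [R.toOp_action, coeff_conjPhase F t (R.toOp_mem b)]
  refine ⟨fun z => ∫ γ, Complex.exp (Complex.I * z * cocycle F γ) * u γ ∂M,
    continuousOn_stripIntegral (measurable_cocycle F) hu hu',
    ⟨_, fun z hz => norm_stripIntegral_le hu hu' hz⟩,
    differentiableOn_stripIntegral (measurable_cocycle F) hu hu', fun t => ⟨?_, ?_⟩⟩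
  · have h1 := R.hasValue_star_mul hm ha.2 (hαb t).1
    rw [star_star] at h1
    convert h1 using 1
    refine integral_congr_ae (Eventually.of_forall fun γ => ?_)
    simp only [hcs, hαc, u]
    have h2 : Complex.I * t * cocycle F γ = (t * cocycle F γ : ℝ) * Complex.I := by
      push_cast; ring
    rw [h2]
    ring
  · have h1 := R.hasValue_star_mul hm (hαb t).2 ha.1
    rw [star_star] at h1
    convert h1 using 1
    have h2 : ∀ γ, star (coeff (R.toOp (star (R.action F t b))) γ) * coeff (R.toOp a) γ =
        (fun γ => Complex.exp ((t * cocycle F γ : ℝ) * Complex.I) * u γ) γ.inv := by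
      intro γ
      simp only [hcs, hαc, huk, Gpd.inv_inv, k]
      ring
    have h3 : Measurable fun γ => Complex.exp ((t * cocycle F γ : ℝ) * Complex.I) * u γ := by
      have := measurable_cocycle (G := G) F
      fun_prop
    rw [integral_congr_ae (Eventually.of_forall h2), integral_gpdMeasure_inv h3]
    refine integral_congr_ae (Eventually.of_forall fun γ => ?_)
    simp only
    have h4 : Complex.exp (Complex.I * (t + β * Complex.I) * cocycle F γ) =
        (Real.exp (-(β * cocycle F γ)) : ℂ) *
          Complex.exp ((t * cocycle F γ : ℝ) * Complex.I) := by
      rw [Complex.ofReal_exp, ← Complex.exp_add]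
      congr 1
      push_cast
      linear_combination ((β : ℂ) * cocycle F γ) * Complex.I_mul_I
    rw [h4, mul_assoc]

lemma isGaugeKMS_kmsWeight (hm : IsCylinderConformal F β m) (h0 : m ≠ 0) :
    R.IsGaugeKMS F β (R.kmsWeight m) :=
  ⟨R.isKMS_kmsWeight hm h0, R.isInvariant_kmsWeight m _⟩

/-- `φ_m(f) = ∫ f dm` for `f ∈ C_c(𝒢)`. -/
lemma hasValue_kmsWeight_of_isCc (hm : IsCylinderConformal F β m) {f : Gpd G → ℂ}
    (hf : IsCc G f) {a : A} (ha : IsConvOp f (R.toOp a)) :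
    Integrable (fun x => f (Gpd.unit x)) m ∧
      (R.kmsWeight m).HasValue a (∫ x, f (Gpd.unit x) ∂m) := by
  -- Writing a = P_Y(aP_X) exhibits it as a product of square integrable elements, so it has some
  -- value, and any value is the integral of the diagonal.
  obtain ⟨X, hX⟩ := exists_mul_finProj hf ha
  obtain ⟨Y, hY⟩ := exists_mul_finProj (isCc_star hf) ha.star
  have h1 : a * (R.fin X).1 = a := R.ext (by rw [R.toOp_mul, toOp_fin, hX])
  have h2 : star (R.fin Y).1 * a = a := R.ext (by
    have := congrArg star hY
    rwa [star_mul, star_star, star_finProj, ← R.toOp_fin, ← R.toOp_mul,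
      ← (R.fin Y).isSelfAdjoint.star_eq] at this)
  have hX' := Weight.sq_mem (R.kmsWeight_fin_lt_top hm X)
  have hY' := Weight.sq_mem (R.kmsWeight_fin_lt_top hm Y)
  have ha' := Weight.starMulSelf_mul_lt_top hX' a
  rw [h1] at ha'
  obtain ⟨z, hz⟩ := Weight.exists_hasValue_star_mul hY' ha'
  rw [h2] at hz
  obtain ⟨h3, h4⟩ := R.hasValue_kmsWeight hz
  rw [ha.coeff_eq] at h3 h4
  exact ⟨h3, h4 ▸ hz⟩

end GraphRep

end MeasureWeight

end GraphKMS

namespace GraphKMS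

section Main

open MeasureTheory

variable {V E : Type*} {G : EGraph V E}

/-! ### The bijections -/

namespace GraphRep

variable {A : Type*} [NonUnitalCStarAlgebra A] (R : GraphRep G A) [Countable V] [Countable E]

lemma kmsWeight_vertex (m : Measure (PathSpace G)) :
    (fun v => R.kmsWeight m (R.vertex v)) = vertexVector m :=
  funext fun v => R.kmsWeight_proj m (FinPath.ofVertex G v)

/-- Since φ_m(P_v) = m(Z(v)), injectivity is that m is determined by its vertex vector. For
surjectivity, the almost harmonic vector of φ comes from some m, and φ_m = φ because both take the
same values on the P_v. -/
lemma isAffineBij_kmsWeight (F : E → ℝ) (β : ℝ) :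
    IsAffineBij R.kmsWeight {m | IsKMSMeasure F β m ∧ m ≠ 0} {φ | R.IsGaugeKMS F β φ} := by
  refine ⟨⟨fun m hm => R.isGaugeKMS_kmsWeight hm.1.isCylinderConformal hm.2,
    fun m hm m' hm' h => ?_, fun φ hφ => ?_⟩, fun m hm m' hm' a b ha hb =>
      ⟨((isAffineBij_vertexVector F β).2 m hm m' hm' a b ha hb).1, R.kmsWeight_add_smul m m' a b⟩⟩
  · refine hm.1.isCylinderConformal.ext hm'.1.isCylinderConformal ?_
    rw [← R.kmsWeight_vertex, ← R.kmsWeight_vertex, h]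
  · obtain ⟨m, hm, e⟩ := (isAffineBij_vertexVector (G := G) F β).1.surjOn
      ⟨R.isAlmostHarmonic hφ.1, R.vertex_ne_zero hφ.1⟩
    refine ⟨m, hm, R.eq_of_vertex_eq (R.isGaugeKMS_kmsWeight hm.1.isCylinderConformal hm.2) hφ
      fun v => ?_⟩
    exact (congrFun (R.kmsWeight_vertex m) v).trans (congrFun e v)

lemma isAffineBij_vertex (F : E → ℝ) (β : ℝ) :
    IsAffineBij (fun (φ : Weight A) v => φ (R.vertex v)) {φ | R.IsGaugeKMS F β φ}
      {ψ | IsAlmostHarmonic G F β ψ ∧ ψ ≠ 0} := by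
  have hΦ := R.isAffineBij_kmsWeight F β
  refine ⟨⟨fun φ hφ => ⟨R.isAlmostHarmonic hφ.1, R.vertex_ne_zero hφ.1⟩,
    fun φ hφ φ' hφ' h => R.eq_of_vertex_eq hφ hφ' (congrFun h), fun ψ hψ => ?_⟩,
    fun φ hφ φ' hφ' a b ha hb => ⟨?_, rfl⟩⟩
  · obtain ⟨m, hm, e⟩ := (isAffineBij_vertexVector (G := G) F β).1.surjOn hψ
    exact ⟨R.kmsWeight m, hΦ.1.mapsTo hm, (R.kmsWeight_vertex m).trans e⟩
  · obtain ⟨m, hm, rfl⟩ := hΦ.1.surjOn hφ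
    obtain ⟨m', hm', rfl⟩ := hΦ.1.surjOn hφ'
    obtain ⟨h1, h2⟩ := hΦ.2 m hm m' hm' a b ha hb
    rw [← h2]
    exact hΦ.1.mapsTo h1

end GraphRep

variable (G) in
/-- `C*(G)` as an algebra of operators. -/
noncomputable def cstarRep : GraphRep G (CStarG G) where
  toOp := Subtype.val
  toOp_add _ _ := rfl
  toOp_mul _ _ := rfl
  toOp_star _ := rfl
  toOp_smul _ _ := rfl
  norm_toOp _ := rfl
  mem_iff T := ⟨fun h => ⟨⟨T, h⟩, rfl⟩, fun ⟨a, h⟩ => h ▸ a.2⟩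
  action := gaugeAction
  toOp_action _ _ _ := rfl

lemma isConvOp_vertex (v : V) :
    IsConvOp (Set.indicator (Gpd.unit '' cylinder (FinPath.ofVertex G v)) (fun _ => 1))
      ((cstarRep G).vertex v).1.1 := by
  have h := isConvOp_basicOp (FinPath.ofVertex G v) (FinPath.ofVertex G v)
  rw [basicBisection_self, ← (cstarRep G).toOp_elt] at h
  exact h

end Main

end GraphKMS

theorem theorem2p9 {V E : Type*} [Countable V] [Countable E] (G : GraphKMS.EGraph V E)
    (F : E → ℝ) (β : ℝ) :
    -- KMS measures and almost harmonic vectors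
    Set.BijOn (fun m : MeasureTheory.Measure (GraphKMS.PathSpace G) => GraphKMS.vertexVector m)
      {m | GraphKMS.IsKMSMeasure F β m} {ψ | GraphKMS.IsAlmostHarmonic G F β ψ} ∧
    -- the projections `P_v` of `C*(G)`, and the map `m ↦ φ_m`
    ∃ (P : V → GraphKMS.PosCone (GraphKMS.CStarG G))
      (Φ : MeasureTheory.Measure (GraphKMS.PathSpace G) → GraphKMS.Weight (GraphKMS.CStarG G)),
      (∀ v, GraphKMS.IsConvOp
        (Set.indicator (GraphKMS.Gpd.unit '' GraphKMS.cylinder (GraphKMS.FinPath.ofVertex G v))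
          (fun _ => 1)) (P v).1.1) ∧
      -- `φ_m(f) = ∫ f dm` for `f ∈ C_c(𝒢)`
      (∀ m, GraphKMS.IsKMSMeasure F β m → m ≠ 0 → ∀ f, GraphKMS.IsCc G f →
        ∃ T : GraphKMS.CStarG G, GraphKMS.IsConvOp f T.1 ∧
          MeasureTheory.Integrable (fun x => f (GraphKMS.Gpd.unit x)) m ∧
          (Φ m).HasValue T (∫ x, f (GraphKMS.Gpd.unit x) ∂m)) ∧
      -- the three affine bijections
      GraphKMS.IsAffineBij Φ {m | GraphKMS.IsKMSMeasure F β m ∧ m ≠ 0}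
        {φ | GraphKMS.IsGaugeKMSWeight F β φ} ∧
      GraphKMS.IsAffineBij
        (fun m : MeasureTheory.Measure (GraphKMS.PathSpace G) => GraphKMS.vertexVector m)
        {m | GraphKMS.IsKMSMeasure F β m ∧ m ≠ 0}
        {ψ | GraphKMS.IsAlmostHarmonic G F β ψ ∧ ψ ≠ 0} ∧
      GraphKMS.IsAffineBij (fun (φ : GraphKMS.Weight (GraphKMS.CStarG G)) v => φ (P v))
        {φ | GraphKMS.IsGaugeKMSWeight F β φ}
        {ψ | GraphKMS.IsAlmostHarmonic G F β ψ ∧ ψ ≠ 0} := by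
  refine ⟨GraphKMS.bijOn_vertexVector F β, (GraphKMS.cstarRep G).vertex,
    (GraphKMS.cstarRep G).kmsWeight, GraphKMS.isConvOp_vertex, fun m hm _ f hf => ?_,
    (GraphKMS.cstarRep G).isAffineBij_kmsWeight F β, GraphKMS.isAffineBij_vertexVector F β,
    (GraphKMS.cstarRep G).isAffineBij_vertex F β⟩
  obtain ⟨T, hT⟩ := GraphKMS.exists_isConvOp_cstar hf
  exact ⟨T, hT, (GraphKMS.cstarRep G).hasValue_kmsWeight_of_isCc hm.isCylinderConformal hf hT⟩
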